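/- Let $\tau\in\mathbb C$ with $\operatorname{Im}\tau>0$, let $p=e^{\mathrm i\pi\tau}$, and let $\theta_1(u|\tau)=2\sum_{k\ge 0}(-1)^kp^{(k+1/2)^2}\sin((2k+1)u)$, $\theta_3(u|\tau)=1+2\sum_{k\ge 1}p^{k^2}\cos(2ku)$, $\theta_4(u|\tau)=1+2\sum_{k\ge 1}(-1)^kp^{k^2}\cos(2ku)$ be the Jacobi theta functions. Let $n\ge 0$ be an integer and $\phi(u)=\theta_1(u|\tau)^{2n+1}$. There are constants $E_0\neq 0$ and $E$, depending only on $n$ and $\tau$ (and clearly unique), such that $$\frac{\theta_1(u|\tau)^{2n+3}}{\theta_1(3u|3\tau)^{2n}\,\theta_4(3u|3\tau)}=E_0u^3+E_0E\,u^5+\mathcal O(u^7),\qquad u\to 0,$$ and the following holds. Let $q$ be a $Q$-operator eigenvalue, that is, an entire function, not identically zero, such that for all $u\in\mathbb C$ $$\phi(u)q(u)+\phi\left(u+\tfrac{2\pi}3\right)q\left(u+\tfrac{2\pi}3\right)+\phi\left(u-\tfrac{2\pi}3\right)q\left(u-\tfrac{2\pi}3\right)=0,$$ $$q(u+2\pi)=q(-u)=q(u),\qquad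 q(u+\pi\tau)=e^{-\mathrm i(2n+1)(u+\pi\tau/2)}q(u).$$ Put $$\Phi(u,v)=\theta_3\left(\tfrac{3u}2\big|\tfrac{3\tau}2\right)\theta_4\left(\tfrac{3v}2\big|\tfrac{3\tau}2\right)q(u)q(v+\pi)-\theta_4\left(\tfrac{3u}2\big|\tfrac{3\tau}2\right)\theta_3\left(\tfrac{3v}2\big|\tfrac{3\tau}2\right)q(u+\pi)q(v),$$ $$S=(2n+3)\,q''(0)\,q\left(\tfrac\pi3\right)+(2n-1)\,q(0)\,\frac{(q\phi)''\left(\frac\pi3\right)}{\phi\left(\frac\pi3\right)}+2(2n+1)E\,q(0)\,q\left(\tfrac\pi3\right).$$ Then $$q\left(\tfrac{\pi\tau}2\right)S=3\mathrm i\,q'\left(\pi+\tfrac{\pi\tau}2\right)\Phi\left(0,\tfrac\pi3\right);$$ in particular, if $q(\pi\tau/2)\neq 0$, then $$S=3\mathrm i\,\frac{q'\left(\pi+\frac{\pi\tau}2\right)}{q\left(\frac{\pi\tau}2\right)}\,\Phi\left(0,\tfrac\pi3\right).$$ -/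

import Mathlib

open scoped Real Topology Asymptotics
open Complex (I)

namespace XYZChain

/-! The four Jacobi theta functions `θⱼ(u|τ)` with nome `p = exp(iπτ)`, written through Mathlib's
`jacobiTheta₂ z τ = ∑_{k ∈ ℤ} exp(2πikz + πik²τ)`. -/

/-- `θ₁(u|τ) = -i ∑_{k ∈ ℤ} (-1)^k p^{(k+1/2)²} e^{i(2k+1)u}
= 2 ∑_{k ≥ 0} (-1)^k p^{(k+1/2)²} sin((2k+1)u)`. -/
noncomputable def theta1 (u τ : ℂ) : ℂ :=
  -I * Complex.exp (I * u + I * π * τ / 4) * jacobiTheta₂ (u / π + 1 / 2 + τ / 2) τ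

/-- `θ₃(u|τ) = ∑_{k ∈ ℤ} p^{k²} e^{2iku} = 1 + 2 ∑_{k ≥ 1} p^{k²} cos(2ku)`. -/
noncomputable def theta3 (u τ : ℂ) : ℂ :=
  jacobiTheta₂ (u / π) τ

/-- `θ₄(u|τ) = ∑_{k ∈ ℤ} (-1)^k p^{k²} e^{2iku} = 1 + 2 ∑_{k ≥ 1} (-1)^k p^{k²} cos(2ku)`. -/
noncomputable def theta4 (u τ : ℂ) : ℂ :=
  jacobiTheta₂ (u / π + 1 / 2) τ

/-- `φ(u) = θ₁(u|τ)^L`, where `L = 2n+1` is the length of the chain. -/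
noncomputable def phi (n : ℕ) (τ u : ℂ) : ℂ :=
  theta1 u τ ^ (2 * n + 1)

/-- `q` is a `Q`-operator eigenvalue at the supersymmetric point `η = π/3`, for the chain of length
`L = 2n+1`: a nonzero entire function solving Baxter's `TQ`-relation (with `λ = φ`) that has the
required periodicity, reflection symmetry and quasi-periodicity. -/
structure IsQEigenvalue (n : ℕ) (τ : ℂ) (q : ℂ → ℂ) : Prop where
  entire : Differentiable ℂ q
  ne_zero : q ≠ 0
  tq : ∀ u, phi n τ u * q u
      + phi n τ (u + 2 * π / 3) * q (u + 2 * π / 3)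
      + phi n τ (u - 2 * π / 3) * q (u - 2 * π / 3) = 0
  periodic : ∀ u, q (u + 2 * π) = q u
  even : ∀ u, q (-u) = q u
  quasi_periodic : ∀ u,
    q (u + π * τ) = Complex.exp (-(I * (2 * n + 1) * (u + π * τ / 2))) * q u

/-- The alternant `Φ(u,v) = f₁(u) f₂(v) - f₂(u) f₁(v)`, where `f₁(u) = θ₃(3u/2|3τ/2) q(u)` and
`f₂(u) = f₁(u + π) = θ₄(3u/2|3τ/2) q(u + π)`. -/
noncomputable def bigPhi (τ : ℂ) (q : ℂ → ℂ) (u v : ℂ) : ℂ :=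
  theta3 (3 * u / 2) (3 * τ / 2) * theta4 (3 * v / 2) (3 * τ / 2) * q u * q (v + π)
    - theta4 (3 * u / 2) (3 * τ / 2) * theta3 (3 * v / 2) (3 * τ / 2) * q (u + π) * q v

/-- The theta quotient whose expansion at `u = 0` defines the constant `E`. -/
noncomputable def thetaQuotient (n : ℕ) (τ u : ℂ) : ℂ :=
  theta1 u τ ^ (2 * n + 3)
    / (theta1 (3 * u) (3 * τ) ^ (2 * n) * theta4 (3 * u) (3 * τ))

/-- The expression
`(2n+3) q''(0) q(π/3) + (2n-1) q(0) (qφ)''(π/3)/φ(π/3) + 2(2n+1) E q(0) q(π/3)`. -/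
noncomputable def quadraticForm (n : ℕ) (τ E : ℂ) (q : ℂ → ℂ) : ℂ :=
  (2 * n + 3) * iteratedDeriv 2 q 0 * q (π / 3)
    + (2 * n - 1) * q 0
      * (iteratedDeriv 2 (fun u => q u * phi n τ u) (π / 3) / phi n τ (π / 3))
    + 2 * (2 * n + 1) * E * q 0 * q (π / 3)

end XYZChain

/-! Put h = φq, V = `thetaV`, T = `thetaT` and T* = `thetaTs`, where T*(u) = T(u + π). The
TQ-relation becomes h(u) + h(u + 2π/3) + h(u - 2π/3) = 0, and every linear differential operator
with 2π/3-periodic coefficients preserves it. The operator used is `hirotaForm`. With ψ = h/(VⁿT) it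
equals VTh · (ψ''/ψ + 2(log T)'' + n(n+1)(log V)''). If its value on h were divisible by φVT, the
quotient would have all the symmetries of q and solve the TQ-relation again.

Divisibility by φ is a matter of local exponents. Divisibility by V follows from parity and the
TQ-relation. Divisibility by T fails: at π + πτ/2 both T and q vanish, and the form takes the value
-2VT'φq'. The function VφT*q(· + π) obeys the same relation with the same multipliers, and at that
point it is a multiple of q(πτ/2). Jacobi's derivative formula (`thetaDeriv_eq`,
`two_mul_deriv_thetaT`) evaluates T' there, so the explicit combination `balancedForm` vanishes at
all zeros of T. Its quotient x by φVT is a solution (`IsSolution.exists_reducedBalancedForm_eq`).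

Solutions are unique up to a scalar (`IsSolution.cross_eq`), hence x(0)q(π/3) = q(0)x(π/3). Since V
has simple zeros at 0 and π/3, both values of x are read off from first derivatives. The theta
constants collect to 2(2n+1)E and the terms with q'(π + πτ/2) to Φ(0, π/3).

Uniqueness uses two Wronskians. The difference Wronskian of two solutions is φ(u - 2π/3) times a
constant that changes sign under u ↦ u + πτ, so it vanishes and the ratio of the solutions is
2π/3-periodic. A linear combination y can therefore be made to vanish at u₀ and u₀ ± 2π/3. The
differential Wronskian of shifts of φy, divided by V²ⁿ, is an even theta function of order two with
a double zero at u₀ and a zero at -u₀, so it is identically zero, which forces y = 0.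

All theta identities rest on one principle: entire functions with equal multipliers and matching
simple zeros are proportional, by Liouville's theorem. -/

namespace XYZChain

/-! ### Entire functions: division, Liouville's theorem, cancellation -/

/-- Division of entire functions: `g` has only simple zeros and `f` vanishes at each of them. -/
theorem exists_entire_quotient {f g : ℂ → ℂ} (hf : Differentiable ℂ f) (hg : Differentiable ℂ g)
    (hz : ∀ z, g z = 0 → f z = 0 ∧ deriv g z ≠ 0) :
    ∃ k : ℂ → ℂ, Differentiable ℂ k ∧ ∀ z, f z = g z * k z := by
  classical
  refine ⟨fun z => if g z = 0 then deriv f z / deriv g z else f z / g z, ?_, ?_⟩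
  · intro z
    by_cases h0 : g z = 0
    · obtain ⟨hfz, hgz⟩ := hz z h0
      have hdf : DifferentiableAt ℂ (dslope f z) z :=
        ((Complex.differentiableOn_dslope Filter.univ_mem).2 hf.differentiableOn).differentiableAt
          Filter.univ_mem
      have hdg : DifferentiableAt ℂ (dslope g z) z :=
        ((Complex.differentiableOn_dslope Filter.univ_mem).2 hg.differentiableOn).differentiableAt
          Filter.univ_mem
      have hg0 : dslope g z z ≠ 0 := by rwa [dslope_same]
      -- Near z both functions are (w - z) times their `dslope`, so the quotient of the slopes
      -- extends f/g through the zero.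
      refine (hdf.div hdg hg0).congr_of_eventuallyEq ?_
      filter_upwards [hdg.continuousAt.eventually_ne hg0] with w hw
      have e1 : ∀ F : ℂ → ℂ, F z = 0 → (w - z) * dslope F z w = F w := by
        intro F hF
        have := sub_smul_dslope F z w
        simpa [hF, smul_eq_mul] using this
      by_cases hwz : w = z
      · subst hwz
        simp [h0, dslope_same]
      · have hwz' : w - z ≠ 0 := sub_ne_zero.2 hwz
        have hgw : g w ≠ 0 := by
          rw [← e1 g h0]; exact mul_ne_zero hwz' hw
        simp only [hgw, if_false, Pi.div_apply]
        rw [← e1 g h0, ← e1 f hfz]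
        field_simp
    · refine ((hf z).div (hg z) h0).congr_of_eventuallyEq ?_
      filter_upwards [(hg z).continuousAt.eventually_ne h0] with w hw
      simp [hw]
  · intro z
    by_cases h0 : g z = 0
    · simp [h0, (hz z h0).1]
    · simp only [h0, if_false]
      field_simp

/-- A bound on a fundamental parallelogram is a global bound, and Liouville's theorem applies.
Asking only for periodic norms also admits multipliers such as -1. -/
theorem entire_eq_const_of_norm_periodic {h : ℂ → ℂ} (hh : Differentiable ℂ h) {a : ℝ} (ha : 0 < a)
    {b : ℂ} (hb : 0 < b.im) (h1 : ∀ z, ‖h (z + a)‖ = ‖h z‖) (h2 : ∀ z, ‖h (z + b)‖ = ‖h z‖)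
    (z w : ℂ) : h z = h w := by
  have H1 : ∀ (k : ℤ) (z : ℂ), ‖h (z + k * a)‖ = ‖h z‖ := by
    intro k z
    have : Function.Periodic (fun z => ‖h z‖) (a : ℂ) := h1
    simpa using this.int_mul k z
  have H2 : ∀ (k : ℤ) (z : ℂ), ‖h (z + k * b)‖ = ‖h z‖ := by
    intro k z
    have : Function.Periodic (fun z => ‖h z‖) b := h2
    simpa using this.int_mul k z
  have hK : IsCompact (Set.Icc 0 a ×ℂ Set.Icc 0 b.im) := isCompact_Icc.reProdIm isCompact_Icc
  obtain ⟨C, hC⟩ := hK.exists_bound_of_continuousOn hh.continuous.continuousOn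
  refine hh.apply_eq_apply_of_bounded ?_ z w
  refine (Metric.isBounded_closedBall (x := (0 : ℂ)) (r := C)).subset ?_
  rintro _ ⟨z, rfl⟩
  rw [mem_closedBall_zero_iff]
  -- The imaginary part is reduced first; the later real translation does not disturb it.
  set z1 : ℂ := z + (-⌊z.im / b.im⌋ : ℤ) * b with hz1
  set z2 : ℂ := z1 + (-⌊z1.re / a⌋ : ℤ) * a with hz2
  have e : ‖h z2‖ = ‖h z‖ := by rw [hz2, H1, hz1, H2]
  rw [← e]
  apply hC
  have i1 : z1.im = z.im - ⌊z.im / b.im⌋ * b.im := by simp [hz1, sub_eq_add_neg]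
  have i2 : z2.im = z1.im := by simp [hz2]
  have r2 : z2.re = z1.re - ⌊z1.re / a⌋ * a := by simp [hz2, sub_eq_add_neg]
  have k1 := Int.floor_le (z.im / b.im)
  have k2 := (Int.lt_floor_add_one (z.im / b.im)).le
  have k3 := Int.floor_le (z1.re / a)
  have k4 := (Int.lt_floor_add_one (z1.re / a)).le
  rw [le_div_iff₀ hb] at k1
  rw [div_le_iff₀ hb] at k2
  rw [le_div_iff₀ ha] at k3
  rw [div_le_iff₀ ha] at k4
  rw [Complex.mem_reProdIm, i2, i1, r2]
  constructor <;> constructor <;> linarith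

theorem entire_eq_zero_of_eventually {f : ℂ → ℂ} (hf : Differentiable ℂ f) {z : ℂ}
    (h : ∀ᶠ w in 𝓝 z, f w = 0) : ∀ w, f w = 0 := by
  have ha : AnalyticOnNhd ℂ f Set.univ := fun w _ => hf.analyticAt w
  intro w
  exact ha.eqOn_zero_of_preconnected_of_eventuallyEq_zero isPreconnected_univ (Set.mem_univ z) h
    (Set.mem_univ w)

theorem entire_mul_cancel {f g : ℂ → ℂ} (hf : Differentiable ℂ f) (hg : Differentiable ℂ g)
    {z₀ : ℂ} (hz : g z₀ ≠ 0) (h : ∀ z, f z * g z = 0) : ∀ z, f z = 0 := by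
  refine entire_eq_zero_of_eventually hf (z := z₀) ?_
  filter_upwards [(hg z₀).continuousAt.eventually_ne hz] with w hw
  exact (mul_eq_zero.1 (h w)).resolve_right hw

theorem entire_mul_cancel' {f₁ f₂ g : ℂ → ℂ} (hf₁ : Differentiable ℂ f₁) (hf₂ : Differentiable ℂ f₂)
    (hg : Differentiable ℂ g) {z₀ : ℂ} (hz : g z₀ ≠ 0) (h : ∀ z, g z * f₁ z = g z * f₂ z) :
    ∀ z, f₁ z = f₂ z := by
  intro z
  have := entire_mul_cancel (f := fun z => f₁ z - f₂ z) (hf₁.sub hf₂) hg hz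
    (fun z => by linear_combination h z) z
  exact sub_eq_zero.1 this

/-- Finitely many entire functions which do not vanish identically have a common nonzero. -/
theorem exists_mul_ne_zero {f g : ℂ → ℂ} (hf : Differentiable ℂ f) (hg : Differentiable ℂ g)
    (h1 : ∃ z, f z ≠ 0) (h2 : ∃ z, g z ≠ 0) : ∃ z, f z * g z ≠ 0 := by
  by_contra! h
  obtain ⟨z, hz⟩ := h2
  obtain ⟨w, hw⟩ := h1
  exact hw (entire_mul_cancel hf hg hz h w)

/-- Entire functions with vanishing Wronskian are proportional. -/
theorem entire_proportional {a b : ℂ → ℂ} (ha : Differentiable ℂ a) (hb : Differentiable ℂ b)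
    {z₀ : ℂ} (hz : b z₀ ≠ 0) (h : ∀ z, deriv a z * b z = a z * deriv b z) :
    ∀ z, a z = a z₀ / b z₀ * b z := by
  have hev : ∀ᶠ w in 𝓝 z₀, b w ≠ 0 := (hb z₀).continuousAt.eventually_ne hz
  obtain ⟨r, hr, hball⟩ := Metric.eventually_nhds_iff_ball.1 hev
  have hconst : ∀ w ∈ Metric.ball z₀ r, a w / b w = a z₀ / b z₀ := by
    intro w hw
    have hd : DifferentiableOn ℂ (fun w => a w / b w) (Metric.ball z₀ r) := fun w hw =>
      ((ha w).div (hb w) (hball w hw)).differentiableWithinAt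
    refine Metric.isOpen_ball.is_const_of_deriv_eq_zero
      (convex_ball z₀ r).isPreconnected hd ?_ hw (Metric.mem_ball_self hr)
    intro w hw
    rw [deriv_fun_div (ha w) (hb w) (hball w hw), h w]
    simp
  intro z
  have := entire_eq_zero_of_eventually (f := fun z => a z - a z₀ / b z₀ * b z)
    (ha.sub (hb.const_mul _)) (z := z₀) ?_ z
  · exact sub_eq_zero.1 this
  · filter_upwards [Metric.ball_mem_nhds z₀ hr] with w hw
    rw [← hconst w hw, div_mul_cancel₀ _ (hball w hw), sub_self]

/-! ### An infinite product with the zeros of the theta function -/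

/-- The infinite product `∏_{k ≥ 0} (1 + p^{2k+1} x)`. -/
noncomputable def oddProd (p x : ℂ) : ℂ := ∏' k : ℕ, (1 + p ^ (2 * k + 1) * x)

theorem summable_norm_oddProd {p : ℂ} (hp : ‖p‖ < 1) (x : ℂ) :
    Summable fun k : ℕ => ‖p ^ (2 * k + 1) * x‖ := by
  have h : Summable fun k : ℕ => (‖p‖ ^ 2) ^ k :=
    summable_geometric_of_lt_one (by positivity) (by nlinarith [norm_nonneg p])
  refine (h.mul_left (‖p‖ * ‖x‖)).congr fun k => ?_
  rw [norm_mul, norm_pow]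
  ring

theorem differentiable_oddProd {p : ℂ} (hp : ‖p‖ < 1) : Differentiable ℂ (oddProd p) := by
  have h : MultipliableLocallyUniformlyOn (fun (k : ℕ) x => 1 + p ^ (2 * k + 1) * x)
      (Set.univ : Set ℂ) := by
    use fun x ↦ ∏' n, (1 + p ^ (2 * n + 1) * x)
    apply hasProdLocallyUniformlyOn_of_forall_compact isOpen_univ
    intro K hK hcK
    obtain ⟨C, hC⟩ := hcK.exists_bound_of_continuousOn (f := fun x : ℂ => x) (by fun_prop)
    refine ((summable_norm_oddProd hp (C : ℂ))).hasProdUniformlyOn_nat_one_add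
      hcK (.of_forall fun n x hx ↦ ?_) (fun _ ↦ by fun_prop)
    rw [norm_mul, norm_mul]
    gcongr
    exact (hC x hx).trans (by simpa using le_abs_self C)
  have := h.hasProdLocallyUniformlyOn.differentiableOn
    (.of_forall fun _ ↦ by simpa [Finset.prod_fn] using
      DifferentiableOn.finsetProd (fun _ _ ↦ by fun_prop)) isOpen_univ
  intro x
  exact (this x (Set.mem_univ x)).differentiableAt Filter.univ_mem

theorem oddProd_ne_zero {p x : ℂ} (hp : ‖p‖ < 1) (h : ∀ k : ℕ, 1 + p ^ (2 * k + 1) * x ≠ 0) :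
    oddProd p x ≠ 0 :=
  tprod_one_add_ne_zero_of_summable h (summable_norm_oddProd hp x)

theorem oddProd_eq {p : ℂ} (hp : ‖p‖ < 1) (x : ℂ) :
    oddProd p x = (1 + p * x) * oddProd p (p ^ 2 * x) := by
  have hm : Multipliable fun k : ℕ => (1 + p ^ (2 * (k + 1) + 1) * x) := by
    refine multipliable_one_add_of_summable ?_
    refine (summable_norm_oddProd hp (p ^ 2 * x)).congr fun k => ?_
    congr 1; ring
  have h1 : oddProd p x = (1 + p ^ (2 * 0 + 1) * x) * ∏' k : ℕ, (1 + p ^ (2 * (k + 1) + 1) * x) :=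
    tprod_eq_zero_mul' hm
  have h2 : ∏' k : ℕ, (1 + p ^ (2 * (k + 1) + 1) * x) = oddProd p (p ^ 2 * x) :=
    tprod_congr fun k => by ring
  rw [h1, h2, mul_zero, zero_add, pow_one]

/-- The product `∏_{k ≥ 0} (1 + p^{2k+1} e^{2πiz}) (1 + p^{2k+1} e^{-2πiz})` with `p = e^{iπτ}`. -/
noncomputable def thetaProd (z τ : ℂ) : ℂ :=
  oddProd (Complex.exp (I * π * τ)) (Complex.exp (2 * π * I * z))
    * oddProd (Complex.exp (I * π * τ)) (Complex.exp (-(2 * π * I * z)))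

theorem norm_nome_lt_one {τ : ℂ} (hτ : 0 < τ.im) : ‖Complex.exp (I * π * τ)‖ < 1 := by
  rw [Complex.norm_exp, Real.exp_lt_one_iff]
  have : (I * π * τ).re = -(π * τ.im) := by simp
  rw [this]
  have := mul_pos Real.pi_pos hτ
  linarith

theorem differentiable_thetaProd {τ : ℂ} (hτ : 0 < τ.im) :
    Differentiable ℂ (fun z => thetaProd z τ) := by
  have h := differentiable_oddProd (norm_nome_lt_one hτ)
  unfold thetaProd
  exact (h.comp (g := oddProd _) (f := fun z : ℂ => Complex.exp (2 * π * I * z)) (by fun_prop)).mul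
    (h.comp (g := oddProd _) (f := fun z : ℂ => Complex.exp (-(2 * π * I * z))) (by fun_prop))

theorem thetaProd_add_one (z τ : ℂ) : thetaProd (z + 1) τ = thetaProd z τ := by
  unfold thetaProd
  rw [show 2 * π * I * (z + 1) = 2 * π * I * z + 2 * π * I by ring, Complex.exp_periodic,
    show -(2 * π * I * z + 2 * π * I) = -(2 * π * I * z) - 2 * π * I by ring,
    Complex.exp_periodic.sub_eq]

/-- The shift by τ moves one factor from one product to the other; the ratio of the two factors
exchanged is the multiplier. -/
theorem thetaProd_add_tau (z : ℂ) {τ : ℂ} (hτ : 0 < τ.im) :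
    thetaProd (z + τ) τ = Complex.exp (-(π * I * (τ + 2 * z))) * thetaProd z τ := by
  have hp := norm_nome_lt_one hτ
  unfold thetaProd
  set p := Complex.exp (I * π * τ) with hpdef
  rw [oddProd_eq hp (Complex.exp (2 * π * I * z)), oddProd_eq hp (Complex.exp (-(2 * π * I * (z + τ))))]
  have e1 : Complex.exp (2 * π * I * (z + τ)) = p ^ 2 * Complex.exp (2 * π * I * z) := by
    rw [hpdef, ← Complex.exp_nat_mul, ← Complex.exp_add]; congr 1; push_cast; ring
  have e2 : p ^ 2 * Complex.exp (-(2 * π * I * (z + τ))) = Complex.exp (-(2 * π * I * z)) := by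
    rw [hpdef, ← Complex.exp_nat_mul, ← Complex.exp_add]; congr 1; push_cast; ring
  have e3 : p * Complex.exp (-(2 * π * I * (z + τ))) = Complex.exp (-(π * I * (τ + 2 * z))) := by
    rw [hpdef, ← Complex.exp_add]; congr 1; ring
  have e4 : 1 + p * Complex.exp (-(2 * π * I * (z + τ))) =
      Complex.exp (-(π * I * (τ + 2 * z))) * (1 + p * Complex.exp (2 * π * I * z)) := by
    have e5 : Complex.exp (-(π * I * (τ + 2 * z))) * (p * Complex.exp (2 * π * I * z)) = 1 := by
      rw [hpdef, ← Complex.exp_add, ← Complex.exp_add, ← Complex.exp_zero]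
      congr 1; ring
    rw [e3]
    linear_combination -e5
  rw [e1, e2, e4]
  ring

theorem eq_of_oddProd_eq_zero {z τ : ℂ} (hτ : 0 < τ.im)
    (h : oddProd (Complex.exp (I * π * τ)) (Complex.exp (2 * π * I * z)) = 0) :
    ∃ m n : ℤ, z = 1 / 2 + τ / 2 + m + n * τ := by
  by_contra! hne
  refine oddProd_ne_zero (norm_nome_lt_one hτ) (fun k hk => ?_) h
  have h1 : Complex.exp (I * π * τ) ^ (2 * k + 1) * Complex.exp (2 * π * I * z)
      = Complex.exp (π * I) := by
    rw [Complex.exp_pi_mul_I]; linear_combination hk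
  rw [← Complex.exp_nat_mul, ← Complex.exp_add, Complex.exp_eq_exp_iff_exists_int] at h1
  obtain ⟨m, hm⟩ := h1
  apply hne m (-(k + 1))
  have hpi : (π : ℂ) * I ≠ 0 := mul_ne_zero (by exact_mod_cast Real.pi_ne_zero) Complex.I_ne_zero
  push_cast at hm ⊢
  apply mul_left_cancel₀ hpi
  linear_combination (1 / 2) * hm

theorem eq_of_thetaProd_eq_zero {z τ : ℂ} (hτ : 0 < τ.im) (h : thetaProd z τ = 0) :
    ∃ m n : ℤ, z = 1 / 2 + τ / 2 + m + n * τ := by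
  rcases mul_eq_zero.1 h with h | h
  · exact eq_of_oddProd_eq_zero hτ h
  · rw [show -(2 * π * I * z) = 2 * π * I * (-z) by ring] at h
    obtain ⟨m, n, hmn⟩ := eq_of_oddProd_eq_zero hτ h
    refine ⟨-m - 1, -n - 1, ?_⟩
    push_cast
    linear_combination -hmn

/-- A function satisfying a multiplicative (quasi-)periodicity keeps its order-one zeros. -/
theorem deriv_ne_zero_of_quasi {f e : ℂ → ℂ} (hf : Differentiable ℂ f) (he : Differentiable ℂ e)
    {c z : ℂ} (h : ∀ u, f (u + c) = e u * f u) (hez : e z ≠ 0) (hz : f z = 0) :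
    deriv f (z + c) ≠ 0 ↔ deriv f z ≠ 0 := by
  have h1 : deriv (fun u => f (u + c)) z = deriv (fun u => e u * f u) z := by
    congr 1; funext u; exact h u
  rw [deriv_comp_add_const, deriv_fun_mul (he z) (hf z), hz] at h1
  rw [h1]; simp [hez]

theorem exists_int_shift_induction {P : ℂ → Prop} {a b z₀ : ℂ} (h0 : P z₀)
    (ha : ∀ z, P (z + a) ↔ P z) (hb : ∀ z, P (z + b) ↔ P z) (m n : ℤ) : P (z₀ + m * a + n * b) := by
  have H : ∀ (c : ℂ), (∀ z, P (z + c) ↔ P z) → ∀ (m : ℤ) z, P (z + m * c) ↔ P z := by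
    intro c hc m
    induction m using Int.induction_on with
    | zero => simp
    | succ k ih =>
      intro z
      rw [← ih z, ← hc (z + (k : ℤ) * c)]; push_cast; ring_nf
    | pred k ih =>
      intro z
      rw [← ih z, ← hc (z + ((-k - 1 : ℤ)) * c)]; push_cast; ring_nf
  rw [H b hb, H a ha]; exact h0

theorem thetaProd_simple_zero {τ : ℂ} (hτ : 0 < τ.im) :
    thetaProd (1 / 2 + τ / 2) τ = 0 ∧ deriv (fun z => thetaProd z τ) (1 / 2 + τ / 2) ≠ 0 := by
  have hp := norm_nome_lt_one hτ
  set p := Complex.exp (I * π * τ) with hpdef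
  have hp0 : p ≠ 0 := Complex.exp_ne_zero _
  have hA := differentiable_oddProd hp
  -- The zero sits in the k = 0 factor of the second product, split off here. The remaining factors
  -- equal `oddProd p (-p)` twice at this point.
  have hfac : (fun z => thetaProd z τ) = fun z => (1 + p * Complex.exp (-(2 * π * I * z))) *
      (oddProd p (Complex.exp (2 * π * I * z)) * oddProd p (p ^ 2 * Complex.exp (-(2 * π * I * z)))) := by
    funext z
    rw [thetaProd, ← hpdef, oddProd_eq hp (Complex.exp (-(2 * π * I * z)))]
    ring
  have ex : Complex.exp (2 * π * I * (1 / 2 + τ / 2)) = -p := by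
    rw [show 2 * π * I * (1 / 2 + τ / 2) = π * I + I * π * τ by ring, Complex.exp_add,
      Complex.exp_pi_mul_I]; ring
  have ey : p * Complex.exp (-(2 * π * I * (1 / 2 + τ / 2))) = -1 := by
    rw [Complex.exp_neg, ex]; field_simp
  have hz : 1 + p * Complex.exp (-(2 * π * I * (1 / 2 + τ / 2))) = 0 := by rw [ey]; ring
  have hnz : oddProd p (-p) ≠ 0 := by
    refine oddProd_ne_zero hp fun k hk => ?_
    have : p ^ (2 * k + 2) = 1 := by linear_combination -hk
    have h2 : ‖p‖ ^ (2 * k + 2) = 1 := by rw [← norm_pow, this, norm_one]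
    exact absurd h2 (pow_lt_one₀ (norm_nonneg _) hp (by omega)).ne
  refine ⟨by rw [show thetaProd (1 / 2 + τ / 2) τ = _ from congrFun hfac _, hz, zero_mul], ?_⟩
  rw [hfac, deriv_fun_mul (by fun_prop) (by fun_prop), hz, zero_mul, add_zero]
  have hd : deriv (fun z => 1 + p * Complex.exp (-(2 * π * I * z))) (1 / 2 + τ / 2)
      = 2 * π * I := by
    have : HasDerivAt (fun z => 1 + p * Complex.exp (-(2 * π * I * z)))
        (p * (Complex.exp (-(2 * π * I * (1 / 2 + τ / 2))) * -(2 * π * I * 1))) (1 / 2 + τ / 2) :=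
      (((((hasDerivAt_id _).const_mul (2 * π * I)).neg).cexp).const_mul p).const_add 1
    rw [this.deriv]
    linear_combination (-(2 * π * I)) * ey
  rw [hd, ex, show p ^ 2 * Complex.exp (-(2 * π * I * (1 / 2 + τ / 2))) = -p by
    linear_combination p * ey]
  refine mul_ne_zero (mul_ne_zero (mul_ne_zero two_ne_zero ?_) Complex.I_ne_zero)
    (mul_ne_zero hnz hnz)
  exact_mod_cast Real.pi_ne_zero

/-! ### Zeros of `jacobiTheta₂` -/

theorem differentiable_jacobiTheta₂ {τ : ℂ} (hτ : 0 < τ.im) :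
    Differentiable ℂ (fun z => jacobiTheta₂ z τ) := fun z => differentiableAt_jacobiTheta₂_fst z hτ

theorem jacobiTheta₂_add_tau (z τ : ℂ) :
    jacobiTheta₂ (z + τ) τ = Complex.exp (-(π * I * (τ + 2 * z))) * jacobiTheta₂ z τ := by
  rw [jacobiTheta₂_add_left']; congr 2; ring

/-- Evenness and the two translation laws send the half period to itself with multiplier -1. -/
theorem jacobiTheta₂_half_eq_zero (τ : ℂ) : jacobiTheta₂ (1 / 2 + τ / 2) τ = 0 := by
  have h1 : jacobiTheta₂ (1 / 2 + τ / 2) τ = jacobiTheta₂ (-(1 / 2 + τ / 2) + τ + 1) τ := by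
    congr 1; ring
  rw [jacobiTheta₂_add_left, jacobiTheta₂_add_tau, jacobiTheta₂_neg_left] at h1
  rw [show -(π * I * (τ + 2 * (-(1 / 2 + τ / 2)))) = π * I by ring, Complex.exp_pi_mul_I] at h1
  linear_combination (1 / 2) * h1

/-- Only the constant Fourier mode survives. This certifies that the theta function is not
identically zero. -/
theorem integral_jacobiTheta₂ {τ : ℂ} (hτ : 0 < τ.im) :
    ∫ x in (0 : ℝ)..1, jacobiTheta₂ x τ = 1 := by
  have hs : Summable fun n : ℤ => ‖jacobiTheta₂_term n 0 τ‖ :=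
    (summable_jacobiTheta₂_term_iff 0 τ).2 hτ |>.norm
  have hn : ∀ (n : ℤ) (x : ℝ), ‖jacobiTheta₂_term n x τ‖ = ‖jacobiTheta₂_term n 0 τ‖ := by
    intro n x; simp [norm_jacobiTheta₂_term]
  have hc : ∀ n : ℤ, Continuous fun x : ℝ => jacobiTheta₂_term n x τ := by
    intro n; unfold jacobiTheta₂_term; fun_prop
  have key := intervalIntegral.hasSum_integral_of_dominated_convergence (μ := MeasureTheory.volume)
    (a := 0) (b := 1) (F := fun (n : ℤ) (x : ℝ) => jacobiTheta₂_term n x τ)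
    (f := fun x : ℝ => jacobiTheta₂ x τ)
    (fun n _ => ‖jacobiTheta₂_term n 0 τ‖) (fun n => (hc n).aestronglyMeasurable)
    (fun n => .of_forall fun x _ => (hn n x).le) (.of_forall fun x _ => hs)
    (by simp) (.of_forall fun x _ => hasSum_jacobiTheta₂_term x hτ)
  have hint : ∀ n : ℤ, ∫ x in (0 : ℝ)..1, jacobiTheta₂_term n x τ = if n = 0 then 1 else 0 := by
    intro n
    unfold jacobiTheta₂_term
    split_ifs with h
    · simp [h]
    · have hc : (2 * π * I * n : ℂ) ≠ 0 := by
        simp [h, Real.pi_ne_zero]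
      simp_rw [Complex.exp_add]
      rw [intervalIntegral.integral_mul_const, integral_exp_mul_complex hc]
      have : Complex.exp (2 * π * I * n) = 1 := by
        rw [mul_comm]; exact Complex.exp_int_mul_two_pi_mul_I n
      simp [this]
  simp_rw [hint] at key
  exact key.unique (hasSum_ite_eq 0 1)

theorem exists_jacobiTheta₂_ne_zero {τ : ℂ} (hτ : 0 < τ.im) : ∃ z, jacobiTheta₂ z τ ≠ 0 := by
  by_contra! h
  have := integral_jacobiTheta₂ hτ
  simp [h] at this

theorem quotient_quasi_periodic {f g k e ε : ℂ → ℂ}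
    (hg : Differentiable ℂ g) (hk : Differentiable ℂ k) (hε : Differentiable ℂ ε)
    (he : ∀ z, e z ≠ 0) {c : ℂ}
    (h : ∀ z, f z = g z * k z) (hfc : ∀ z, f (z + c) = ε z * e z * f z)
    (hgc : ∀ z, g (z + c) = e z * g z) {z₀ : ℂ} (hz₀ : g z₀ ≠ 0) : ∀ z, k (z + c) = ε z * k z := by
  refine entire_mul_cancel' (f₁ := fun z => k (z + c)) (g := g) (by fun_prop)
    (by fun_prop) hg hz₀ fun z => ?_
  have h1 := h (z + c)
  rw [hfc, hgc, h z] at h1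
  refine mul_left_cancel₀ (he z) ?_
  linear_combination -h1

/-- Jacobi's triple product up to a constant. The simple zeros of the product are zeros of the
series and the multipliers agree, so the quotient is entire and doubly periodic. The zero set and
its simplicity are then inherited from the product. -/
theorem exists_jacobiTheta₂_eq_thetaProd {τ : ℂ} (hτ : 0 < τ.im) :
    ∃ c : ℂ, c ≠ 0 ∧ ∀ z, jacobiTheta₂ z τ = c * thetaProd z τ := by
  have hP := differentiable_thetaProd hτ
  have hJ := differentiable_jacobiTheta₂ hτ
  obtain ⟨h0, h1⟩ := thetaProd_simple_zero hτ
  have he : Differentiable ℂ fun z => Complex.exp (-(π * I * (τ + 2 * z))) := by fun_prop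
  have hzero : ∀ z, thetaProd z τ = 0 →
      jacobiTheta₂ z τ = 0 ∧ deriv (fun z => thetaProd z τ) z ≠ 0 := by
    intro z hz
    obtain ⟨m, n, rfl⟩ := eq_of_thetaProd_eq_zero hτ hz
    have := exists_int_shift_induction (P := fun z => thetaProd z τ = 0 ∧ jacobiTheta₂ z τ = 0 ∧
      deriv (fun z => thetaProd z τ) z ≠ 0) (a := 1) (b := τ) (z₀ := 1 / 2 + τ / 2)
      ⟨h0, jacobiTheta₂_half_eq_zero τ, h1⟩ ?_ ?_ m n
    · rw [mul_one] at this; exact this.2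
    · intro z
      rw [thetaProd_add_one, jacobiTheta₂_add_left]
      refine and_congr_right fun hz => and_congr_right fun _ => ?_
      exact deriv_ne_zero_of_quasi hP (e := fun _ => 1) (by fun_prop)
        (fun u => by rw [thetaProd_add_one, one_mul]) one_ne_zero hz
    · intro z
      rw [thetaProd_add_tau z hτ, jacobiTheta₂_add_tau, mul_eq_zero, mul_eq_zero]
      simp only [Complex.exp_ne_zero, false_or]
      refine and_congr_right fun hz => and_congr_right fun _ => ?_
      exact deriv_ne_zero_of_quasi hP he (fun u => thetaProd_add_tau u hτ)
        (Complex.exp_ne_zero _) hz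
  obtain ⟨k, hk, hfk⟩ := exists_entire_quotient hJ hP hzero
  obtain ⟨z₀, hz₀⟩ := exists_jacobiTheta₂_ne_zero hτ
  have hz₀' : thetaProd z₀ τ ≠ 0 := fun h => hz₀ (by rw [hfk z₀, h, zero_mul])
  have k1 := quotient_quasi_periodic hP hk (e := fun _ => 1) (ε := fun _ => 1) (c := 1)
    (by fun_prop) (by simp)
    hfk (fun z => by simp [jacobiTheta₂_add_left]) (fun z => by simp [thetaProd_add_one]) hz₀'
  have k2 := quotient_quasi_periodic hP hk (e := fun z => Complex.exp (-(π * I * (τ + 2 * z))))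
    (ε := fun _ => 1) (c := τ) (by fun_prop) (by simp)
    hfk (fun z => by rw [jacobiTheta₂_add_tau, one_mul]) (fun z => thetaProd_add_tau z hτ) hz₀'
  have hconst := entire_eq_const_of_norm_periodic hk (a := 1) one_pos hτ
    (fun z => by rw [Complex.ofReal_one, k1, one_mul]) (fun z => by rw [k2, one_mul])
  refine ⟨k 0, fun h => hz₀ ?_, fun z => by rw [hfk z, hconst z 0, mul_comm]⟩
  rw [hfk z₀, hconst z₀ 0, h, mul_zero]

theorem eq_of_jacobiTheta₂_eq_zero {z τ : ℂ} (hτ : 0 < τ.im) (h : jacobiTheta₂ z τ = 0) :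
    ∃ m n : ℤ, z = 1 / 2 + τ / 2 + m + n * τ := by
  obtain ⟨c, hc, hJ⟩ := exists_jacobiTheta₂_eq_thetaProd hτ
  rw [hJ, mul_eq_zero] at h
  exact eq_of_thetaProd_eq_zero hτ (h.resolve_left hc)

theorem jacobiTheta₂_eq_zero_iff {z τ : ℂ} (hτ : 0 < τ.im) :
    jacobiTheta₂ z τ = 0 ↔ ∃ m n : ℤ, z = 1 / 2 + τ / 2 + m + n * τ := by
  refine ⟨eq_of_jacobiTheta₂_eq_zero hτ, ?_⟩
  rintro ⟨m, n, rfl⟩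
  have := exists_int_shift_induction (P := fun z => jacobiTheta₂ z τ = 0) (a := 1) (b := τ)
    (jacobiTheta₂_half_eq_zero τ) (fun z => by rw [jacobiTheta₂_add_left])
    (fun z => by rw [jacobiTheta₂_add_tau]; simp [Complex.exp_ne_zero]) m n
  rwa [mul_one] at this

theorem deriv_jacobiTheta₂_ne_zero {z τ : ℂ} (hτ : 0 < τ.im) (h : jacobiTheta₂ z τ = 0) :
    deriv (fun z => jacobiTheta₂ z τ) z ≠ 0 := by
  have hJ := differentiable_jacobiTheta₂ hτ
  obtain ⟨m, n, rfl⟩ := eq_of_jacobiTheta₂_eq_zero hτ h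
  have h1 : deriv (fun z => jacobiTheta₂ z τ) (1 / 2 + τ / 2) ≠ 0 := by
    obtain ⟨c, hc, hJ⟩ := exists_jacobiTheta₂_eq_thetaProd hτ
    rw [show (fun z => jacobiTheta₂ z τ) = fun z => c * thetaProd z τ from funext hJ,
      deriv_const_mul _ (differentiable_thetaProd hτ _)]
    exact mul_ne_zero hc (thetaProd_simple_zero hτ).2
  have := exists_int_shift_induction (P := fun z => jacobiTheta₂ z τ = 0 ∧
      deriv (fun z => jacobiTheta₂ z τ) z ≠ 0) (a := 1) (b := τ) (z₀ := 1 / 2 + τ / 2)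
      ⟨jacobiTheta₂_half_eq_zero τ, h1⟩ ?_ ?_ m n
  · rw [mul_one] at this; exact this.2
  · intro z
    rw [jacobiTheta₂_add_left]
    refine and_congr_right fun hz => ?_
    exact deriv_ne_zero_of_quasi hJ (e := fun _ => 1) (by fun_prop)
      (fun u => by rw [jacobiTheta₂_add_left, one_mul]) one_ne_zero hz
  · intro z
    rw [jacobiTheta₂_add_tau, mul_eq_zero]
    simp only [Complex.exp_ne_zero, false_or]
    refine and_congr_right fun hz => ?_
    exact deriv_ne_zero_of_quasi hJ (e := fun z => Complex.exp (-(π * I * (τ + 2 * z))))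
      (by fun_prop) (fun u => jacobiTheta₂_add_tau u τ) (Complex.exp_ne_zero _) hz

/-! ### Landen-type formulas and Jacobi's derivative formula -/

theorem hasSum_prod_mul {f g : ℤ → ℂ} {a b : ℂ} (hf : HasSum f a) (hg : HasSum g b) :
    HasSum (fun x : ℤ × ℤ => f x.1 * g x.2) (a * b) :=
  hf.mul hg (summable_mul_of_summable_norm (f := f) (g := g) hf.summable.norm hg.summable.norm)

theorem hasSum_jacobiTheta₂_mul (a b : ℂ) {σ : ℂ} (hσ : 0 < σ.im) :
    HasSum (fun x : ℤ × ℤ => jacobiTheta₂_term x.1 a σ * jacobiTheta₂_term x.2 b σ)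
      (jacobiTheta₂ a σ * jacobiTheta₂ b σ) :=
  hasSum_prod_mul (f := fun n => jacobiTheta₂_term n a σ) (g := fun n => jacobiTheta₂_term n b σ)
    (hasSum_jacobiTheta₂_term a hσ) (hasSum_jacobiTheta₂_term b hσ)

theorem jacobiTheta₂_term_mul_even (z w τ : ℂ) (a b : ℤ) :
    jacobiTheta₂_term (a + b) z τ * jacobiTheta₂_term (a - b) w τ =
      jacobiTheta₂_term a (z + w) (2 * τ) * jacobiTheta₂_term b (z - w) (2 * τ) := by
  simp only [jacobiTheta₂_term, ← Complex.exp_add]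
  congr 1; push_cast; ring

theorem jacobiTheta₂_term_mul_odd (z w τ : ℂ) (a b : ℤ) :
    jacobiTheta₂_term (a + b + 1) z τ * jacobiTheta₂_term (a - b) w τ =
      Complex.exp (2 * π * I * z + π * I * τ) *
      (jacobiTheta₂_term a (z + w + τ) (2 * τ) * jacobiTheta₂_term b (z - w + τ) (2 * τ)) := by
  simp only [jacobiTheta₂_term, ← Complex.exp_add]
  congr 1; push_cast; ring

/-- Landen-type product formula: the product of two theta functions of modulus `τ` in terms of
theta functions of modulus `2τ`. -/
theorem jacobiTheta₂_mul (z w : ℂ) {τ : ℂ} (hτ : 0 < τ.im) :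
    jacobiTheta₂ z τ * jacobiTheta₂ w τ =
      jacobiTheta₂ (z + w) (2 * τ) * jacobiTheta₂ (z - w) (2 * τ)
      + Complex.exp (2 * π * I * z + π * I * τ) *
        (jacobiTheta₂ (z + w + τ) (2 * τ) * jacobiTheta₂ (z - w + τ) (2 * τ)) := by
  have hτ2 : 0 < (2 * τ).im := by simpa using hτ
  set f : ℤ × ℤ → ℂ := fun x => jacobiTheta₂_term x.1 z τ * jacobiTheta₂_term x.2 w τ with hf
  -- The index pairs (m, n) are split by the parity of m + n: the even ones are (a + b, a - b), the
  -- odd ones (a + b + 1, a - b).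
  let g₀ : ℤ × ℤ → ℤ × ℤ := fun x => (x.1 + x.2, x.1 - x.2)
  let g₁ : ℤ × ℤ → ℤ × ℤ := fun x => (x.1 + x.2 + 1, x.1 - x.2)
  have hg₀ : Function.Injective g₀ := by
    rintro ⟨a, b⟩ ⟨c, d⟩ h
    simp only [g₀, Prod.mk.injEq] at h ⊢
    omega
  have hg₁ : Function.Injective g₁ := by
    rintro ⟨a, b⟩ ⟨c, d⟩ h
    simp only [g₁, Prod.mk.injEq] at h ⊢
    omega
  have hcompl : IsCompl (Set.range g₀) (Set.range g₁) := by
    rw [isCompl_iff, codisjoint_iff]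
    constructor
    · rw [Set.disjoint_left]
      rintro _ ⟨⟨a, b⟩, rfl⟩ ⟨⟨c, d⟩, h⟩
      simp only [g₀, g₁, Prod.mk.injEq] at h
      omega
    · ext ⟨m, n⟩
      simp only [Set.sup_eq_union, Set.top_eq_univ, Set.mem_union, Set.mem_range, Prod.exists, Set.mem_univ, iff_true, g₀, g₁,
        Prod.mk.injEq]
      rcases Int.even_or_odd (m + n) with ⟨k, hk⟩ | ⟨k, hk⟩
      · exact Or.inl ⟨k, m - k, by omega, by omega⟩
      · exact Or.inr ⟨k, m - k - 1, by omega, by omega⟩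
  have h0 : HasSum (f ∘ g₀)
      (jacobiTheta₂ (z + w) (2 * τ) * jacobiTheta₂ (z - w) (2 * τ)) :=
    (hasSum_jacobiTheta₂_mul (z + w) (z - w) hτ2).congr_fun fun x =>
      jacobiTheta₂_term_mul_even z w τ x.1 x.2
  have h1 : HasSum (f ∘ g₁) (Complex.exp (2 * π * I * z + π * I * τ) *
        (jacobiTheta₂ (z + w + τ) (2 * τ) * jacobiTheta₂ (z - w + τ) (2 * τ))) :=
    ((hasSum_jacobiTheta₂_mul (z + w + τ) (z - w + τ) hτ2).mul_left _).congr_fun fun x =>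
      jacobiTheta₂_term_mul_odd z w τ x.1 x.2
  exact (hasSum_jacobiTheta₂_mul z w hτ).unique
    (HasSum.add_isCompl hcompl (hg₀.hasSum_range_iff.2 h0) (hg₁.hasSum_range_iff.2 h1))

theorem jacobiTheta₂_zero_mul_half {τ : ℂ} (hτ : 0 < τ.im) :
    jacobiTheta₂ 0 τ * jacobiTheta₂ (1 / 2) τ = jacobiTheta₂ (1 / 2) (2 * τ) ^ 2 := by
  rw [jacobiTheta₂_mul 0 (1 / 2) hτ]
  have h := jacobiTheta₂_half_eq_zero (2 * τ)
  rw [show (0 : ℂ) + 1 / 2 + τ = 1 / 2 + 2 * τ / 2 by ring, h,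
    show (0 : ℂ) - 1 / 2 = -(1 / 2) by ring, jacobiTheta₂_neg_left, zero_add]
  ring

theorem jacobiTheta₂_half_tau_sq {τ : ℂ} (hτ : 0 < τ.im) :
    jacobiTheta₂ (τ / 2) τ ^ 2 = 2 * jacobiTheta₂ τ (2 * τ) * jacobiTheta₂ 0 (2 * τ) := by
  rw [sq, jacobiTheta₂_mul _ _ hτ]
  have h := jacobiTheta₂_add_tau 0 (2 * τ)
  rw [show τ / 2 + τ / 2 + τ = 0 + 2 * τ by ring, h,
    show τ / 2 - τ / 2 + τ = τ by ring, show τ / 2 + τ / 2 = τ by ring, sub_self]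
  have e : Complex.exp (2 * π * I * (τ / 2) + π * I * τ) *
      Complex.exp (-(π * I * (2 * τ + 2 * 0))) = 1 := by
    rw [← Complex.exp_add, ← Complex.exp_zero]; congr 1; ring
  linear_combination (jacobiTheta₂ 0 (2 * τ) * jacobiTheta₂ τ (2 * τ)) * e

/-- The derivative of `jacobiTheta₂` at its zero `1/2 + τ/2`. -/
noncomputable def thetaDeriv (τ : ℂ) : ℂ := deriv (fun z => jacobiTheta₂ z τ) (1 / 2 + τ / 2)

/-- Differentiate the product formula with w = τ/2 at z = 1/2 + τ/2. In each of its two summands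
exactly one factor vanishes, and both contribute equally. -/
theorem thetaDeriv_mul {τ : ℂ} (hτ : 0 < τ.im) :
    thetaDeriv τ * jacobiTheta₂ (τ / 2) τ =
      2 * thetaDeriv (2 * τ) * jacobiTheta₂ (1 / 2) (2 * τ) := by
  have hτ2 : 0 < (2 * τ).im := by simpa using hτ
  have hJ := differentiable_jacobiTheta₂ hτ
  have hJ2 := differentiable_jacobiTheta₂ hτ2
  have h1 : HasDerivAt (fun z => jacobiTheta₂ z τ * jacobiTheta₂ (τ / 2) τ)
      (thetaDeriv τ * jacobiTheta₂ (τ / 2) τ) (1 / 2 + τ / 2) :=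
    (hJ _).hasDerivAt.mul_const _
  have hs : ∀ c z : ℂ, HasDerivAt (fun z => jacobiTheta₂ (z + c) (2 * τ))
      (deriv (fun z => jacobiTheta₂ z (2 * τ)) (z + c)) z := fun c z =>
    HasDerivAt.comp_add_const z c (hJ2 (z + c)).hasDerivAt
  have hs' : ∀ c z : ℂ, z + c = 1 / 2 + τ → HasDerivAt (fun z => jacobiTheta₂ (z + c) (2 * τ))
      (thetaDeriv (2 * τ)) z := fun c z h => by
    have := hs c z
    rwa [h, show 1 / 2 + τ = 1 / 2 + 2 * τ / 2 by ring] at this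
  have hexp : HasDerivAt (fun z : ℂ => Complex.exp (2 * π * I * z + π * I * τ))
      (Complex.exp (2 * π * I * (1 / 2 + τ / 2) + π * I * τ) * (2 * π * I * 1)) (1 / 2 + τ / 2) :=
    (((hasDerivAt_id _).const_mul _).add_const _).cexp
  have h2 := ((hs' (τ / 2) (1 / 2 + τ / 2) (by ring)).mul (hs (-(τ / 2)) (1 / 2 + τ / 2))).add
    (hexp.mul ((hs (τ / 2 + τ) (1 / 2 + τ / 2)).mul
      (hs' (-(τ / 2) + τ) (1 / 2 + τ / 2) (by ring))))
  have hfun : (fun z => jacobiTheta₂ z τ * jacobiTheta₂ (τ / 2) τ) =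
      (fun z => jacobiTheta₂ (z + τ / 2) (2 * τ)) * (fun z => jacobiTheta₂ (z + -(τ / 2)) (2 * τ))
      + (fun z : ℂ => Complex.exp (2 * π * I * z + π * I * τ)) *
      ((fun z => jacobiTheta₂ (z + (τ / 2 + τ)) (2 * τ)) *
        (fun z => jacobiTheta₂ (z + (-(τ / 2) + τ)) (2 * τ))) := by
    funext z
    simp only [Pi.add_apply, Pi.mul_apply]
    rw [jacobiTheta₂_mul z (τ / 2) hτ]
    ring_nf
  rw [← hfun] at h2
  rw [h1.unique h2]
  have h0 := jacobiTheta₂_half_eq_zero (2 * τ)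
  simp only [Pi.mul_apply]
  have hq := jacobiTheta₂_add_tau (1 / 2) (2 * τ)
  rw [show 1 / 2 + τ / 2 + τ / 2 = 1 / 2 + 2 * τ / 2 by ring,
    show 1 / 2 + τ / 2 + (-(τ / 2) + τ) = 1 / 2 + 2 * τ / 2 by ring,
    show 1 / 2 + τ / 2 + (τ / 2 + τ) = 1 / 2 + 2 * τ by ring,
    show 1 / 2 + τ / 2 + -(τ / 2) = 1 / 2 by ring, h0, hq]
  have e : Complex.exp (2 * π * I * (1 / 2 + τ / 2) + π * I * τ) *
      Complex.exp (-(π * I * (2 * τ + 2 * (1 / 2)))) = 1 := by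
    rw [← Complex.exp_add, ← Complex.exp_zero]; congr 1; ring
  linear_combination (jacobiTheta₂ (1 / 2) (2 * τ) * thetaDeriv (2 * τ)) * e

/-- The product of the three even theta constants. -/
noncomputable def thetaConst (τ : ℂ) : ℂ :=
  jacobiTheta₂ (τ / 2) τ * jacobiTheta₂ 0 τ * jacobiTheta₂ (1 / 2) τ

theorem jacobiTheta₂_half_tau_ne_zero {τ : ℂ} (hτ : 0 < τ.im) : jacobiTheta₂ (τ / 2) τ ≠ 0 := by
  intro h
  obtain ⟨m, n, hmn⟩ := eq_of_jacobiTheta₂_eq_zero hτ h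
  have him := congrArg Complex.im hmn
  have hre := congrArg Complex.re hmn
  simp at him hre
  have hn : n = 0 := by
    rcases him with h | h
    · exact h
    · exact absurd h hτ.ne'
  subst hn
  simp at hre
  have h2 : (2 * m + 1 : ℝ) = 0 := by linarith
  have h3 : (2 * m + 1 : ℤ) = 0 := by exact_mod_cast h2
  omega

/-- Up to elementary prefactors: θ₁'/(θ₂θ₃θ₄) is unchanged when τ is doubled. The three Landen-type
relations combine to give this. -/
theorem thetaDeriv_mul_thetaConst {τ : ℂ} (hτ : 0 < τ.im) :
    thetaDeriv τ * thetaConst (2 * τ) = thetaDeriv (2 * τ) * thetaConst τ := by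
  have h1 := thetaDeriv_mul hτ
  have h2 := jacobiTheta₂_half_tau_sq hτ
  have h3 := jacobiTheta₂_zero_mul_half hτ
  refine mul_right_cancel₀ (jacobiTheta₂_half_tau_ne_zero hτ) ?_
  unfold thetaConst
  rw [show 2 * τ / 2 = τ by ring]
  linear_combination (jacobiTheta₂ τ (2 * τ) * jacobiTheta₂ 0 (2 * τ) *
    jacobiTheta₂ (1 / 2) (2 * τ)) * h1 - thetaDeriv (2 * τ) * jacobiTheta₂ 0 τ *
    jacobiTheta₂ (1 / 2) τ * h2 - 2 * thetaDeriv (2 * τ) * jacobiTheta₂ τ (2 * τ) *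
    jacobiTheta₂ 0 (2 * τ) * h3

/-- Terms with positive exponent decay as the nome tends to 0, and all terms are dominated by those
with k = 0. -/
theorem tendsto_tsum_nome {τ : ℂ} (hτ : 0 < τ.im) {c : ℤ → ℂ} {e : ℤ → ℤ} (he : ∀ n, 0 ≤ e n)
    (hs : Summable fun n => c n * Complex.exp (π * I * e n * τ)) :
    Filter.Tendsto (fun k : ℕ => ∑' n, c n * Complex.exp (π * I * e n * (2 ^ k * τ)))
      Filter.atTop (𝓝 (∑' n, if e n = 0 then c n else 0)) := by
  have hre : ∀ (n : ℤ) (k : ℕ),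
      (π * I * e n * (2 ^ k * τ) : ℂ).re = -(π * e n * τ.im) * 2 ^ k := by
    intro n k
    rw [show (π * I * e n * (2 ^ k * τ) : ℂ) = ((π * e n * 2 ^ k : ℝ) : ℂ) * (I * τ) by
      push_cast; ring, Complex.re_ofReal_mul]
    simp; ring
  refine tendsto_tsum_of_dominated_convergence hs.norm (fun n => ?_) (.of_forall fun k n => ?_)
  · split_ifs with h
    · simp [h]
    · rw [show (0 : ℂ) = c n * 0 by simp]
      refine Filter.Tendsto.const_mul _ ?_
      rw [tendsto_zero_iff_norm_tendsto_zero]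
      simp_rw [Complex.norm_exp, hre]
      refine Real.tendsto_exp_atBot.comp ?_
      have hpos : (0 : ℝ) < e n := by exact_mod_cast lt_of_le_of_ne (he n) (Ne.symm h)
      refine Filter.Tendsto.const_mul_atTop_of_neg (by
        have := mul_pos (mul_pos Real.pi_pos hpos) hτ; linarith)
        (tendsto_pow_atTop_atTop_of_one_lt one_lt_two)
  · rw [norm_mul, norm_mul, Complex.norm_exp, Complex.norm_exp, hre,
      show (π * I * e n * τ : ℂ) = π * I * e n * (2 ^ 0 * τ) by simp, hre]
    refine mul_le_mul_of_nonneg_left (Real.exp_le_exp.2 ?_) (norm_nonneg _)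
    have hpos : (0 : ℝ) ≤ e n := by exact_mod_cast he n
    have h1 : (1 : ℝ) ≤ 2 ^ k := one_le_pow₀ one_le_two
    have h2 := mul_nonneg (mul_nonneg Real.pi_pos.le hpos) hτ.le
    nlinarith

theorem deriv_jacobiTheta₂ (z : ℂ) {τ : ℂ} (hτ : 0 < τ.im) :
    deriv (fun z => jacobiTheta₂ z τ) z = jacobiTheta₂' z τ :=
  (hasDerivAt_jacobiTheta₂_fst z hτ).deriv

theorem im_two_pow_mul_pos {τ : ℂ} (hτ : 0 < τ.im) (k : ℕ) : 0 < ((2 : ℂ) ^ k * τ).im := by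
  have : (2 : ℂ) ^ k = ((2 ^ k : ℝ) : ℂ) := by push_cast; rfl
  rw [this, Complex.im_ofReal_mul]
  positivity

theorem int_mul_add_one_nonneg (n : ℤ) : 0 ≤ n ^ 2 + n := by
  rcases le_or_gt 0 n with h | h <;> nlinarith

theorem int_mul_add_one_eq_zero_iff (n : ℤ) : n ^ 2 + n = 0 ↔ n = 0 ∨ n = -1 := by
  rw [show n ^ 2 + n = n * (n + 1) by ring, mul_eq_zero]; omega

theorem exp_two_pi_int_half (n : ℤ) :
    Complex.exp (2 * π * I * n * (1 / 2)) = (-1) ^ n := by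
  rw [show 2 * π * I * n * (1 / 2) = n * (π * I) by ring, Complex.exp_int_mul, Complex.exp_pi_mul_I]

theorem tsum_two_points (c : ℤ → ℂ) :
    ∑' n : ℤ, (if n ^ 2 + n = 0 then c n else 0) = c 0 + c (-1) := by
  rw [tsum_eq_sum (s := {0, -1})]
  · rw [Finset.sum_pair (by decide)]; simp
  · intro n hn
    rw [if_neg]
    rw [int_mul_add_one_eq_zero_iff]
    simpa using hn

theorem tendsto_thetaConst {τ : ℂ} (hτ : 0 < τ.im) :
    Filter.Tendsto (fun k : ℕ => thetaConst (2 ^ k * τ)) Filter.atTop (𝓝 2) := by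
  have t1 : Filter.Tendsto (fun k : ℕ => jacobiTheta₂ (2 ^ k * τ / 2) (2 ^ k * τ)) Filter.atTop
      (𝓝 2) := by
    have e1 : ∀ (n : ℤ) (σ : ℂ), jacobiTheta₂_term n (σ / 2) σ =
        1 * Complex.exp (π * I * (n ^ 2 + n : ℤ) * σ) := by
      intro n σ; rw [jacobiTheta₂_term, one_mul]; congr 1; push_cast; ring
    have := tendsto_tsum_nome hτ (c := fun _ => 1) (e := fun n => n ^ 2 + n)
      -- At the half period τ/2 the exponent is n² + n, so the two terms n = 0 and n = -1 survive
      -- and the limit is 2.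
      int_mul_add_one_nonneg
      (((summable_jacobiTheta₂_term_iff (τ / 2) τ).2 hτ).congr fun n => e1 n τ)
    rw [tsum_two_points, one_add_one_eq_two] at this
    refine this.congr fun k => ?_
    exact tsum_congr fun n => (e1 n _).symm
  have t2 : ∀ (z : ℂ), Filter.Tendsto (fun k : ℕ => jacobiTheta₂ z (2 ^ k * τ)) Filter.atTop
      (𝓝 1) := by
    intro z
    have e1 : ∀ (n : ℤ) (σ : ℂ), jacobiTheta₂_term n z σ =
        Complex.exp (2 * π * I * n * z) * Complex.exp (π * I * (n ^ 2 : ℤ) * σ) := by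
      intro n σ; rw [jacobiTheta₂_term, ← Complex.exp_add]; congr 1; push_cast; ring
    have := tendsto_tsum_nome hτ (c := fun n => Complex.exp (2 * π * I * n * z))
      (e := fun n => n ^ 2) (fun n => sq_nonneg n)
      (((summable_jacobiTheta₂_term_iff z τ).2 hτ).congr fun n => e1 n τ)
    have h1 : ∑' n : ℤ, (if n ^ 2 = 0 then Complex.exp (2 * π * I * n * z) else 0) = 1 := by
      rw [tsum_eq_single 0]
      · simp
      · intro n hn; simp [hn]
    rw [h1] at this
    refine this.congr fun k => ?_
    exact tsum_congr fun n => (e1 n _).symm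
  have := (t1.mul (t2 0)).mul (t2 (1 / 2))
  simpa [thetaConst] using this

theorem tendsto_thetaDeriv {τ : ℂ} (hτ : 0 < τ.im) :
    Filter.Tendsto (fun k : ℕ => thetaDeriv (2 ^ k * τ)) Filter.atTop (𝓝 (2 * π * I)) := by
  have e1 : ∀ (n : ℤ) (σ : ℂ), jacobiTheta₂'_term n (1 / 2 + σ / 2) σ =
      (2 * π * I * n * (-1) ^ n) * Complex.exp (π * I * (n ^ 2 + n : ℤ) * σ) := by
    intro n σ
    rw [jacobiTheta₂'_term, jacobiTheta₂_term, ← exp_two_pi_int_half, mul_assoc (2 * π * I * n),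
      ← Complex.exp_add]
    congr 2; push_cast; ring
  have := tendsto_tsum_nome hτ (c := fun n => 2 * π * I * n * (-1) ^ n) (e := fun n => n ^ 2 + n)
    int_mul_add_one_nonneg
    (((summable_jacobiTheta₂'_term_iff (1 / 2 + τ / 2) τ).2 hτ).congr fun n => e1 n τ)
  rw [tsum_two_points] at this
  have h2 : (2 * π * I * (0 : ℤ) * (-1) ^ (0 : ℤ) + 2 * π * I * (-1 : ℤ) * (-1) ^ (-1 : ℤ) : ℂ)
      = 2 * π * I := by
    simp
  rw [h2] at this
  refine this.congr fun k => ?_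
  rw [thetaDeriv, deriv_jacobiTheta₂ _ (im_two_pow_mul_pos hτ k)]
  exact tsum_congr fun n => (e1 n _).symm

theorem jacobiTheta₂_ofReal_ne_zero (x : ℝ) {τ : ℂ} (hτ : 0 < τ.im) : jacobiTheta₂ x τ ≠ 0 := by
  intro h
  obtain ⟨m, n, hmn⟩ := eq_of_jacobiTheta₂_eq_zero hτ h
  have him := congrArg Complex.im hmn
  simp at him
  have h2 : ((2 * n + 1 : ℤ) : ℝ) * τ.im = 0 := by push_cast; linarith
  rcases mul_eq_zero.1 h2 with h3 | h3
  · have : (2 * n + 1 : ℤ) = 0 := by exact_mod_cast h3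
    omega
  · exact hτ.ne' h3

theorem thetaConst_ne_zero {τ : ℂ} (hτ : 0 < τ.im) : thetaConst τ ≠ 0 := by
  have h0 := jacobiTheta₂_ofReal_ne_zero 0 hτ
  have h1 := jacobiTheta₂_ofReal_ne_zero (1 / 2) hτ
  push_cast at h0 h1
  exact mul_ne_zero (mul_ne_zero (jacobiTheta₂_half_tau_ne_zero hτ) h0) h1

/-- **Jacobi's derivative formula** `θ₁' = θ₂ θ₃ θ₄`. -/
theorem thetaDeriv_eq {τ : ℂ} (hτ : 0 < τ.im) : thetaDeriv τ = π * I * thetaConst τ := by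
  -- The ratio of derivative to constants is the same at τ and at 2ᵏτ; its limit is 2πi/2.
  have h1 : ∀ k : ℕ,
      thetaDeriv τ * thetaConst (2 ^ k * τ) = thetaDeriv (2 ^ k * τ) * thetaConst τ := by
    intro k
    induction k with
    | zero => simp
    | succ k ih =>
      have h := thetaDeriv_mul_thetaConst (im_two_pow_mul_pos hτ k)
      rw [show (2 : ℂ) ^ (k + 1) * τ = 2 * (2 ^ k * τ) by ring]
      refine mul_right_cancel₀ (thetaConst_ne_zero (im_two_pow_mul_pos hτ k)) ?_
      linear_combination thetaConst (2 * (2 ^ k * τ)) * ih + thetaConst τ * h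
  have t1 := (tendsto_thetaConst hτ).const_mul (thetaDeriv τ)
  have t2 := (tendsto_thetaDeriv hτ).mul_const (thetaConst τ)
  have := tendsto_nhds_unique (t1.congr h1) t2
  linear_combination (1 / 2) * this

/-! ### Multipliers and zeros of θ₁, θ₃, θ₄ -/

theorem ofReal_pi_ne_zero : (π : ℂ) ≠ 0 := by exact_mod_cast Real.pi_ne_zero

/-- The basic multiplier `e^{-i(u + πτ/2)}` for translations by `πτ`. -/
noncomputable def quasiFactor (τ u : ℂ) : ℂ := Complex.exp (-(I * (u + π * τ / 2)))

theorem quasiFactor_ne_zero (τ u : ℂ) : quasiFactor τ u ≠ 0 := Complex.exp_ne_zero _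

theorem differentiable_quasiFactor (τ : ℂ) : Differentiable ℂ (quasiFactor τ) := by
  unfold quasiFactor; fun_prop

theorem quasiFactor_pow (τ u : ℂ) (k : ℕ) :
    quasiFactor τ u ^ k = Complex.exp (-(I * k * (u + π * τ / 2))) := by
  rw [quasiFactor, ← Complex.exp_nat_mul]; congr 1; ring

theorem quasiFactor_add_pi (τ u : ℂ) : quasiFactor τ (u + π) = -quasiFactor τ u := by
  rw [quasiFactor, quasiFactor, show -(I * (u + π + π * τ / 2)) =
    -(I * (u + π * τ / 2)) - π * I by ring, Complex.exp_sub, Complex.exp_pi_mul_I]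
  ring

theorem quasiFactor_add_third (τ u : ℂ) :
    quasiFactor τ (u + 2 * π / 3) ^ 3 = quasiFactor τ u ^ 3 := by
  rw [quasiFactor_pow, quasiFactor_pow, show -(I * (3 : ℕ) * (u + 2 * π / 3 + π * τ / 2)) =
    -(I * (3 : ℕ) * (u + π * τ / 2)) - 2 * π * I by push_cast; ring, Complex.exp_periodic.sub_eq]

theorem quasiFactor_sub_third (τ u : ℂ) :
    quasiFactor τ (u - 2 * π / 3) ^ 3 = quasiFactor τ u ^ 3 := by
  rw [← quasiFactor_add_third, sub_add_cancel]

theorem quasiFactor_mul_shift (τ u a b : ℂ) (h : a + b = 0) :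
    quasiFactor τ (u + a) * quasiFactor τ (u + b) = quasiFactor τ u ^ 2 := by
  rw [quasiFactor_pow, quasiFactor, quasiFactor, ← Complex.exp_add]
  congr 1; push_cast; linear_combination (-I) * h

theorem differentiable_theta3 {τ : ℂ} (hτ : 0 < τ.im) : Differentiable ℂ (fun u => theta3 u τ) := by
  unfold theta3
  exact (differentiable_jacobiTheta₂ hτ).comp (f := fun u : ℂ => u / π) (by fun_prop)

theorem deriv_theta3 (u : ℂ) {τ : ℂ} (hτ : 0 < τ.im) :
    deriv (fun u => theta3 u τ) u = deriv (fun z => jacobiTheta₂ z τ) (u / π) / π := by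
  have h : HasDerivAt ((fun z => jacobiTheta₂ z τ) ∘ fun u : ℂ => u / π)
      (deriv (fun z => jacobiTheta₂ z τ) (u / π) * (1 / π)) u :=
    ((differentiable_jacobiTheta₂ hτ (u / π)).hasDerivAt).comp u
      ((hasDerivAt_id' u).div_const (π : ℂ))
  rw [show (fun u => theta3 u τ) = (fun z => jacobiTheta₂ z τ) ∘ fun u : ℂ => u / π from rfl,
    h.deriv]
  ring

theorem theta3_add_pi (u τ : ℂ) : theta3 (u + π) τ = theta3 u τ := by
  rw [theta3, theta3, add_div, div_self ofReal_pi_ne_zero, jacobiTheta₂_add_left]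

theorem theta3_neg (u τ : ℂ) : theta3 (-u) τ = theta3 u τ := by
  rw [theta3, theta3, neg_div, jacobiTheta₂_neg_left]

theorem theta3_add_tau (u τ : ℂ) : theta3 (u + π * τ) τ = quasiFactor τ u ^ 2 * theta3 u τ := by
  have hp := ofReal_pi_ne_zero
  rw [theta3, theta3, add_div, mul_div_cancel_left₀ _ hp, jacobiTheta₂_add_tau, quasiFactor_pow]
  congr 2; push_cast; field_simp; ring

theorem theta3_eq_zero_iff {u τ : ℂ} (hτ : 0 < τ.im) :
    theta3 u τ = 0 ↔ ∃ m n : ℤ, u = π / 2 + π * τ / 2 + m * π + n * (π * τ) := by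
  have hp := ofReal_pi_ne_zero
  rw [theta3, jacobiTheta₂_eq_zero_iff hτ]
  refine exists_congr fun m => exists_congr fun n => ?_
  rw [div_eq_iff hp]
  constructor <;> intro h <;> rw [h] <;> ring

theorem deriv_theta3_ne_zero {u τ : ℂ} (hτ : 0 < τ.im) (h : theta3 u τ = 0) :
    deriv (fun u => theta3 u τ) u ≠ 0 := by
  rw [deriv_theta3 u hτ]
  exact div_ne_zero (deriv_jacobiTheta₂_ne_zero hτ h) ofReal_pi_ne_zero

theorem theta4_eq_theta3 (u τ : ℂ) : theta4 u τ = theta3 (u + π / 2) τ := by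
  have hp := ofReal_pi_ne_zero
  rw [theta4, theta3]; congr 1; field_simp

theorem theta1_eq_theta3 (u τ : ℂ) :
    theta1 u τ = -I * Complex.exp (I * u + I * π * τ / 4) * theta3 (u + π / 2 + π * τ / 2) τ := by
  have hp := ofReal_pi_ne_zero
  rw [theta1, theta3]; congr 2; field_simp

theorem differentiable_theta1 {τ : ℂ} (hτ : 0 < τ.im) : Differentiable ℂ (fun u => theta1 u τ) := by
  have h := differentiable_theta3 hτ
  simp_rw [theta1_eq_theta3]
  have h2 : Differentiable ℂ fun u => theta3 (u + π / 2 + π * τ / 2) τ :=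
    h.comp (f := fun u : ℂ => u + π / 2 + π * τ / 2) (by fun_prop)
  fun_prop

theorem theta1_add_pi (u τ : ℂ) : theta1 (u + π) τ = -theta1 u τ := by
  rw [theta1_eq_theta3, theta1_eq_theta3, show u + π + π / 2 + π * τ / 2 =
    u + π / 2 + π * τ / 2 + π by ring, theta3_add_pi,
    show I * (u + π) + I * π * τ / 4 = I * u + I * π * τ / 4 + π * I by ring, Complex.exp_add,
    Complex.exp_pi_mul_I]
  ring

theorem theta1_add_tau (u τ : ℂ) : theta1 (u + π * τ) τ = -quasiFactor τ u ^ 2 * theta1 u τ := by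
  rw [theta1_eq_theta3, theta1_eq_theta3, show u + π * τ + π / 2 + π * τ / 2 =
    u + π / 2 + π * τ / 2 + π * τ by ring, theta3_add_tau, quasiFactor_pow, quasiFactor_pow]
  have e : Complex.exp (I * (u + π * τ) + I * π * τ / 4) *
      Complex.exp (-(I * (2 : ℕ) * (u + π / 2 + π * τ / 2 + π * τ / 2))) =
      -(Complex.exp (-(I * (2 : ℕ) * (u + π * τ / 2))) * Complex.exp (I * u + I * π * τ / 4)) := by
    rw [← Complex.exp_add, ← Complex.exp_add, ← Complex.exp_sub_pi_mul_I]
    congr 1; push_cast; ring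
  linear_combination (-I * theta3 (u + π / 2 + π * τ / 2) τ) * e

theorem theta1_neg (u τ : ℂ) : theta1 (-u) τ = -theta1 u τ := by
  rw [theta1_eq_theta3, theta1_eq_theta3, show -u + π / 2 + π * τ / 2 =
    -(u - π / 2 - π * τ / 2) by ring, theta3_neg, show u + π / 2 + π * τ / 2 =
    u - π / 2 - π * τ / 2 + π * τ + π by ring, theta3_add_pi, theta3_add_tau, quasiFactor_pow]
  have e : Complex.exp (I * u + I * π * τ / 4) *
      Complex.exp (-(I * (2 : ℕ) * (u - π / 2 - π * τ / 2 + π * τ / 2))) =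
      -(Complex.exp (I * -u + I * π * τ / 4)) := by
    rw [← Complex.exp_add, ← Complex.exp_add_pi_mul_I]
    congr 1; push_cast; ring
  linear_combination (-I * theta3 (u - π / 2 - π * τ / 2) τ) * e

theorem theta1_eq_zero_iff {u τ : ℂ} (hτ : 0 < τ.im) :
    theta1 u τ = 0 ↔ ∃ m n : ℤ, u = m * π + n * (π * τ) := by
  rw [theta1_eq_theta3, mul_eq_zero, theta3_eq_zero_iff hτ]
  simp only [neg_mul, neg_eq_zero, mul_eq_zero, Complex.I_ne_zero, Complex.exp_ne_zero, false_or]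
  refine exists_congr fun m => exists_congr fun n => ?_
  constructor <;> intro h <;> linear_combination h

theorem deriv_theta1_ne_zero {u τ : ℂ} (hτ : 0 < τ.im) (h : theta1 u τ = 0) :
    deriv (fun u => theta1 u τ) u ≠ 0 := by
  rw [theta1_eq_theta3, mul_eq_zero] at h
  have hc : ∀ u : ℂ, -I * Complex.exp (I * u + I * π * τ / 4) ≠ 0 := fun u => by
    simp [Complex.exp_ne_zero, Complex.I_ne_zero]
  have h0 := h.resolve_left (hc u)
  have h3 := differentiable_theta3 hτ
  have h2 : Differentiable ℂ fun u => theta3 (u + π / 2 + π * τ / 2) τ :=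
    h3.comp (f := fun u : ℂ => u + π / 2 + π * τ / 2) (by fun_prop)
  simp_rw [theta1_eq_theta3]
  rw [deriv_fun_mul (by fun_prop) (h2 u), h0, mul_zero, zero_add]
  refine mul_ne_zero (hc u) ?_
  have := deriv_theta3_ne_zero hτ h0
  rwa [show (fun u => theta3 (u + π / 2 + π * τ / 2) τ) =
    fun u => theta3 (u + (π / 2 + π * τ / 2)) τ by funext u; rw [add_assoc],
    deriv_comp_add_const (f := fun u => theta3 u τ), ← add_assoc]

/-- Two entire functions with the same multipliers along two independent translations are
proportional if the simple zeros of one are zeros of the other. -/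
theorem eq_const_mul_of_quasi_periodic {f g e₁ e₂ : ℂ → ℂ} (hf : Differentiable ℂ f)
    (hg : Differentiable ℂ g) (hz : ∀ z, g z = 0 → f z = 0 ∧ deriv g z ≠ 0)
    {a : ℝ} (ha : 0 < a) {b : ℂ} (hb : 0 < b.im) (he₁ : ∀ z, e₁ z ≠ 0) (he₂ : ∀ z, e₂ z ≠ 0)
    (hfa : ∀ z, f (z + a) = e₁ z * f z) (hga : ∀ z, g (z + a) = e₁ z * g z)
    (hfb : ∀ z, f (z + b) = e₂ z * f z) (hgb : ∀ z, g (z + b) = e₂ z * g z)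
    {z₀ : ℂ} (hz₀ : g z₀ ≠ 0) : ∃ c, ∀ z, f z = c * g z := by
  obtain ⟨k, hk, hfk⟩ := exists_entire_quotient hf hg hz
  have k1 := quotient_quasi_periodic hg hk (ε := fun _ => 1) (by fun_prop) he₁ hfk
    (by simpa using hfa) hga hz₀
  have k2 := quotient_quasi_periodic hg hk (ε := fun _ => 1) (by fun_prop) he₂ hfk
    (by simpa using hfb) hgb hz₀
  refine ⟨k 0, fun z => ?_⟩
  rw [hfk z, entire_eq_const_of_norm_periodic hk ha hb (fun z => by rw [k1, one_mul])
    (fun z => by rw [k2, one_mul]) z 0, mul_comm]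

/-! ### Theta functions adapted to translations by 2π/3 and πτ -/

/-- `θ₃(3u/2|3τ/2)`. -/
noncomputable def thetaT (τ u : ℂ) : ℂ := theta3 (3 * u / 2) (3 * τ / 2)

/-- `θ₄(3u/2|3τ/2)`. -/
noncomputable def thetaTs (τ u : ℂ) : ℂ := theta4 (3 * u / 2) (3 * τ / 2)

/-- `θ₁(3u|3τ)`. -/
noncomputable def thetaV (τ u : ℂ) : ℂ := theta1 (3 * u) (3 * τ)

/-- `θ₁(3u/2|3τ/2)`. -/
noncomputable def thetaH (τ u : ℂ) : ℂ := theta1 (3 * u / 2) (3 * τ / 2)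

theorem im_three_mul {τ : ℂ} (hτ : 0 < τ.im) : 0 < (3 * τ).im := by
  simpa using hτ

theorem im_three_halves {τ : ℂ} (hτ : 0 < τ.im) : 0 < (3 * τ / 2).im := by
  have : (3 * τ / 2) = ((3 / 2 : ℝ) : ℂ) * τ := by push_cast; ring
  rw [this, Complex.im_ofReal_mul]; positivity

theorem quasiFactor_scale (τ u : ℂ) :
    quasiFactor (3 * τ / 2) (3 * u / 2) ^ 2 = quasiFactor τ u ^ 3 := by
  rw [quasiFactor_pow, quasiFactor_pow]; congr 1; push_cast; ring

theorem quasiFactor_scale' (τ u : ℂ) :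
    quasiFactor (3 * τ) (3 * u) ^ 2 = quasiFactor τ u ^ 6 := by
  rw [quasiFactor_pow, quasiFactor_pow]; congr 1; push_cast; ring

theorem deriv_comp_mul_const {f : ℂ → ℂ} (hf : Differentiable ℂ f) (c u : ℂ) :
    deriv (fun u => f (c * u)) u = c * deriv f (c * u) := by
  have : HasDerivAt (fun u => f (c * u)) (deriv f (c * u) * (c * 1)) u :=
    (hf (c * u)).hasDerivAt.comp u ((hasDerivAt_id u).const_mul c)
  rw [this.deriv]; ring

theorem differentiable_thetaT {τ : ℂ} (hτ : 0 < τ.im) : Differentiable ℂ (thetaT τ) :=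
  (differentiable_theta3 (im_three_halves hτ)).comp (f := fun u : ℂ => 3 * u / 2) (by fun_prop)

theorem thetaT_add_third (τ u : ℂ) : thetaT τ (u + 2 * π / 3) = thetaT τ u := by
  rw [thetaT, thetaT, ← theta3_add_pi (3 * u / 2)]; congr 1; ring

theorem thetaT_neg (τ u : ℂ) : thetaT τ (-u) = thetaT τ u := by
  rw [thetaT, thetaT, ← theta3_neg]; congr 1; ring

theorem thetaT_add_tau (τ u : ℂ) : thetaT τ (u + π * τ) = quasiFactor τ u ^ 3 * thetaT τ u := by
  rw [thetaT, thetaT, ← quasiFactor_scale, ← theta3_add_tau]; congr 1; ring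

theorem thetaT_eq_zero_iff {τ u : ℂ} (hτ : 0 < τ.im) :
    thetaT τ u = 0 ↔ ∃ m n : ℤ, u = π / 3 + π * τ / 2 + m * (2 * π / 3) + n * (π * τ) := by
  rw [thetaT, theta3_eq_zero_iff (im_three_halves hτ)]
  refine exists_congr fun m => exists_congr fun n => ?_
  constructor <;> intro h
  · linear_combination (2 / 3) * h
  · linear_combination (3 / 2) * h

theorem deriv_thetaT {τ : ℂ} (hτ : 0 < τ.im) (u : ℂ) :
    deriv (thetaT τ) u = 3 / 2 * deriv (fun u => theta3 u (3 * τ / 2)) (3 * u / 2) := by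
  have := deriv_comp_mul_const (differentiable_theta3 (im_three_halves hτ)) (3 / 2) u
  rw [show 3 / 2 * u = 3 * u / 2 by ring] at this
  rw [← this]; congr 1; funext u; rw [thetaT]; congr 1; ring

theorem deriv_thetaT_ne_zero {τ u : ℂ} (hτ : 0 < τ.im) (h : thetaT τ u = 0) :
    deriv (thetaT τ) u ≠ 0 := by
  rw [deriv_thetaT hτ]
  exact mul_ne_zero (by norm_num) (deriv_theta3_ne_zero (im_three_halves hτ) h)

theorem thetaTs_eq_third (τ u : ℂ) : thetaTs τ u = thetaT τ (u + π / 3) := by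
  rw [thetaTs, thetaT, theta4_eq_theta3]; congr 1; ring

theorem thetaTs_eq (τ u : ℂ) : thetaTs τ u = thetaT τ (u + π) := by
  rw [thetaTs_eq_third, ← thetaT_add_third]; congr 1; ring

theorem thetaTs_add_pi (τ u : ℂ) : thetaTs τ (u + π) = thetaT τ u := by
  rw [thetaTs_eq, ← thetaT_add_third τ u, ← thetaT_add_third τ (u + 2 * π / 3),
    ← thetaT_add_third τ (u + 2 * π / 3 + 2 * π / 3)]
  congr 1; ring

theorem differentiable_thetaTs {τ : ℂ} (hτ : 0 < τ.im) : Differentiable ℂ (thetaTs τ) := by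
  have h := differentiable_thetaT hτ
  have : thetaTs τ = fun u => thetaT τ (u + π) := funext fun u => thetaTs_eq τ u
  rw [this]; fun_prop

theorem thetaTs_add_third (τ u : ℂ) : thetaTs τ (u + 2 * π / 3) = thetaTs τ u := by
  rw [thetaTs_eq, thetaTs_eq, ← thetaT_add_third τ (u + π)]; congr 1; ring

theorem thetaTs_neg (τ u : ℂ) : thetaTs τ (-u) = thetaTs τ u := by
  rw [thetaTs_eq_third, thetaTs_eq_third, ← thetaT_neg, ← thetaT_add_third]; congr 1; ring

theorem thetaTs_add_tau (τ u : ℂ) :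
    thetaTs τ (u + π * τ) = -quasiFactor τ u ^ 3 * thetaTs τ u := by
  rw [thetaTs_eq, thetaTs_eq, show u + π * τ + π = u + π + π * τ by ring, thetaT_add_tau,
    quasiFactor_add_pi]; ring

theorem differentiable_thetaV {τ : ℂ} (hτ : 0 < τ.im) : Differentiable ℂ (thetaV τ) :=
  (differentiable_theta1 (im_three_mul hτ)).comp (f := fun u : ℂ => 3 * u) (by fun_prop)

theorem thetaV_add_pi_third (τ u : ℂ) : thetaV τ (u + π / 3) = -thetaV τ u := by
  rw [thetaV, thetaV, ← theta1_add_pi]; congr 1; ring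

theorem thetaV_add_third (τ u : ℂ) : thetaV τ (u + 2 * π / 3) = thetaV τ u := by
  rw [show u + 2 * π / 3 = u + π / 3 + π / 3 by ring, thetaV_add_pi_third, thetaV_add_pi_third,
    neg_neg]

theorem thetaV_neg (τ u : ℂ) : thetaV τ (-u) = -thetaV τ u := by
  rw [thetaV, thetaV, ← theta1_neg]; congr 1; ring

theorem thetaV_add_tau (τ u : ℂ) : thetaV τ (u + π * τ) = -quasiFactor τ u ^ 6 * thetaV τ u := by
  rw [thetaV, thetaV, ← quasiFactor_scale', ← theta1_add_tau]; congr 1; ring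

theorem thetaV_eq_zero_iff {τ u : ℂ} (hτ : 0 < τ.im) :
    thetaV τ u = 0 ↔ ∃ m n : ℤ, u = m * (π / 3) + n * (π * τ) := by
  rw [thetaV, theta1_eq_zero_iff (im_three_mul hτ)]
  refine exists_congr fun m => exists_congr fun n => ?_
  constructor <;> intro h
  · linear_combination (1 / 3) * h
  · linear_combination 3 * h

theorem deriv_thetaV_ne_zero {τ u : ℂ} (hτ : 0 < τ.im) (h : thetaV τ u = 0) :
    deriv (thetaV τ) u ≠ 0 := by
  have h3 := im_three_mul hτ
  rw [show thetaV τ = fun u => theta1 (3 * u) (3 * τ) from rfl,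
    deriv_comp_mul_const (f := fun u => theta1 u (3 * τ)) (differentiable_theta1 h3)]
  exact mul_ne_zero (by norm_num) (deriv_theta1_ne_zero h3 h)

theorem differentiable_thetaH {τ : ℂ} (hτ : 0 < τ.im) : Differentiable ℂ (thetaH τ) :=
  (differentiable_theta1 (im_three_halves hτ)).comp (f := fun u : ℂ => 3 * u / 2) (by fun_prop)

theorem thetaH_add_third (τ u : ℂ) : thetaH τ (u + 2 * π / 3) = -thetaH τ u := by
  rw [thetaH, thetaH, ← theta1_add_pi]; congr 1; ring

theorem thetaH_add_tau (τ u : ℂ) : thetaH τ (u + π * τ) = -quasiFactor τ u ^ 3 * thetaH τ u := by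
  rw [thetaH, thetaH, ← quasiFactor_scale, ← theta1_add_tau]; congr 1; ring

theorem thetaH_eq_zero_iff {τ u : ℂ} (hτ : 0 < τ.im) :
    thetaH τ u = 0 ↔ ∃ m n : ℤ, u = m * (2 * π / 3) + n * (π * τ) := by
  rw [thetaH, theta1_eq_zero_iff (im_three_halves hτ)]
  refine exists_congr fun m => exists_congr fun n => ?_
  constructor <;> intro h
  · linear_combination (2 / 3) * h
  · linear_combination (3 / 2) * h

theorem deriv_thetaH_ne_zero {τ u : ℂ} (hτ : 0 < τ.im) (h : thetaH τ u = 0) :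
    deriv (thetaH τ) u ≠ 0 := by
  have h3 := im_three_halves hτ
  have e : thetaH τ = fun u => theta1 (3 / 2 * u) (3 * τ / 2) := by
    funext u; rw [thetaH]; congr 1; ring
  rw [e, deriv_comp_mul_const (f := fun u => theta1 u (3 * τ / 2)) (differentiable_theta1 h3)]
  refine mul_ne_zero (by norm_num) (deriv_theta1_ne_zero h3 ?_)
  rw [← h, thetaH]; congr 1; ring

theorem exists_thetaV_ne_zero {τ : ℂ} (hτ : 0 < τ.im) : ∃ u, thetaV τ u ≠ 0 := by
  by_contra! h
  have : thetaV τ = fun _ => 0 := funext h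
  exact deriv_thetaV_ne_zero hτ (h 0) (by rw [this]; simp)

theorem exists_thetaH_ne_zero {τ : ℂ} (hτ : 0 < τ.im) : ∃ u, thetaH τ u ≠ 0 := by
  by_contra! h
  have : thetaH τ = fun _ => 0 := funext h
  exact deriv_thetaH_ne_zero hτ (h 0) (by rw [this]; simp)

theorem exists_theta1_ne_zero {τ : ℂ} (hτ : 0 < τ.im) : ∃ u, theta1 u τ ≠ 0 := by
  by_contra! h
  have : (fun u => theta1 u τ) = fun _ => 0 := funext h
  exact deriv_theta1_ne_zero hτ (h 0) (by rw [this]; simp)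

/-- The lattice `ℤπ + ℤπτ` does not contain `2π/3` modulo itself. -/
theorem theta1_third_ne_zero {τ u : ℂ} (hτ : 0 < τ.im) (h : theta1 u τ = 0) {k : ℤ}
    (hk : ¬ (3 ∣ k)) : theta1 (u + k * (π / 3)) τ ≠ 0 := by
  intro h2
  obtain ⟨m, n, hmn⟩ := (theta1_eq_zero_iff hτ).1 h
  obtain ⟨m', n', hmn'⟩ := (theta1_eq_zero_iff hτ).1 h2
  have e : (π : ℂ) * ((k : ℂ) / 3 - (m' - m)) = π * ((n' - n) * τ) := by
    linear_combination hmn' - hmn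
  have e2 := mul_left_cancel₀ ofReal_pi_ne_zero e
  have him := congrArg Complex.im e2
  have him' : (((n' - n : ℤ) : ℝ)) * τ.im = 0 := by
    rw [show ((k : ℂ) / 3 - (m' - m)) = (((k : ℝ) / 3 - (m' - m) : ℝ) : ℂ) by push_cast; ring,
      Complex.ofReal_im, show ((n' - n : ℂ)) * τ = ((n' - n : ℤ) : ℝ) * τ by push_cast; ring,
      Complex.im_ofReal_mul] at him
    exact him.symm
  have hn : ((n' - n : ℤ) : ℝ) = 0 := (mul_eq_zero.1 him').resolve_right hτ.ne'
  have hn' : (n' : ℂ) - n = 0 := by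
    have : (n' - n : ℤ) = 0 := by exact_mod_cast hn
    exact_mod_cast this
  rw [hn', zero_mul] at e2
  have e3 : (k : ℂ) = 3 * (m' - m) := by linear_combination 3 * e2
  exact hk ⟨m' - m, by exact_mod_cast e3⟩

theorem theta1_add_third_add_third (τ u : ℂ) :
    theta1 (u + 2 * π / 3 + 2 * π / 3) τ = theta1 (u - 2 * π / 3) τ := by
  rw [show u + 2 * π / 3 + 2 * π / 3 = u - 2 * π / 3 + π + π by ring, theta1_add_pi, theta1_add_pi,
    neg_neg]

/-- Both sides have the same multipliers under 2π/3 and πτ. The index of a zero of θ₁(3u|3τ) modulo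
3 tells which of the three factors vanishes there. -/
theorem exists_thetaV_eq {τ : ℂ} (hτ : 0 < τ.im) : ∃ c : ℂ, c ≠ 0 ∧ ∀ u,
    thetaV τ u = theta1 u τ * (c * (theta1 (u + 2 * π / 3) τ * theta1 (u - 2 * π / 3) τ)) := by
  have h1 := differentiable_theta1 hτ
  have hf : Differentiable ℂ fun u =>
      theta1 u τ * (theta1 (u + 2 * π / 3) τ * theta1 (u - 2 * π / 3) τ) :=
    h1.mul ((h1.comp (f := fun u : ℂ => u + 2 * π / 3) (by fun_prop)).mul
      (h1.comp (f := fun u : ℂ => u - 2 * π / 3) (by fun_prop)))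
  obtain ⟨z₀, hz₀⟩ := exists_thetaV_ne_zero hτ
  have key : ∃ c, ∀ u, theta1 u τ * (theta1 (u + 2 * π / 3) τ * theta1 (u - 2 * π / 3) τ) =
      c * thetaV τ u := by
    refine eq_const_mul_of_quasi_periodic (f := fun u => theta1 u τ *
      (theta1 (u + 2 * π / 3) τ * theta1 (u - 2 * π / 3) τ)) hf (differentiable_thetaV hτ) ?_
      (a := 2 * π / 3) (by positivity) (b := π * τ) (by rw [Complex.im_ofReal_mul]; positivity)
      (e₁ := fun _ => 1) (e₂ := fun u => -quasiFactor τ u ^ 6) (by simp)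
      (fun u => neg_ne_zero.2 (pow_ne_zero _ (quasiFactor_ne_zero _ _))) ?_ ?_ ?_ ?_ hz₀
    · intro z hz
      refine ⟨?_, deriv_thetaV_ne_zero hτ hz⟩
      obtain ⟨m, n, rfl⟩ := (thetaV_eq_zero_iff hτ).1 hz
      have : ∃ k : ℤ, m = 3 * k ∨ m = 3 * k + 1 ∨ m = 3 * k + 2 := ⟨m / 3, by omega⟩
      obtain ⟨k, rfl | rfl | rfl⟩ := this
      · rw [(theta1_eq_zero_iff hτ).2 ⟨k, n, by push_cast; ring⟩]; ring
      · rw [(theta1_eq_zero_iff (u := _ + 2 * π / 3) hτ).2 ⟨k + 1, n, by push_cast; ring⟩]; ring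
      · rw [(theta1_eq_zero_iff (u := _ - 2 * π / 3) hτ).2 ⟨k, n, by push_cast; ring⟩]; ring
    · intro u
      push_cast
      rw [theta1_add_third_add_third, show u + 2 * π / 3 - 2 * π / 3 = u by ring]; ring
    · intro u
      push_cast
      rw [thetaV_add_third, one_mul]
    · intro u
      have e : (quasiFactor τ (u + 2 * π / 3) * quasiFactor τ (u + -(2 * π / 3))) ^ 2 =
        (quasiFactor τ u ^ 2) ^ 2 := by rw [quasiFactor_mul_shift _ _ _ _ (by ring)]
      rw [show u + π * τ + 2 * π / 3 = u + 2 * π / 3 + π * τ by ring,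
        show u + π * τ - 2 * π / 3 = u - 2 * π / 3 + π * τ by ring, theta1_add_tau, theta1_add_tau,
        theta1_add_tau]
      rw [← sub_eq_add_neg] at e
      linear_combination (-quasiFactor τ u ^ 2 * (theta1 u τ * (theta1 (u + 2 * π / 3) τ *
        theta1 (u - 2 * π / 3) τ))) * e
    · exact thetaV_add_tau τ
  obtain ⟨c, hc⟩ := key
  have hc0 : c ≠ 0 := by
    rintro rfl
    obtain ⟨z₁, hz₁⟩ := exists_theta1_ne_zero hτ
    have h2 := exists_mul_ne_zero h1 ((h1.comp (f := fun u : ℂ => u + 2 * π / 3)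
      (by fun_prop)).mul (h1.comp (f := fun u : ℂ => u - 2 * π / 3) (by fun_prop))) ⟨z₁, hz₁⟩
      (exists_mul_ne_zero (h1.comp (f := fun u : ℂ => u + 2 * π / 3) (by fun_prop))
        (h1.comp (f := fun u : ℂ => u - 2 * π / 3) (by fun_prop))
        ⟨z₁ - 2 * π / 3, by simpa using hz₁⟩ ⟨z₁ + 2 * π / 3, by simpa using hz₁⟩)
    obtain ⟨z, hz⟩ := h2
    refine hz ((hc z).trans (zero_mul _))
  refine ⟨c⁻¹, inv_ne_zero hc0, fun u => ?_⟩
  rw [mul_left_comm, hc u, inv_mul_cancel_left₀ hc0]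

theorem theta4_triple_eq_zero_iff {τ u : ℂ} (hτ : 0 < τ.im) :
    theta4 (3 * u) (3 * τ) = 0 ↔ ∃ m n : ℤ, u = π * τ / 2 + m * (π / 3) + n * (π * τ) := by
  rw [theta4_eq_theta3, theta3_eq_zero_iff (im_three_mul hτ)]
  refine exists_congr fun m => exists_congr fun n => ?_
  constructor <;> intro h
  · linear_combination (1 / 3) * h
  · linear_combination 3 * h

/-- The shift by π/3 exchanges the two factors on the right, so their product has period π/3, and
its zeros are those of the left side. This turns the denominator defining E into values of T and T*.
-/
theorem exists_theta4_triple_eq {τ : ℂ} (hτ : 0 < τ.im) : ∃ c : ℂ, c ≠ 0 ∧ ∀ u,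
    theta4 (3 * u) (3 * τ) = c * (thetaT τ u * thetaTs τ u) := by
  have h3 := im_three_mul hτ
  have hT := differentiable_thetaT hτ
  have hTs := differentiable_thetaTs hτ
  have hgg : Differentiable ℂ fun u => theta3 u (3 * τ) := differentiable_theta3 h3
  have e4 : (fun u => theta4 (3 * u) (3 * τ)) = fun u => theta3 (3 * u + π / 2) (3 * τ) :=
    funext fun u => theta4_eq_theta3 _ _
  have hshift : Differentiable ℂ fun u => theta3 (u + π / 2) (3 * τ) :=
    hgg.comp (f := fun u : ℂ => u + π / 2) (by fun_prop)
  have hg : Differentiable ℂ fun u => theta4 (3 * u) (3 * τ) := by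
    rw [e4]
    exact hgg.comp (f := fun u : ℂ => 3 * u + π / 2) (by fun_prop)
  have hsimple : ∀ u, theta4 (3 * u) (3 * τ) = 0 →
      deriv (fun u => theta4 (3 * u) (3 * τ)) u ≠ 0 := by
    intro u hu
    rw [e4, deriv_comp_mul_const (f := fun u => theta3 (u + π / 2) (3 * τ)) hshift,
      deriv_comp_add_const (f := fun u => theta3 u (3 * τ))]
    rw [theta4_eq_theta3] at hu
    exact mul_ne_zero (by norm_num) (deriv_theta3_ne_zero h3 hu)
  have hz₀ : theta4 (3 * 0) (3 * τ) ≠ 0 := by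
    have := jacobiTheta₂_ofReal_ne_zero (1 / 2) h3
    simpa [theta4] using this
  have hT0 : thetaT τ 0 * thetaTs τ 0 ≠ 0 := by
    have h1 := jacobiTheta₂_ofReal_ne_zero (1 / 2) (im_three_halves hτ)
    have h2 := jacobiTheta₂_ofReal_ne_zero 0 (im_three_halves hτ)
    refine mul_ne_zero ?_ ?_
    · simpa [thetaT, theta3] using h2
    · simpa [thetaTs, theta4] using h1
  have key : ∃ c, ∀ u, thetaT τ u * thetaTs τ u = c * theta4 (3 * u) (3 * τ) := by
    refine eq_const_mul_of_quasi_periodic (f := fun u => thetaT τ u * thetaTs τ u)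
      (g := fun u => theta4 (3 * u) (3 * τ)) (hT.mul hTs) hg ?_
      (a := π / 3) (by positivity) (b := π * τ) (by rw [Complex.im_ofReal_mul]; positivity)
      (e₁ := fun _ => 1) (e₂ := fun u => -quasiFactor τ u ^ 6) (by simp)
      (fun u => neg_ne_zero.2 (pow_ne_zero _ (quasiFactor_ne_zero _ _))) ?_ ?_ ?_ ?_ hz₀
    · intro z hz
      refine ⟨?_, hsimple z hz⟩
      obtain ⟨m, n, rfl⟩ := (theta4_triple_eq_zero_iff hτ).1 hz
      obtain ⟨k, rfl | rfl⟩ := Int.even_or_odd' m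
      · rw [thetaTs_eq_third, (thetaT_eq_zero_iff (u := _ + π / 3) hτ).2
          ⟨k, n, by push_cast; ring⟩, mul_zero]
      · rw [(thetaT_eq_zero_iff hτ).2 ⟨k, n, by push_cast; ring⟩, zero_mul]
    · intro u
      push_cast
      rw [← thetaTs_eq_third, thetaTs_eq_third τ (u + π / 3),
        show u + π / 3 + π / 3 = u + 2 * π / 3 by ring, thetaT_add_third]; ring
    · intro u
      push_cast
      rw [theta4_eq_theta3, theta4_eq_theta3, one_mul, ← theta3_add_pi (3 * u + π / 2)]
      congr 1; ring
    · intro u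
      rw [thetaT_add_tau, thetaTs_add_tau]; ring
    · intro u
      rw [theta4_eq_theta3, theta4_eq_theta3, ← quasiFactor_scale']
      rw [show 3 * (u + π * τ) + π / 2 = 3 * u + π / 2 + π * (3 * τ) by ring, theta3_add_tau,
        quasiFactor_pow, quasiFactor_pow]
      congr 1
      rw [show -(I * (2 : ℕ) * (3 * u + π / 2 + π * (3 * τ) / 2)) =
        -(I * (2 : ℕ) * (3 * u + π * (3 * τ) / 2)) - π * I by push_cast; ring, Complex.exp_sub,
        Complex.exp_pi_mul_I]
      ring
  obtain ⟨c, hc⟩ := key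
  have hc0 : c ≠ 0 := by
    rintro rfl
    exact hT0 ((hc 0).trans (zero_mul _))
  refine ⟨c⁻¹, inv_ne_zero hc0, fun u => ?_⟩
  rw [hc u, inv_mul_cancel_left₀ hc0]

/-- Jacobi's derivative formula at the zero `π + πτ/2` of `θ₃(3u/2|3τ/2)`. -/
theorem two_mul_deriv_thetaT {τ : ℂ} (hτ : 0 < τ.im) :
    2 * deriv (thetaT τ) (π + π * τ / 2) =
      3 * I * (thetaT τ 0 * thetaTs τ 0) * thetaT τ (π * τ / 2) := by
  have hp := ofReal_pi_ne_zero
  have h3 := im_three_halves hτ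
  rw [deriv_thetaT hτ, deriv_theta3 _ h3]
  have e : deriv (fun z => jacobiTheta₂ z (3 * τ / 2)) (3 * (π + π * τ / 2) / 2 / π) =
      thetaDeriv (3 * τ / 2) := by
    rw [thetaDeriv, show 3 * (π + π * τ / 2) / 2 / π = 1 / 2 + 3 * τ / 2 / 2 + 1 by
      field_simp; ring, ← deriv_comp_add_const (f := fun z => jacobiTheta₂ z (3 * τ / 2))]
    simp_rw [jacobiTheta₂_add_left]
  rw [e, thetaDeriv_eq h3, thetaConst, thetaT, thetaT, thetaTs, theta3, theta3, theta4]
  rw [show 3 * (0 : ℂ) / 2 / π = 0 by simp, zero_add,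
    show 3 * (π * τ / 2) / 2 / π = 3 * τ / 2 / 2 by field_simp]
  field_simp

/-! ### Solutions of the TQ-relation and their difference Wronskian -/

/-- Possibly vanishing entire solutions of the `TQ`-relation with the symmetries of a
`Q`-eigenvalue. -/
structure IsSolution (n : ℕ) (τ : ℂ) (q : ℂ → ℂ) : Prop where
  entire : Differentiable ℂ q
  tq : ∀ u, phi n τ u * q u
      + phi n τ (u + 2 * π / 3) * q (u + 2 * π / 3)
      + phi n τ (u - 2 * π / 3) * q (u - 2 * π / 3) = 0
  periodic : ∀ u, q (u + 2 * π) = q u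
  even : ∀ u, q (-u) = q u
  quasi_periodic : ∀ u, q (u + π * τ) = quasiFactor τ u ^ (2 * n + 1) * q u

theorem IsQEigenvalue.isSolution {n : ℕ} {τ : ℂ} {q : ℂ → ℂ} (h : IsQEigenvalue n τ q) :
    IsSolution n τ q where
  entire := h.entire
  tq := h.tq
  periodic := h.periodic
  even := h.even
  quasi_periodic u := by
    rw [h.quasi_periodic, quasiFactor_pow]; push_cast; rfl

theorem IsSolution.const_mul_sub {n : ℕ} {τ : ℂ} {x q : ℂ → ℂ} (hx : IsSolution n τ x)
    (hq : IsSolution n τ q) (a b : ℂ) : IsSolution n τ (fun u => a * x u - b * q u) where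
  entire := (hx.entire.const_mul a).sub (hq.entire.const_mul b)
  tq u := by linear_combination a * hx.tq u - b * hq.tq u
  periodic u := by rw [hx.periodic, hq.periodic]
  even u := by rw [hx.even, hq.even]
  quasi_periodic u := by rw [hx.quasi_periodic, hq.quasi_periodic]; ring

theorem differentiable_phi (n : ℕ) {τ : ℂ} (hτ : 0 < τ.im) : Differentiable ℂ (phi n τ) :=
  (differentiable_theta1 hτ).pow _

theorem phi_neg (n : ℕ) (τ u : ℂ) : phi n τ (-u) = -phi n τ u := by
  rw [phi, phi, theta1_neg, Odd.neg_pow ⟨n, rfl⟩]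

theorem phi_add_pi (n : ℕ) (τ u : ℂ) : phi n τ (u + π) = -phi n τ u := by
  rw [phi, phi, theta1_add_pi, Odd.neg_pow ⟨n, rfl⟩]

theorem phi_add_two_pi (n : ℕ) (τ u : ℂ) : phi n τ (u + 2 * π) = phi n τ u := by
  rw [show u + 2 * π = u + π + π by ring, phi_add_pi, phi_add_pi, neg_neg]

theorem phi_add_tau (n : ℕ) (τ u : ℂ) :
    phi n τ (u + π * τ) = -quasiFactor τ u ^ (4 * n + 2) * phi n τ u := by
  rw [phi, phi, theta1_add_tau, mul_pow, Odd.neg_pow ⟨n, rfl⟩, ← pow_mul]; ring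

theorem exists_phi_ne_zero (n : ℕ) {τ : ℂ} (hτ : 0 < τ.im) : ∃ u, phi n τ u ≠ 0 := by
  obtain ⟨u, hu⟩ := exists_theta1_ne_zero hτ
  exact ⟨u, pow_ne_zero _ hu⟩

theorem phi_eq_zero_iff {n : ℕ} {τ u : ℂ} : phi n τ u = 0 ↔ theta1 u τ = 0 := by
  rw [phi, pow_eq_zero_iff (by omega)]

theorem phi_add_third_ne_zero {n : ℕ} {τ u : ℂ} (hτ : 0 < τ.im) (h : theta1 u τ = 0) :
    phi n τ (u + 2 * π / 3) ≠ 0 := by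
  rw [Ne, phi_eq_zero_iff]
  have := theta1_third_ne_zero hτ h (k := 2) (by norm_num)
  rwa [show u + (2 : ℤ) * (π / 3 : ℂ) = u + 2 * π / 3 by push_cast; ring] at this

theorem theta1_add_third_ne_zero {τ u : ℂ} (hτ : 0 < τ.im) (h : theta1 u τ = 0) :
    theta1 (u + 2 * π / 3) τ ≠ 0 := by
  have := phi_add_third_ne_zero (n := 0) hτ h
  rwa [Ne, phi_eq_zero_iff] at this

theorem theta1_sub_third_ne_zero {τ u : ℂ} (hτ : 0 < τ.im) (h : theta1 u τ = 0) :
    theta1 (u - 2 * π / 3) τ ≠ 0 := by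
  have := theta1_third_ne_zero hτ h (k := -2) (by norm_num)
  rwa [show u + (-2 : ℤ) * (π / 3 : ℂ) = u - 2 * π / 3 by push_cast; ring] at this

theorem add_third_add_third_of_periodic {f : ℂ → ℂ} (hf : ∀ u, f (u + 2 * π) = f u) (u : ℂ) :
    f (u + 2 * π / 3 + 2 * π / 3) = f (u - 2 * π / 3) := by
  rw [← hf (u - 2 * π / 3)]; congr 1; ring

theorem sub_third_sub_third_of_periodic {f : ℂ → ℂ} (hf : ∀ u, f (u + 2 * π) = f u) (u : ℂ) :
    f (u - 2 * π / 3 - 2 * π / 3) = f (u + 2 * π / 3) := by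
  rw [← hf (u - 2 * π / 3 - 2 * π / 3)]; congr 1; ring

/-- Any two solutions have vanishing difference Wronskian. -/
theorem IsSolution.wronskian_eq_zero {n : ℕ} {τ : ℂ} (hτ : 0 < τ.im) {x q : ℂ → ℂ}
    (hx : IsSolution n τ x) (hq : IsSolution n τ q) (u : ℂ) :
    x (u + 2 * π / 3) * q u = q (u + 2 * π / 3) * x u := by
  classical
  have hxe := hx.entire
  have hqe := hq.entire
  have hphi := differentiable_phi n hτ
  set W : ℂ → ℂ := fun u => x (u + 2 * π / 3) * q u - q (u + 2 * π / 3) * x u with hW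
  have hWd : Differentiable ℂ W := by fun_prop
  -- Eliminating the middle term φ(u)x(u)q(u) between the two TQ-relations.
  have hrel : ∀ u, phi n τ (u + 2 * π / 3) * W u = phi n τ (u - 2 * π / 3) * W (u - 2 * π / 3) := by
    intro u
    simp only [hW, sub_add_cancel]
    linear_combination q u * hx.tq u - x u * hq.tq u
  have hz : ∀ u, phi n τ (u - 2 * π / 3) = 0 → phi n τ (u + 2 * π / 3) ≠ 0 := by
    intro u hu
    rw [phi_eq_zero_iff] at hu
    rw [Ne, phi_eq_zero_iff]
    have := theta1_sub_third_ne_zero hτ hu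
    rwa [sub_third_sub_third_of_periodic (f := fun u => theta1 u τ)
      (fun u => by rw [show u + 2 * π = u + π + π by ring, theta1_add_pi, theta1_add_pi,
        neg_neg])] at this
  -- The zeros of φ have order 2n + 1, so division at simple zeros does not apply. By `hrel` the
  -- quotient is also W(u - 2π/3)/φ(u + 2π/3), and by `hz` the two denominators never vanish
  -- together.
  obtain ⟨k, hk, hWk⟩ : ∃ k : ℂ → ℂ, Differentiable ℂ k ∧ ∀ u, W u = phi n τ (u - 2 * π / 3) * k u := by
    have hd1 : Differentiable ℂ fun u => phi n τ (u - 2 * π / 3) := by fun_prop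
    have hd2 : Differentiable ℂ fun u => phi n τ (u + 2 * π / 3) := by fun_prop
    have hd3 : Differentiable ℂ fun u => W (u - 2 * π / 3) := by fun_prop
    refine ⟨fun u => if phi n τ (u - 2 * π / 3) = 0 then
      W (u - 2 * π / 3) / phi n τ (u + 2 * π / 3) else W u / phi n τ (u - 2 * π / 3), ?_, ?_⟩
    · intro u
      by_cases h0 : phi n τ (u - 2 * π / 3) = 0
      · refine ((hd3 u).div (hd2 u) (hz u h0)).congr_of_eventuallyEq ?_
        filter_upwards [(hd2 u).continuousAt.eventually_ne (hz u h0)] with w hw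
        split_ifs with h1
        · rfl
        · simp only [Pi.div_apply]
          rw [div_eq_div_iff h1 hw]
          linear_combination hrel w
      · refine ((hWd u).div (hd1 u) h0).congr_of_eventuallyEq ?_
        filter_upwards [(hd1 u).continuousAt.eventually_ne h0] with w hw
        simp [hw]
    · intro u
      by_cases h0 : phi n τ (u - 2 * π / 3) = 0
      · have := hrel u
        rw [h0, zero_mul, mul_eq_zero] at this
        simp [h0, this.resolve_left (hz u h0)]
      · simp only [h0, if_false]
        rw [mul_comm, div_mul_cancel₀ _ h0]
  obtain ⟨z₀, hz₀⟩ := exists_phi_ne_zero n hτ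
  have hd1 : Differentiable ℂ fun u => phi n τ (u - 2 * π / 3) := by fun_prop
  have hz₁ : (fun u => phi n τ (u - 2 * π / 3)) (z₀ + 2 * π / 3) ≠ 0 := by simpa using hz₀
  have k1 : ∀ u, k (u + 2 * π / 3) = k u := by
    obtain ⟨z₂, hz₂⟩ := exists_mul_ne_zero hd1 hphi ⟨_, hz₁⟩ ⟨_, hz₀⟩
    refine entire_mul_cancel' (f₁ := fun u => k (u + 2 * π / 3)) (by fun_prop) hk
      (hd1.mul hphi) hz₂ fun u => ?_
    have e1 := hWk (u + 2 * π / 3)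
    have e2 := hrel (u + 2 * π / 3)
    rw [add_sub_cancel_right] at e1 e2
    rw [add_third_add_third_of_periodic (phi_add_two_pi n τ), e1, hWk] at e2
    simp only [Pi.mul_apply]
    linear_combination e2
  have hmu : ∀ u, quasiFactor τ (u + 2 * π / 3) * quasiFactor τ u =
      quasiFactor τ (u - 2 * π / 3) ^ 2 := by
    intro u
    rw [quasiFactor_pow, quasiFactor, quasiFactor, ← Complex.exp_add,
      ← Complex.exp_periodic.sub_eq (-(I * (2 : ℕ) * (u - 2 * π / 3 + π * τ / 2)))]
    congr 1; push_cast; ring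
  -- W has multiplier given by a power of `quasiFactor`, φ by minus the same power. The leftover
  -- sign kills the constant.
  have k2 : ∀ u, k (u + π * τ) = -1 * k u := by
    refine quotient_quasi_periodic (f := W) hd1 hk (ε := fun _ => -1)
      (e := fun u => -quasiFactor τ (u - 2 * π / 3) ^ (4 * n + 2)) (by fun_prop)
      (fun u => neg_ne_zero.2 (pow_ne_zero _ (quasiFactor_ne_zero _ _))) hWk ?_ ?_ hz₁
    · intro u
      simp only [hW]
      rw [show u + π * τ + 2 * π / 3 = u + 2 * π / 3 + π * τ by ring, hx.quasi_periodic,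
        hx.quasi_periodic, hq.quasi_periodic, hq.quasi_periodic,
        show 4 * n + 2 = 2 * (2 * n + 1) by ring, pow_mul, ← hmu, mul_pow]
      ring
    · intro u
      rw [show u + π * τ - 2 * π / 3 = u - 2 * π / 3 + π * τ by ring, phi_add_tau]
  have hconst := entire_eq_const_of_norm_periodic hk (a := 2 * π / 3) (by positivity) (b := π * τ)
    (by rw [Complex.im_ofReal_mul]; positivity) (fun u => by push_cast; rw [k1])
    (fun u => by rw [k2, neg_one_mul, norm_neg])
  have hk0 : ∀ u, k u = 0 := by
    intro u
    have := k2 u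
    rw [hconst (u + π * τ) u] at this
    linear_combination (1 / 2) * this
  have := hWk u
  rw [hk0, mul_zero] at this
  exact sub_eq_zero.1 this

/-! ### The differential Wronskian and uniqueness of solutions -/

/-- The symmetries of `h = φ q` for a solution `q`. -/
structure IsOddSolution (n : ℕ) (τ : ℂ) (h : ℂ → ℂ) : Prop where
  entire : Differentiable ℂ h
  sum_eq_zero : ∀ u, h u + h (u + 2 * π / 3) + h (u - 2 * π / 3) = 0
  periodic : ∀ u, h (u + 2 * π) = h u
  odd : ∀ u, h (-u) = -h u
  quasi_periodic : ∀ u, h (u + π * τ) = -quasiFactor τ u ^ (6 * n + 3) * h u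

theorem IsSolution.isOddSolution {n : ℕ} {τ : ℂ} (hτ : 0 < τ.im) {q : ℂ → ℂ}
    (hq : IsSolution n τ q) : IsOddSolution n τ (fun u => phi n τ u * q u) where
  entire := (differentiable_phi n hτ).mul hq.entire
  sum_eq_zero := hq.tq
  periodic u := by rw [phi_add_two_pi, hq.periodic]
  odd u := by rw [phi_neg, hq.even]; ring
  quasi_periodic u := by rw [phi_add_tau, hq.quasi_periodic]; ring

theorem differentiable_deriv {f : ℂ → ℂ} (hf : Differentiable ℂ f) : Differentiable ℂ (deriv f) :=
  fun z => ((hf.analyticAt z).deriv).differentiableAt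

namespace IsOddSolution

variable {n : ℕ} {τ : ℂ} {h : ℂ → ℂ}

theorem deriv_sum (hh : IsOddSolution n τ h) (u : ℂ) :
    deriv h u + deriv h (u + 2 * π / 3) + deriv h (u - 2 * π / 3) = 0 := by
  have hd := hh.entire
  have e : (fun u => h u + h (u + 2 * π / 3) + h (u - 2 * π / 3)) = fun _ => 0 :=
    funext hh.sum_eq_zero
  have e2 := congrFun (congrArg deriv e) u
  rw [deriv_fun_add (by fun_prop) (by fun_prop), deriv_fun_add (by fun_prop) (by fun_prop),
    deriv_comp_add_const, deriv_comp_sub_const] at e2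
  simpa using e2

theorem deriv_periodic (hh : IsOddSolution n τ h) (u : ℂ) : deriv h (u + 2 * π) = deriv h u := by
  rw [← deriv_comp_add_const]; congr 1; funext u; exact hh.periodic u

theorem deriv_even (hh : IsOddSolution n τ h) (u : ℂ) : deriv h (-u) = deriv h u := by
  have e : (fun u => h (-u)) = fun u => -h u := funext hh.odd
  have e2 := congrFun (congrArg deriv e) u
  rw [deriv_comp_neg, deriv.fun_neg] at e2
  linear_combination -e2

theorem deriv_quasiFactor_pow (τ u : ℂ) (k : ℕ) :
    deriv (fun u => quasiFactor τ u ^ k) u = -(I * k) * quasiFactor τ u ^ k := by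
  simp_rw [quasiFactor_pow]
  have : HasDerivAt (fun u => Complex.exp (-(I * k * (u + π * τ / 2))))
      (Complex.exp (-(I * k * (u + π * τ / 2))) * (-(I * k * 1))) u :=
    ((((hasDerivAt_id' u).add_const _).const_mul _).neg).cexp
  rw [this.deriv]; ring

theorem deriv_quasi_periodic (hh : IsOddSolution n τ h) (u : ℂ) :
    deriv h (u + π * τ) =
      -quasiFactor τ u ^ (6 * n + 3) * (deriv h u - I * (6 * n + 3) * h u) := by
  have hd := hh.entire
  have hm := differentiable_quasiFactor τ
  have e : (fun u => h (u + π * τ)) = fun u => -quasiFactor τ u ^ (6 * n + 3) * h u :=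
    funext hh.quasi_periodic
  have e2 := congrFun (congrArg deriv e) u
  rw [deriv_comp_add_const, deriv_fun_mul (by fun_prop) (by fun_prop), deriv.fun_neg,
    deriv_quasiFactor_pow] at e2
  rw [e2]; push_cast; ring

end IsOddSolution

/-- The Wronskian of `h(u + 2π/3)` and `h(u - 2π/3)`. -/
noncomputable def oddWronskian (h : ℂ → ℂ) (u : ℂ) : ℂ :=
  deriv h (u + 2 * π / 3) * h (u - 2 * π / 3) - h (u + 2 * π / 3) * deriv h (u - 2 * π / 3)

namespace IsOddSolution

variable {n : ℕ} {τ : ℂ} {h : ℂ → ℂ}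

theorem differentiable_oddWronskian (hh : IsOddSolution n τ h) :
    Differentiable ℂ (oddWronskian h) := by
  have h1 := hh.entire
  have h2 := differentiable_deriv h1
  unfold oddWronskian
  fun_prop

theorem deriv_oddWronskian (hh : IsOddSolution n τ h) (u : ℂ) :
    deriv (oddWronskian h) u = deriv (deriv h) (u + 2 * π / 3) * h (u - 2 * π / 3)
      - h (u + 2 * π / 3) * deriv (deriv h) (u - 2 * π / 3) := by
  have hd := hh.entire
  have hd2 := differentiable_deriv hd
  have : oddWronskian h = fun u => deriv h (u + 2 * π / 3) * h (u - 2 * π / 3)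
    - h (u + 2 * π / 3) * deriv h (u - 2 * π / 3) := rfl
  rw [this, deriv_fun_sub (by fun_prop) (by fun_prop), deriv_fun_mul (by fun_prop) (by fun_prop),
    deriv_fun_mul (by fun_prop) (by fun_prop), deriv_comp_add_const, deriv_comp_sub_const,
    deriv_comp_add_const, deriv_comp_sub_const]
  ring

/-- Since the three shifts of h add up to zero, the Wronskians of cyclically consecutive shifts
coincide. This yields the 2π/3-periodicity. -/
theorem oddWronskian_eq (hh : IsOddSolution n τ h) (u : ℂ) :
    oddWronskian h u = deriv h u * h (u + 2 * π / 3) - h u * deriv h (u + 2 * π / 3) := by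
  rw [oddWronskian]
  linear_combination deriv h (u + 2 * π / 3) * hh.sum_eq_zero u
    - h (u + 2 * π / 3) * hh.deriv_sum u

theorem oddWronskian_eq' (hh : IsOddSolution n τ h) (u : ℂ) :
    oddWronskian h u = deriv h (u - 2 * π / 3) * h u - h (u - 2 * π / 3) * deriv h u := by
  rw [oddWronskian]
  linear_combination h (u - 2 * π / 3) * hh.deriv_sum u
    - deriv h (u - 2 * π / 3) * hh.sum_eq_zero u

theorem oddWronskian_add_third (hh : IsOddSolution n τ h) (u : ℂ) :
    oddWronskian h (u + 2 * π / 3) = oddWronskian h u := by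
  rw [hh.oddWronskian_eq' u, oddWronskian, add_third_add_third_of_periodic hh.periodic,
    add_third_add_third_of_periodic hh.deriv_periodic, add_sub_cancel_right]

theorem oddWronskian_neg (hh : IsOddSolution n τ h) (u : ℂ) :
    oddWronskian h (-u) = oddWronskian h u := by
  rw [oddWronskian, oddWronskian, show -u + 2 * π / 3 = -(u - 2 * π / 3) by ring,
    show -u - 2 * π / 3 = -(u + 2 * π / 3) by ring, hh.odd, hh.odd, hh.deriv_even, hh.deriv_even]
  ring

theorem oddWronskian_quasi_periodic (hh : IsOddSolution n τ h) (u : ℂ) :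
    oddWronskian h (u + π * τ) = quasiFactor τ u ^ 6 * quasiFactor τ u ^ (12 * n) *
      oddWronskian h u := by
  have e1 : quasiFactor τ (u + 2 * π / 3) ^ (6 * n + 3) = quasiFactor τ u ^ (6 * n + 3) := by
    rw [show 6 * n + 3 = 3 * (2 * n + 1) by ring, pow_mul, quasiFactor_add_third, ← pow_mul]
  have e2 : quasiFactor τ (u - 2 * π / 3) ^ (6 * n + 3) = quasiFactor τ u ^ (6 * n + 3) := by
    rw [show 6 * n + 3 = 3 * (2 * n + 1) by ring, pow_mul, quasiFactor_sub_third, ← pow_mul]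
  rw [oddWronskian, oddWronskian, show u + π * τ + 2 * π / 3 = u + 2 * π / 3 + π * τ by ring,
    show u + π * τ - 2 * π / 3 = u - 2 * π / 3 + π * τ by ring, hh.quasi_periodic,
    hh.quasi_periodic, hh.deriv_quasi_periodic, hh.deriv_quasi_periodic, e1, e2]
  ring

/-- A solution with vanishing Wronskian vanishes. -/
theorem eq_zero_of_oddWronskian (hh : IsOddSolution n τ h) (h0 : ∀ u, oddWronskian h u = 0) :
    ∀ u, h u = 0 := by
  have hd := hh.entire
  -- If F is not identically zero, adding the two forms of the Wronskian shows that h is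
  -- proportional to F; but h is odd and F is even.
  set F : ℂ → ℂ := fun u => h (u + 2 * π / 3) - h (u - 2 * π / 3) with hF
  have hFd : Differentiable ℂ F := by fun_prop
  have hF' : ∀ u, deriv F u = deriv h (u + 2 * π / 3) - deriv h (u - 2 * π / 3) := by
    intro u
    rw [hF, deriv_fun_sub (by fun_prop) (by fun_prop), deriv_comp_add_const, deriv_comp_sub_const]
  by_cases hF0 : ∃ z, F z ≠ 0
  · obtain ⟨z, hz⟩ := hF0
    have := entire_proportional hd hFd hz (fun u => by
      rw [hF']
      simp only [hF]
      have e1 := hh.oddWronskian_eq u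
      have e2 := hh.oddWronskian_eq' u
      rw [h0] at e1 e2
      linear_combination -e1 - e2)
    intro u
    have h1 := this u
    have h2 := this (-u)
    rw [hh.odd] at h2
    have h3 : F (-u) = F u := by
      simp only [hF]
      rw [show -u + 2 * π / 3 = -(u - 2 * π / 3) by ring,
        show -u - 2 * π / 3 = -(u + 2 * π / 3) by ring, hh.odd, hh.odd]
      ring
    rw [h3] at h2
    linear_combination (1 / 2) * h1 - (1 / 2) * h2
  · push Not at hF0
    -- Three such shifts make up the period 2π, so h = (-2)³h.
    have h1 : ∀ u, h u = -2 * h (u + 2 * π / 3) := by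
      intro u
      have := hF0 u
      simp only [hF] at this
      linear_combination hh.sum_eq_zero u + this
    intro u
    have e1 := h1 u
    have e2 := h1 (u + 2 * π / 3)
    have e3 := h1 (u + 2 * π / 3 + 2 * π / 3)
    rw [show u + 2 * π / 3 + 2 * π / 3 + 2 * π / 3 = u + 2 * π by ring, hh.periodic] at e3
    have : 9 * h u = 0 := by linear_combination e1 - 2 * e2 + 4 * e3
    simpa using this

end IsOddSolution

/-- Both h and h' contain the factor θ₁²ⁿ, because φ = θ₁²ⁿ⁺¹. -/
theorem IsSolution.oddWronskian_eq_theta1_pow_mul {n : ℕ} {τ : ℂ} (hτ : 0 < τ.im) {q : ℂ → ℂ}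
    (hq : IsSolution n τ q) : ∃ E : ℂ → ℂ, Differentiable ℂ E ∧
      ∀ u, oddWronskian (fun u => phi n τ u * q u) u = theta1 u τ ^ (2 * n) * E u := by
  have hh := hq.isOddSolution hτ
  have h1 := hh.entire
  have h2 := differentiable_deriv h1
  have ht := differentiable_theta1 hτ
  have ht2 := differentiable_deriv ht
  have hqd := hq.entire
  have hqd2 := differentiable_deriv hqd
  set h : ℂ → ℂ := fun u => phi n τ u * q u with hdef
  refine ⟨fun u => ((2 * n + 1) * deriv (fun u => theta1 u τ) u * q u + theta1 u τ * deriv q u) *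
    h (u + 2 * π / 3) - theta1 u τ * q u * deriv h (u + 2 * π / 3), by fun_prop, fun u => ?_⟩
  have e : deriv h u = theta1 u τ ^ (2 * n) *
      ((2 * n + 1) * deriv (fun u => theta1 u τ) u * q u + theta1 u τ * deriv q u) := by
    simp only [hdef, phi]
    rw [deriv_fun_mul (by fun_prop) (by fun_prop), deriv_fun_pow (ht u)]
    push_cast
    ring
  rw [hh.oddWronskian_eq, e]
  simp only [hdef, phi]
  ring

/-- The Wronskian attached to a solution is divisible by `θ₁(3u|3τ)^{2n}`. -/
theorem IsSolution.exists_oddWronskian_eq {n : ℕ} {τ : ℂ} (hτ : 0 < τ.im) {q : ℂ → ℂ}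
    (hq : IsSolution n τ q) : ∃ k : ℂ → ℂ, Differentiable ℂ k ∧
      ∀ u, oddWronskian (fun u => phi n τ u * q u) u = thetaV τ u ^ (2 * n) * k u := by
  have hh := hq.isOddSolution hτ
  have hV := differentiable_thetaV hτ
  have ht := differentiable_theta1 hτ
  obtain ⟨E, hE, hEeq⟩ := hq.oddWronskian_eq_theta1_pow_mul hτ
  obtain ⟨c, hc, hVeq⟩ := exists_thetaV_eq hτ
  obtain ⟨z₀, hz₀⟩ := exists_thetaV_ne_zero hτ
  obtain ⟨z₁, hz₁⟩ := exists_theta1_ne_zero hτ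
  -- One simple factor V is removed at a time. Divisibility by θ₁²ⁿ gives a zero of the quotient at
  -- the zeros of θ₁, and periodicity carries it to all zeros of V.
  suffices H : ∀ j ≤ 2 * n, ∃ k : ℂ → ℂ, Differentiable ℂ k ∧
      ∀ u, oddWronskian (fun u => phi n τ u * q u) u = thetaV τ u ^ j * k u from H _ le_rfl
  intro j
  induction j with
  | zero => exact fun _ => ⟨_, hh.differentiable_oddWronskian, fun u => by simp⟩
  | succ j ih =>
    intro hj
    obtain ⟨k, hk, hkeq⟩ := ih (by omega)
    have hper : ∀ u, k (u + 2 * π / 3) = k u := by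
      refine entire_mul_cancel' (f₁ := fun u => k (u + 2 * π / 3)) (by fun_prop) hk (hV.pow j)
        (z₀ := z₀) (pow_ne_zero _ hz₀) fun u => ?_
      have := hkeq (u + 2 * π / 3)
      rw [hh.oddWronskian_add_third, hkeq u, thetaV_add_third] at this
      exact this.symm
    have hcancel : ∀ u, theta1 u τ ^ (2 * n - j) * E u =
        (c * (theta1 (u + 2 * π / 3) τ * theta1 (u - 2 * π / 3) τ)) ^ j * k u := by
      have d1 : Differentiable ℂ fun u => theta1 (u + 2 * π / 3) τ :=
        ht.comp (f := fun u : ℂ => u + 2 * π / 3) (by fun_prop)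
      have d2 : Differentiable ℂ fun u => theta1 (u - 2 * π / 3) τ :=
        ht.comp (f := fun u : ℂ => u - 2 * π / 3) (by fun_prop)
      refine entire_mul_cancel' (g := fun u => theta1 u τ ^ j) (by fun_prop) (by fun_prop)
        (by fun_prop) (pow_ne_zero j hz₁) fun u => ?_
      have h1 := hEeq u
      rw [hkeq u, hVeq u, mul_pow] at h1
      rw [← mul_assoc, ← pow_add, show j + (2 * n - j) = 2 * n by omega, ← h1]
      ring
    have hzero : ∀ u, theta1 u τ = 0 → k u = 0 := by
      intro u hu
      have := hcancel u
      rw [hu, zero_pow (by omega), zero_mul, eq_comm, mul_eq_zero] at this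
      exact this.resolve_left (pow_ne_zero _ (mul_ne_zero hc (mul_ne_zero
        (theta1_add_third_ne_zero hτ hu) (theta1_sub_third_ne_zero hτ hu))))
    obtain ⟨k', hk', hkk⟩ := exists_entire_quotient hk hV (fun u hu => by
      refine ⟨?_, deriv_thetaV_ne_zero hτ hu⟩
      rw [hVeq u] at hu
      simp only [mul_eq_zero, hc, false_or] at hu
      rcases hu with hu | hu | hu
      · exact hzero u hu
      · rw [← hper]; exact hzero _ hu
      · rw [← sub_add_cancel u (2 * π / 3), hper]; exact hzero _ hu)
    exact ⟨k', hk', fun u => by rw [hkeq u, hkk u, pow_succ]; ring⟩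

/-- A solution vanishing at three points `u₀`, `u₀ ± 2π/3` in general position vanishes. -/
theorem IsSolution.eq_zero_of_three_zeros {n : ℕ} {τ : ℂ} (hτ : 0 < τ.im) {y : ℂ → ℂ}
    (hy : IsSolution n τ y) {u₀ : ℂ} (h0 : y u₀ = 0) (h1 : y (u₀ + 2 * π / 3) = 0)
    (h2 : y (u₀ - 2 * π / 3) = 0) (hV0 : thetaV τ u₀ ≠ 0) (hH0 : thetaH τ (2 * u₀) ≠ 0) :
    ∀ u, y u = 0 := by
  have hh := hy.isOddSolution hτ
  have hphi := differentiable_phi n hτ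
  have hV := differentiable_thetaV hτ
  have hH := differentiable_thetaH hτ
  have hyd := hy.entire
  obtain ⟨k, hk, hkeq⟩ := hy.exists_oddWronskian_eq hτ
  obtain ⟨zV, hzV⟩ := exists_thetaV_ne_zero hτ
  have hzVp : thetaV τ zV ^ (2 * n) ≠ 0 := pow_ne_zero _ hzV
  have kper : ∀ u, k (u + 2 * π / 3) = k u := by
    refine entire_mul_cancel' (f₁ := fun u => k (u + 2 * π / 3)) (by fun_prop) hk (hV.pow (2 * n))
      (z₀ := zV) hzVp fun u => ?_
    have := hkeq (u + 2 * π / 3)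
    rw [hh.oddWronskian_add_third, hkeq u, thetaV_add_third] at this
    exact this.symm
  -- With period 2π/3, the multiplier `quasiFactor τ u ^ 6` means that k has order two, hence two
  -- zeros modulo periods unless it vanishes.
  have kquasi : ∀ u, k (u + π * τ) = quasiFactor τ u ^ 6 * k u := by
    refine quotient_quasi_periodic (f := oddWronskian (fun u => phi n τ u * y u))
      (hV.pow (2 * n)) hk ((differentiable_quasiFactor τ).pow 6)
      (e := fun u => quasiFactor τ u ^ (12 * n))
      (fun u => pow_ne_zero _ (quasiFactor_ne_zero _ _)) hkeq
      hh.oddWronskian_quasi_periodic (fun u => ?_) hzVp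
    rw [Pi.pow_apply, Pi.pow_apply, thetaV_add_tau, mul_pow, Even.neg_pow (by simp), ← pow_mul]
    ring_nf
  have h0' : phi n τ u₀ * y u₀ = 0 := by rw [h0, mul_zero]
  have h1' : phi n τ (u₀ + 2 * π / 3) * y (u₀ + 2 * π / 3) = 0 := by rw [h1, mul_zero]
  have h2' : phi n τ (u₀ - 2 * π / 3) * y (u₀ - 2 * π / 3) = 0 := by rw [h2, mul_zero]
  have om0 : oddWronskian (fun u => phi n τ u * y u) u₀ = 0 := by
    simp only [oddWronskian, h1', h2']; ring
  have k0 : k u₀ = 0 := by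
    rw [hkeq, mul_eq_zero] at om0
    exact om0.resolve_left (pow_ne_zero _ hV0)
  have k0' : k (-u₀) = 0 := by
    have := hh.oddWronskian_neg u₀
    rw [om0, hkeq, mul_eq_zero, thetaV_neg] at this
    exact this.resolve_left (pow_ne_zero _ (neg_ne_zero.2 hV0))
  -- The derivative of the Wronskian involves h'' only multiplied by h at a shifted point, and h
  -- vanishes at both shifts of u₀. Thus u₀ is a double zero.
  have dom0 : deriv (oddWronskian (fun u => phi n τ u * y u)) u₀ = 0 := by
    rw [hh.deriv_oddWronskian, h1', h2']; ring
  have dk0 : deriv k u₀ = 0 := by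
    rw [show oddWronskian (fun u => phi n τ u * y u) = fun u => thetaV τ u ^ (2 * n) * k u from
      funext hkeq, deriv_fun_mul (by fun_prop) (by fun_prop), k0, mul_zero, zero_add,
      mul_eq_zero] at dom0
    exact dom0.resolve_left (pow_ne_zero _ hV0)
  have hzeros : ∀ (z : ℂ) (m l : ℤ), k z = 0 → k (z + m * (2 * π / 3) + l * (π * τ)) = 0 :=
    fun z m l hz => exists_int_shift_induction (P := fun z => k z = 0) hz
      (fun u => by rw [kper]) (fun u => by rw [kquasi, mul_eq_zero,
        or_iff_right (pow_ne_zero _ (quasiFactor_ne_zero _ _))]) m l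
  have hHm : Differentiable ℂ fun u => thetaH τ (u - u₀) := by fun_prop
  have hHp : Differentiable ℂ fun u => thetaH τ (u + u₀) := by fun_prop
  obtain ⟨zH, hzH⟩ := exists_thetaH_ne_zero hτ
  have hdm : ∀ u, thetaH τ (u - u₀) = 0 → deriv (fun u => thetaH τ (u - u₀)) u ≠ 0 := by
    intro u hu
    rw [deriv_comp_sub_const]
    exact deriv_thetaH_ne_zero hτ hu
  have hdp : ∀ u, thetaH τ (u + u₀) = 0 → deriv (fun u => thetaH τ (u + u₀)) u ≠ 0 := by
    intro u hu
    rw [deriv_comp_add_const]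
    exact deriv_thetaH_ne_zero hτ hu
  obtain ⟨k₁, hk₁, hkk₁⟩ := exists_entire_quotient hk hHm (fun u hu => by
    refine ⟨?_, hdm u hu⟩
    obtain ⟨m, l, hml⟩ := (thetaH_eq_zero_iff hτ).1 hu
    rw [show u = u₀ + m * (2 * π / 3) + l * (π * τ) by linear_combination hml]
    exact hzeros _ _ _ k0)
  -- The zero sets of H(u - u₀) and H(u + u₀) are disjoint, since H(2u₀) ≠ 0; so the zero of k at
  -- -u₀ passes to k₁.
  obtain ⟨k₂, hk₂, hkk₂⟩ := exists_entire_quotient hk₁ hHp (fun u hu => by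
    refine ⟨?_, hdp u hu⟩
    obtain ⟨m, l, hml⟩ := (thetaH_eq_zero_iff hτ).1 hu
    have e : u = -u₀ + m * (2 * π / 3) + l * (π * τ) := by linear_combination hml
    have hku : k u = 0 := by rw [e]; exact hzeros _ _ _ k0'
    rw [hkk₁, mul_eq_zero] at hku
    refine hku.resolve_left fun h3 => ?_
    obtain ⟨m', l', hml'⟩ := (thetaH_eq_zero_iff hτ).1 h3
    refine hH0 ((thetaH_eq_zero_iff hτ).2 ⟨m - m', l - l', ?_⟩)
    push_cast
    linear_combination hml - hml')
  have hkk : ∀ u, k u = thetaH τ (u - u₀) * thetaH τ (u + u₀) * k₂ u := by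
    intro u; rw [hkk₁, hkk₂]; ring
  obtain ⟨z₂, hz₂⟩ := exists_mul_ne_zero hHm hHp ⟨zH + u₀, by simpa using hzH⟩
    ⟨zH - u₀, by simpa using hzH⟩
  have q1 := quotient_quasi_periodic (hHm.mul hHp) hk₂ (ε := fun _ => 1) (e := fun _ => 1)
    (c := 2 * π / 3) (by fun_prop) (by simp) hkk (fun u => by rw [kper]; ring)
    (fun u => by
      simp only [Pi.mul_apply]
      rw [show u + 2 * π / 3 - u₀ = u - u₀ + 2 * π / 3 by ring,
        show u + 2 * π / 3 + u₀ = u + u₀ + 2 * π / 3 by ring, thetaH_add_third, thetaH_add_third]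
      ring) hz₂
  have q2 := quotient_quasi_periodic (hHm.mul hHp) hk₂ (ε := fun _ => 1)
    (e := fun u => quasiFactor τ u ^ 6)
    (c := π * τ) (by fun_prop) (fun u => pow_ne_zero _ (quasiFactor_ne_zero _ _)) hkk
    (fun u => by rw [kquasi]; ring)
    (fun u => by
      simp only [Pi.mul_apply]
      have e : (quasiFactor τ (u + -u₀) * quasiFactor τ (u + u₀)) ^ 3 =
        (quasiFactor τ u ^ 2) ^ 3 := by rw [quasiFactor_mul_shift _ _ _ _ (by ring)]
      rw [← sub_eq_add_neg] at e
      rw [show u + π * τ - u₀ = u - u₀ + π * τ by ring,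
        show u + π * τ + u₀ = u + u₀ + π * τ by ring, thetaH_add_tau, thetaH_add_tau]
      linear_combination thetaH τ (u - u₀) * thetaH τ (u + u₀) * e) hz₂
  have hconst := entire_eq_const_of_norm_periodic hk₂ (a := 2 * π / 3) (by positivity) (b := π * τ)
    (by rw [Complex.im_ofReal_mul]; positivity) (fun u => by push_cast; rw [q1, one_mul])
    (fun u => by rw [q2, one_mul])
  have hH00 : thetaH τ (u₀ - u₀) = 0 := (thetaH_eq_zero_iff hτ).2 ⟨0, 0, by simp⟩
  -- Here k'(u₀) = H'(0)H(2u₀)k₂(u₀), and k'(u₀) = 0.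
  have hc : k₂ u₀ = 0 := by
    rw [show k = fun u => thetaH τ (u - u₀) * (thetaH τ (u + u₀) * k₂ u) from
      funext fun u => by rw [hkk, mul_assoc], deriv_fun_mul (by fun_prop) (by fun_prop), hH00,
      zero_mul, add_zero, mul_eq_zero, mul_eq_zero, ← two_mul] at dk0
    exact (dk0.resolve_left (hdm _ hH00)).resolve_left hH0
  have hom : ∀ u, oddWronskian (fun u => phi n τ u * y u) u = 0 := by
    intro u
    rw [hkeq, hkk, hconst u u₀, hc]; ring
  have := hh.eq_zero_of_oddWronskian hom
  obtain ⟨zp, hzp⟩ := exists_phi_ne_zero n hτ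
  exact entire_mul_cancel hyd hphi hzp fun u => by rw [mul_comm]; exact this u

/-- Solutions are unique up to a scalar. -/
theorem IsSolution.cross_eq {n : ℕ} {τ : ℂ} (hτ : 0 < τ.im) {x q : ℂ → ℂ}
    (hx : IsSolution n τ x) (hq : IsSolution n τ q) (u v : ℂ) : x u * q v = q u * x v := by
  by_cases hq0 : ∀ z, q z = 0
  · rw [hq0, hq0]; ring
  push Not at hq0
  have hV := differentiable_thetaV hτ
  have hH := differentiable_thetaH hτ
  have hqd := hq.entire
  obtain ⟨zH, hzH⟩ := exists_thetaH_ne_zero hτ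
  have hH2 : Differentiable ℂ fun u => thetaH τ (2 * u) := by fun_prop
  obtain ⟨u₀, hu₀⟩ := exists_mul_ne_zero hqd (hV.mul hH2) hq0
    (exists_mul_ne_zero hV hH2 (exists_thetaV_ne_zero hτ)
      ⟨zH / 2, by rwa [mul_div_cancel₀ _ (two_ne_zero)]⟩)
  have hqu : q u₀ ≠ 0 := left_ne_zero_of_mul hu₀
  have hVu : thetaV τ u₀ ≠ 0 := left_ne_zero_of_mul (right_ne_zero_of_mul hu₀)
  have hHu : thetaH τ (2 * u₀) ≠ 0 := right_ne_zero_of_mul (right_ne_zero_of_mul hu₀)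
  have hW := hx.wronskian_eq_zero hτ hq
  -- The combination vanishes at u₀ by construction, and at u₀ ± 2π/3 by the vanishing difference
  -- Wronskian.
  have key := (hx.const_mul_sub hq (q u₀) (x u₀)).eq_zero_of_three_zeros hτ (u₀ := u₀)
    (by ring) (by linear_combination hW u₀)
    (by
      have := hW (u₀ - 2 * π / 3)
      rw [sub_add_cancel] at this
      linear_combination -this) hVu hHu
  refine mul_left_cancel₀ hqu ?_
  linear_combination q v * key u - q u * key v

/-! ### The bilinear form and its symmetries -/

theorem deriv_of_add {f : ℂ → ℂ} {c ε : ℂ} (h : ∀ u, f (u + c) = ε * f u) (u : ℂ) :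
    deriv f (u + c) = ε * deriv f u := by
  have e2 := congrFun (congrArg deriv (funext h : (fun u => f (u + c)) = fun u => ε * f u)) u
  rwa [deriv_comp_add_const, deriv_const_mul_field] at e2

theorem deriv_of_neg {f : ℂ → ℂ} {ε : ℂ} (h : ∀ u, f (-u) = ε * f u) (u : ℂ) :
    deriv f (-u) = -ε * deriv f u := by
  have e2 := congrFun (congrArg deriv (funext h : (fun u => f (-u)) = fun u => ε * f u)) u
  rw [deriv_comp_neg, deriv_const_mul_field] at e2
  linear_combination -e2

theorem deriv_of_quasi {f : ℂ → ℂ} (hf : Differentiable ℂ f) {τ c ε : ℂ} {k : ℕ}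
    (h : ∀ u, f (u + c) = ε * quasiFactor τ u ^ k * f u) (u : ℂ) :
    deriv f (u + c) = ε * quasiFactor τ u ^ k * (deriv f u - I * k * f u) := by
  have hm := differentiable_quasiFactor τ
  have e2 := congrFun (congrArg deriv (funext h : (fun u => f (u + c)) =
    fun u => ε * quasiFactor τ u ^ k * f u)) u
  rw [deriv_comp_add_const, deriv_fun_mul (by fun_prop) (by fun_prop), deriv_const_mul_field,
    IsOddSolution.deriv_quasiFactor_pow] at e2
  rw [e2]; ring

theorem deriv_deriv_of_quasi {f : ℂ → ℂ} (hf : Differentiable ℂ f) {τ c ε : ℂ} {k : ℕ}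
    (h : ∀ u, f (u + c) = ε * quasiFactor τ u ^ k * f u) (u : ℂ) :
    deriv (deriv f) (u + c) =
      ε * quasiFactor τ u ^ k * (deriv (deriv f) u - 2 * I * k * deriv f u - k ^ 2 * f u) := by
  have hm := differentiable_quasiFactor τ
  have hf' := differentiable_deriv hf
  have e2 := congrFun (congrArg deriv (funext (deriv_of_quasi hf h) : (fun u => deriv f (u + c)) =
    fun u => ε * quasiFactor τ u ^ k * (deriv f u - I * k * f u))) u
  rw [deriv_comp_add_const, deriv_fun_mul (by fun_prop) (by fun_prop), deriv_const_mul_field,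
    IsOddSolution.deriv_quasiFactor_pow, deriv_fun_sub (by fun_prop) (by fun_prop),
    deriv_const_mul_field] at e2
  rw [e2]; linear_combination ε * quasiFactor τ u ^ k * k ^ 2 * f u * Complex.I_sq

/-- The bilinear second order differential expression which, divided by `θ₁(3u|3τ)`, is a
Schrödinger operator with `2π/3`-periodic potential in the gauge `h / (θ₁(3u|3τ)^n θ₃(3u/2|3τ/2))`. -/
noncomputable def hirotaForm (n : ℕ) (τ : ℂ) (h : ℂ → ℂ) (u : ℂ) : ℂ :=
  thetaV τ u * (thetaT τ u * deriv (deriv h) u - 2 * deriv (thetaT τ) u * deriv h u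
    + deriv (deriv (thetaT τ)) u * h u)
  - 2 * n * deriv (thetaV τ) u * (thetaT τ u * deriv h u - deriv (thetaT τ) u * h u)
  + n ^ 2 * deriv (deriv (thetaV τ)) u * h u * thetaT τ u

section symmetries

theorem thetaT_add_third' (τ u : ℂ) : thetaT τ (u + 2 * π / 3) = 1 * thetaT τ u := by
  rw [thetaT_add_third, one_mul]

theorem thetaV_add_third' (τ u : ℂ) : thetaV τ (u + 2 * π / 3) = 1 * thetaV τ u := by
  rw [thetaV_add_third, one_mul]

theorem hirotaForm_add_third (n : ℕ) (τ : ℂ) (h : ℂ → ℂ) (u : ℂ) :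
    hirotaForm n τ h (u + 2 * π / 3) =
      thetaV τ u * (thetaT τ u * deriv (deriv h) (u + 2 * π / 3)
        - 2 * deriv (thetaT τ) u * deriv h (u + 2 * π / 3)
        + deriv (deriv (thetaT τ)) u * h (u + 2 * π / 3))
      - 2 * n * deriv (thetaV τ) u * (thetaT τ u * deriv h (u + 2 * π / 3)
        - deriv (thetaT τ) u * h (u + 2 * π / 3))
      + n ^ 2 * deriv (deriv (thetaV τ)) u * h (u + 2 * π / 3) * thetaT τ u := by
  rw [hirotaForm, thetaV_add_third, thetaT_add_third, deriv_of_add (thetaV_add_third' τ),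
    deriv_of_add (thetaT_add_third' τ), deriv_of_add (deriv_of_add (thetaV_add_third' τ)),
    deriv_of_add (deriv_of_add (thetaT_add_third' τ))]
  ring

theorem hirotaForm_sub_third (n : ℕ) (τ : ℂ) (h : ℂ → ℂ) (u : ℂ) :
    hirotaForm n τ h (u - 2 * π / 3) =
      thetaV τ u * (thetaT τ u * deriv (deriv h) (u - 2 * π / 3)
        - 2 * deriv (thetaT τ) u * deriv h (u - 2 * π / 3)
        + deriv (deriv (thetaT τ)) u * h (u - 2 * π / 3))
      - 2 * n * deriv (thetaV τ) u * (thetaT τ u * deriv h (u - 2 * π / 3)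
        - deriv (thetaT τ) u * h (u - 2 * π / 3))
      + n ^ 2 * deriv (deriv (thetaV τ)) u * h (u - 2 * π / 3) * thetaT τ u := by
  obtain ⟨w, rfl⟩ : ∃ w, u = w + 2 * π / 3 := ⟨u - 2 * π / 3, by ring⟩
  rw [add_sub_cancel_right, thetaV_add_third, thetaT_add_third, deriv_of_add (thetaV_add_third' τ),
    deriv_of_add (thetaT_add_third' τ), deriv_of_add (deriv_of_add (thetaV_add_third' τ)),
    deriv_of_add (deriv_of_add (thetaT_add_third' τ)), hirotaForm]
  ring

variable {n : ℕ} {τ : ℂ} {h : ℂ → ℂ}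

theorem IsOddSolution.deriv_deriv_sum (hh : IsOddSolution n τ h) (u : ℂ) :
    deriv (deriv h) u + deriv (deriv h) (u + 2 * π / 3) + deriv (deriv h) (u - 2 * π / 3) = 0 := by
  have hd := differentiable_deriv hh.entire
  have e2 := congrFun (congrArg deriv (funext hh.deriv_sum)) u
  rw [deriv_fun_add (by fun_prop) (by fun_prop), deriv_fun_add (by fun_prop) (by fun_prop),
    deriv_comp_add_const, deriv_comp_sub_const] at e2
  simpa using e2

/-- The form is linear in h, with coefficients built from the 2π/3-periodic functions V and T. -/
theorem IsOddSolution.hirotaForm_sum (hh : IsOddSolution n τ h) (u : ℂ) :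
    hirotaForm n τ h u + hirotaForm n τ h (u + 2 * π / 3) + hirotaForm n τ h (u - 2 * π / 3) = 0 := by
  rw [hirotaForm_add_third, hirotaForm_sub_third, hirotaForm]
  linear_combination thetaV τ u * thetaT τ u * hh.deriv_deriv_sum u
    - (2 * thetaV τ u * deriv (thetaT τ) u + 2 * n * deriv (thetaV τ) u * thetaT τ u) *
      hh.deriv_sum u
    + (thetaV τ u * deriv (deriv (thetaT τ)) u + 2 * n * deriv (thetaV τ) u * deriv (thetaT τ) u
      + n ^ 2 * deriv (deriv (thetaV τ)) u * thetaT τ u) * hh.sum_eq_zero u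

theorem IsOddSolution.hirotaForm_neg (hh : IsOddSolution n τ h) (u : ℂ) :
    hirotaForm n τ h (-u) = hirotaForm n τ h u := by
  have hT : ∀ u, thetaT τ (-u) = 1 * thetaT τ u := fun u => by rw [thetaT_neg, one_mul]
  have hV : ∀ u, thetaV τ (-u) = -1 * thetaV τ u := fun u => by rw [thetaV_neg, neg_one_mul]
  have hh' : ∀ u, h (-u) = -1 * h u := fun u => by rw [hh.odd, neg_one_mul]
  rw [hirotaForm, hirotaForm, hT, hV, hh', deriv_of_neg hT, deriv_of_neg (deriv_of_neg hT),
    deriv_of_neg hV, deriv_of_neg (deriv_of_neg hV), deriv_of_neg hh',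
    deriv_of_neg (deriv_of_neg hh')]
  ring

/-- In the gauge ψ = h/(VⁿT) the multiplier is constant, and (log T)'' and (log V)'' are invariant
under πτ. The multiplier of the form is therefore that of VTh, of exponent 6 + 3 + (6n + 3). -/
theorem IsOddSolution.hirotaForm_quasi_periodic (hτ : 0 < τ.im) (hh : IsOddSolution n τ h) (u : ℂ) :
    hirotaForm n τ h (u + π * τ) = quasiFactor τ u ^ (6 * n + 12) * hirotaForm n τ h u := by
  have hT : ∀ u, thetaT τ (u + π * τ) = 1 * quasiFactor τ u ^ 3 * thetaT τ u := fun u => by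
    rw [thetaT_add_tau, one_mul]
  have hV : ∀ u, thetaV τ (u + π * τ) = -1 * quasiFactor τ u ^ 6 * thetaV τ u := fun u => by
    rw [thetaV_add_tau, neg_one_mul]
  have hh' : ∀ u, h (u + π * τ) = -1 * quasiFactor τ u ^ (6 * n + 3) * h u := fun u => by
    rw [hh.quasi_periodic, neg_one_mul]
  have dT := differentiable_thetaT hτ
  have dV := differentiable_thetaV hτ
  rw [hirotaForm, hirotaForm, hT, hV, hh', deriv_of_quasi dT hT, deriv_deriv_of_quasi dT hT,
    deriv_of_quasi dV hV, deriv_deriv_of_quasi dV hV, deriv_of_quasi hh.entire hh',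
    deriv_deriv_of_quasi hh.entire hh']
  push_cast
  rw [show quasiFactor τ u ^ (6 * n + 12) = quasiFactor τ u ^ (6 * n + 3) * quasiFactor τ u ^ 6 *
    quasiFactor τ u ^ 3 by ring]
  generalize quasiFactor τ u ^ (6 * n + 3) = m₁
  generalize quasiFactor τ u ^ 6 = m₂
  generalize quasiFactor τ u ^ 3 = m₃
  generalize thetaV τ u = V
  generalize thetaT τ u = T
  generalize deriv (thetaV τ) u = V'
  generalize deriv (thetaT τ) u = T'
  ring_nf
  simp only [Complex.I_sq]
  ring

end symmetries

/-! ### Division of the bilinear form by φ -/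

section reduction

/-- Quotient of `hirotaForm n τ (φ q)` by `φ`, where `θ₁(3u|3τ) = θ₁(u|τ) ξ(u)`. -/
noncomputable def reducedForm (n : ℕ) (τ : ℂ) (ξ q : ℂ → ℂ) (u : ℂ) : ℂ :=
  ξ u * thetaT τ u * ((2 * n + 1) * deriv (deriv fun u => theta1 u τ) u * q u
      + 2 * (2 * n + 1) * deriv (fun u => theta1 u τ) u * deriv q u
      + theta1 u τ * deriv (deriv q) u)
    - 2 * ξ u * deriv (thetaT τ) u * ((2 * n + 1) * deriv (fun u => theta1 u τ) u * q u
      + theta1 u τ * deriv q u)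
    + ξ u * theta1 u τ * deriv (deriv (thetaT τ)) u * q u
    - 2 * n * deriv (fun u => theta1 u τ) u * ξ u
      * (thetaT τ u * deriv q u - deriv (thetaT τ) u * q u)
    - 2 * n * deriv ξ u * (thetaT τ u * ((2 * n + 1) * deriv (fun u => theta1 u τ) u * q u
      + theta1 u τ * deriv q u) - deriv (thetaT τ) u * theta1 u τ * q u)
    + n ^ 2 * deriv (deriv (thetaV τ)) u * q u * thetaT τ u

variable {n : ℕ} {τ : ℂ} {q ξ : ℂ → ℂ}

theorem deriv_phi_mul (n : ℕ) (hτ : 0 < τ.im) (hq : Differentiable ℂ q) (u : ℂ) :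
    deriv (fun u => phi n τ u * q u) u = theta1 u τ ^ (2 * n) *
      ((2 * n + 1) * deriv (fun u => theta1 u τ) u * q u + theta1 u τ * deriv q u) := by
  have hθ := differentiable_theta1 hτ
  unfold phi
  rw [deriv_fun_mul (by fun_prop) (by fun_prop), deriv_fun_pow (by fun_prop)]
  push_cast
  ring

/-- The extra factor θ₁ on the left avoids the exponent 2n - 1, which is truncated for n = 0. -/
theorem theta1_mul_deriv_deriv_phi_mul (n : ℕ) (hτ : 0 < τ.im) (hq : Differentiable ℂ q) (u : ℂ) :
    theta1 u τ * deriv (deriv fun u => phi n τ u * q u) u = theta1 u τ ^ (2 * n) *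
      (2 * n * (2 * n + 1) * deriv (fun u => theta1 u τ) u ^ 2 * q u
        + (2 * n + 1) * theta1 u τ * deriv (deriv fun u => theta1 u τ) u * q u
        + 2 * (2 * n + 1) * theta1 u τ * deriv (fun u => theta1 u τ) u * deriv q u
        + theta1 u τ ^ 2 * deriv (deriv q) u) := by
  have hθ := differentiable_theta1 hτ
  have hθ' := differentiable_deriv hθ
  have hq' := differentiable_deriv hq
  rw [show (deriv fun u => phi n τ u * q u) = fun u => theta1 u τ ^ (2 * n) *
      ((2 * n + 1) * deriv (fun u => theta1 u τ) u * q u + theta1 u τ * deriv q u) from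
    funext (deriv_phi_mul n hτ hq), deriv_fun_mul (by fun_prop) (by fun_prop),
    deriv_fun_pow (by fun_prop), deriv_fun_add (by fun_prop) (by fun_prop),
    deriv_fun_mul (by fun_prop) hq.differentiableAt, deriv_const_mul_field,
    deriv_fun_mul (by fun_prop) (by fun_prop)]
  rcases n with _ | n
  · simp; ring
  · rw [show 2 * (n + 1) - 1 = 2 * n + 1 by omega]
    push_cast
    ring

/-- The terms with θ₁'² carry one power of θ₁ too few, but those from Vh'' and from -2nV'Th' cancel:
both have coefficient 2n(2n+1). -/
theorem hirotaForm_phi_mul (hτ : 0 < τ.im) (hξ : Differentiable ℂ ξ)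
    (hV : ∀ u, thetaV τ u = theta1 u τ * ξ u) (hq : Differentiable ℂ q) (u : ℂ) :
    hirotaForm n τ (fun u => phi n τ u * q u) u = phi n τ u * reducedForm n τ ξ q u := by
  have hθ := differentiable_theta1 hτ
  have hV' : deriv (thetaV τ) u = deriv (fun u => theta1 u τ) u * ξ u + theta1 u τ * deriv ξ u := by
    rw [show thetaV τ = fun u => theta1 u τ * ξ u from funext hV,
      deriv_fun_mul (by fun_prop) (by fun_prop)]
  have h1 := deriv_phi_mul n hτ hq u
  have h2 := theta1_mul_deriv_deriv_phi_mul n hτ hq u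
  rw [hirotaForm, reducedForm, h1, hV, hV', phi, pow_succ]
  linear_combination ξ u * thetaT τ u * h2

theorem differentiable_reducedForm (n : ℕ) (hτ : 0 < τ.im) (hξ : Differentiable ℂ ξ)
    (hq : Differentiable ℂ q) : Differentiable ℂ (reducedForm n τ ξ q) := by
  have hθ := differentiable_theta1 hτ
  have hθ' := differentiable_deriv hθ
  have hθ'' := differentiable_deriv hθ'
  have hq' := differentiable_deriv hq
  have hq'' := differentiable_deriv hq'
  have hT := differentiable_thetaT hτ
  have hT' := differentiable_deriv hT
  have hT'' := differentiable_deriv hT'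
  have hξ' := differentiable_deriv hξ
  have hV'' := differentiable_deriv (differentiable_deriv (differentiable_thetaV hτ))
  unfold reducedForm
  fun_prop

end reduction

/-! ### Vanishing at the zeros of V and at the half period -/

section values

variable {n : ℕ} {τ : ℂ}

theorem eq_zero_of_odd_of_periodic {f : ℂ → ℂ} (ho : ∀ u, f (-u) = -f u)
    (hp : ∀ u, f (u + 2 * π / 3) = f u) : f 0 = 0 ∧ f (π / 3) = 0 ∧ f (2 * π / 3) = 0 := by
  have h0 : f 0 = 0 := by
    have := ho 0
    rw [neg_zero] at this
    linear_combination this / 2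
  refine ⟨h0, ?_, ?_⟩
  · have h1 := hp (-(π / 3))
    rw [ho, show -((π : ℂ) / 3) + 2 * π / 3 = π / 3 by ring] at h1
    linear_combination h1 / 2
  · have := hp 0
    rwa [zero_add, h0] at this

theorem deriv_thetaT_neg (τ u : ℂ) : deriv (thetaT τ) (-u) = -deriv (thetaT τ) u := by
  rw [deriv_of_neg (fun u => (thetaT_neg τ u).trans (one_mul _).symm)]; ring

theorem deriv_thetaT_add_third (τ u : ℂ) :
    deriv (thetaT τ) (u + 2 * π / 3) = deriv (thetaT τ) u := by
  rw [deriv_of_add (thetaT_add_third' τ), one_mul]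

theorem deriv_deriv_thetaV_neg (τ u : ℂ) :
    deriv (deriv (thetaV τ)) (-u) = -deriv (deriv (thetaV τ)) u := by
  rw [deriv_of_neg (deriv_of_neg (fun u => (thetaV_neg τ u).trans (neg_one_mul _).symm))]; ring

theorem deriv_deriv_thetaV_add_third (τ u : ℂ) :
    deriv (deriv (thetaV τ)) (u + 2 * π / 3) = deriv (deriv (thetaV τ)) u := by
  rw [deriv_of_add (deriv_of_add (thetaV_add_third' τ)), one_mul]

theorem thetaV_ne_zero_of_thetaT_eq_zero {u : ℂ} (hτ : 0 < τ.im) (h : thetaT τ u = 0) :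
    thetaV τ u ≠ 0 := by
  intro h'
  obtain ⟨m, k, e⟩ := (thetaT_eq_zero_iff hτ).1 h
  obtain ⟨m', k', e'⟩ := (thetaV_eq_zero_iff hτ).1 h'
  have e2 : (π : ℂ) * τ * (1 + 2 * k - 2 * k') = ((2 * (m' * (π / 3) - π / 3 - m * (2 * π / 3)) : ℝ) : ℂ) := by
    push_cast
    linear_combination 2 * e' - 2 * e
  have e3 := congrArg Complex.im e2
  rw [show (π : ℂ) * τ * (1 + 2 * k - 2 * k') = ((π * (1 + 2 * k - 2 * k') : ℝ) : ℂ) * τ by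
    push_cast; ring, Complex.im_ofReal_mul, Complex.ofReal_im] at e3
  have e4 : (1 + 2 * k - 2 * k' : ℝ) = 0 := by
    simpa [Real.pi_ne_zero, hτ.ne'] using e3
  have e5 : 1 + 2 * k - 2 * k' = 0 := by exact_mod_cast e4
  omega

theorem theta1_ne_zero_of_thetaV_ne_zero {u : ℂ} (hτ : 0 < τ.im) (h : thetaV τ u ≠ 0) :
    theta1 u τ ≠ 0 := by
  obtain ⟨c, -, hc⟩ := exists_thetaV_eq hτ
  intro h'
  exact h (by rw [hc, h', zero_mul])

/-- For n ≥ 1, φ vanishes at 0 and π to order at least three, so h' is zero there. As h' is even,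
the differentiated TQ-relation gives h' = 0 at 2π/3 and π/3. The factor n covers n = 0, where this
can fail but is not needed. -/
theorem IsSolution.nat_mul_deriv_eq_zero (hτ : 0 < τ.im) {q : ℂ → ℂ} (hq : IsSolution n τ q) :
    n * deriv (fun u => phi n τ u * q u) (π / 3) = 0 ∧
      n * deriv (fun u => phi n τ u * q u) (2 * π / 3) = 0 := by
  have hh := hq.isOddSolution hτ
  rcases Nat.eq_zero_or_pos n with rfl | hn
  · simp
  have hz : ∀ u, theta1 u τ = 0 → deriv (fun u => phi n τ u * q u) u = 0 := fun u hu => by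
    rw [deriv_phi_mul n hτ hq.entire, hu, zero_pow (by omega), zero_mul]
  have h0 := hz 0 ((theta1_eq_zero_iff hτ).2 ⟨0, 0, by simp⟩)
  have hp := hz π ((theta1_eq_zero_iff hτ).2 ⟨1, 0, by simp⟩)
  have s0 := hh.deriv_sum 0
  have sp := hh.deriv_sum π
  rw [show (0 : ℂ) - 2 * π / 3 = -(2 * π / 3) by ring, hh.deriv_even, zero_add, h0] at s0
  rw [show (π : ℂ) + 2 * π / 3 = -(π / 3) + 2 * π by ring, hh.deriv_periodic, hh.deriv_even, hp,
    show (π : ℂ) - 2 * π / 3 = π / 3 by ring] at sp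
  exact ⟨by linear_combination (n : ℂ) / 2 * sp, by linear_combination (n : ℂ) / 2 * s0⟩

theorem hirotaForm_eq_zero {h : ℂ → ℂ} {u : ℂ} (hV : thetaV τ u = 0)
    (hV'' : deriv (deriv (thetaV τ)) u = 0) (hT' : deriv (thetaT τ) u = 0)
    (hh : n * deriv h u = 0) : hirotaForm n τ h u = 0 := by
  rw [hirotaForm, hV, hV'', hT']
  linear_combination -2 * deriv (thetaV τ) u * thetaT τ u * hh

theorem IsSolution.hirotaForm_eq_zero (hτ : 0 < τ.im) {q : ℂ → ℂ} (hq : IsSolution n τ q) :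
    hirotaForm n τ (fun u => phi n τ u * q u) (π / 3) = 0 ∧
      hirotaForm n τ (fun u => phi n τ u * q u) (2 * π / 3) = 0 := by
  obtain ⟨-, a1, a2⟩ := eq_zero_of_odd_of_periodic (deriv_thetaT_neg τ) (deriv_thetaT_add_third τ)
  obtain ⟨-, b1, b2⟩ := eq_zero_of_odd_of_periodic (deriv_deriv_thetaV_neg τ)
    (deriv_deriv_thetaV_add_third τ)
  obtain ⟨-, c1, c2⟩ := eq_zero_of_odd_of_periodic (thetaV_neg τ) (thetaV_add_third τ)
  obtain ⟨d1, d2⟩ := hq.nat_mul_deriv_eq_zero hτ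
  exact ⟨XYZChain.hirotaForm_eq_zero c1 b1 a1 d1, XYZChain.hirotaForm_eq_zero c2 b2 a2 d2⟩

/-- Reflection and the translations by πτ and 2π fix this point modulo periods, with multiplier -1
because 2n + 1 is odd. -/
theorem IsSolution.eq_zero_half_period {q : ℂ → ℂ} (hq : IsSolution n τ q) :
    q (π + π * τ / 2) = 0 := by
  have h1 := hq.quasi_periodic (-(π + π * τ / 2))
  have hm : quasiFactor τ (-(π + π * τ / 2)) = -1 := by
    rw [quasiFactor, ← Complex.exp_pi_mul_I]; congr 1; ring
  rw [hm, Odd.neg_one_pow ⟨n, rfl⟩, hq.even, ← hq.periodic,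
    show -(π + π * τ / 2) + π * τ + 2 * π = (π : ℂ) + π * τ / 2 by ring] at h1
  linear_combination h1 / 2

end values

/-! ### The corrected form and the new solution -/

section quotient

variable {n : ℕ} {τ : ℂ} {q ξ : ℂ → ℂ}

/-- The combination of `hirotaForm` and `q (· + π)` that vanishes at all zeros of `θ₃(3u/2|3τ/2)`. -/
noncomputable def balancedForm (n : ℕ) (τ : ℂ) (q : ℂ → ℂ) (u : ℂ) : ℂ :=
  q (π * τ / 2) * hirotaForm n τ (fun u => phi n τ u * q u) u
    + 3 * I * (thetaT τ 0 * thetaTs τ 0) * deriv q (π + π * τ / 2) *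
      (thetaV τ u * phi n τ u * thetaTs τ u * q (u + π))

/-- Quotient of `balancedForm n τ q` by `φ`, where `θ₁(3u|3τ) = θ₁(u|τ) ξ(u)`. -/
noncomputable def reducedBalancedForm (n : ℕ) (τ : ℂ) (ξ q : ℂ → ℂ) (u : ℂ) : ℂ :=
  q (π * τ / 2) * reducedForm n τ ξ q u
    + 3 * I * (thetaT τ 0 * thetaTs τ 0) * deriv q (π + π * τ / 2) *
      (thetaV τ u * thetaTs τ u * q (u + π))

theorem balancedForm_eq (hτ : 0 < τ.im) (hξ : Differentiable ℂ ξ)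
    (hV : ∀ u, thetaV τ u = theta1 u τ * ξ u) (hq : Differentiable ℂ q) (u : ℂ) :
    balancedForm n τ q u = phi n τ u * reducedBalancedForm n τ ξ q u := by
  rw [balancedForm, reducedBalancedForm, hirotaForm_phi_mul hτ hξ hV hq]
  ring

theorem add_two_pi_of_add_third {f : ℂ → ℂ} (h : ∀ u, f (u + 2 * π / 3) = f u) (u : ℂ) :
    f (u + 2 * π) = f u := by
  rw [show u + 2 * π = u + 2 * π / 3 + 2 * π / 3 + 2 * π / 3 by ring, h, h, h]

theorem IsOddSolution.hirotaForm_periodic {h : ℂ → ℂ} (hh : IsOddSolution n τ h) (u : ℂ) :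
    hirotaForm n τ h (u + 2 * π) = hirotaForm n τ h u := by
  have hT : ∀ u, thetaT τ (u + 2 * π) = 1 * thetaT τ u := fun u => by
    rw [add_two_pi_of_add_third (thetaT_add_third τ), one_mul]
  have hV : ∀ u, thetaV τ (u + 2 * π) = 1 * thetaV τ u := fun u => by
    rw [add_two_pi_of_add_third (thetaV_add_third τ), one_mul]
  have hh' : ∀ u, h (u + 2 * π) = 1 * h u := fun u => by rw [hh.periodic, one_mul]
  rw [hirotaForm, hirotaForm, hT, hV, hh', deriv_of_add hT, deriv_of_add (deriv_of_add hT),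
    deriv_of_add hV, deriv_of_add (deriv_of_add hV), deriv_of_add hh',
    deriv_of_add (deriv_of_add hh')]
  ring

namespace IsSolution

/-- The correction satisfies the relation because it is the TQ-relation at u + π, up to the sign of
φ, times the 2π/3-periodic function VT*. -/
theorem balancedForm_sum (hτ : 0 < τ.im) (hq : IsSolution n τ q) (u : ℂ) :
    balancedForm n τ q u + balancedForm n τ q (u + 2 * π / 3)
      + balancedForm n τ q (u - 2 * π / 3) = 0 := by
  have h1 := (hq.isOddSolution hτ).hirotaForm_sum u
  have h2 := hq.tq (u + π)
  have e1 := thetaV_add_third τ (u - 2 * π / 3)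
  have e2 := thetaTs_add_third τ (u - 2 * π / 3)
  rw [sub_add_cancel] at e1 e2
  rw [show u + π + 2 * π / 3 = u + 2 * π / 3 + π by ring,
    show u + π - 2 * π / 3 = u - 2 * π / 3 + π by ring, phi_add_pi, phi_add_pi, phi_add_pi] at h2
  rw [balancedForm, balancedForm, balancedForm, thetaV_add_third, thetaTs_add_third, ← e1, ← e2]
  linear_combination q (π * τ / 2) * h1 -
    3 * I * (thetaT τ 0 * thetaTs τ 0) * deriv q (π + π * τ / 2) *
      thetaV τ u * thetaTs τ u * h2

theorem balancedForm_neg (hτ : 0 < τ.im) (hq : IsSolution n τ q) (u : ℂ) :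
    balancedForm n τ q (-u) = balancedForm n τ q u := by
  rw [balancedForm, balancedForm, (hq.isOddSolution hτ).hirotaForm_neg, thetaV_neg, thetaTs_neg,
    phi_neg, show -u + π = -(u + π) + 2 * π by ring, hq.periodic, hq.even]
  ring

theorem balancedForm_periodic (hτ : 0 < τ.im) (hq : IsSolution n τ q) (u : ℂ) :
    balancedForm n τ q (u + 2 * π) = balancedForm n τ q u := by
  rw [balancedForm, balancedForm, (hq.isOddSolution hτ).hirotaForm_periodic,
    add_two_pi_of_add_third (thetaV_add_third τ), add_two_pi_of_add_third (thetaTs_add_third τ),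
    phi_add_two_pi, show u + 2 * π + π = u + π + 2 * π by ring, hq.periodic]

theorem balancedForm_quasi_periodic (hτ : 0 < τ.im) (hq : IsSolution n τ q) (u : ℂ) :
    balancedForm n τ q (u + π * τ) = quasiFactor τ u ^ (6 * n + 12) * balancedForm n τ q u := by
  rw [balancedForm, balancedForm, (hq.isOddSolution hτ).hirotaForm_quasi_periodic hτ, thetaV_add_tau,
    thetaTs_add_tau, phi_add_tau, show u + π * τ + π = u + π + π * τ by ring, hq.quasi_periodic,
    quasiFactor_add_pi, Odd.neg_pow ⟨n, rfl⟩]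
  ring

/-- With T = q = 0 at this point, the form reduces to -2VT'φq'. The derivative formula for T'
matches it with the correction, where T*(π + πτ/2) = T(πτ/2). This fixes the coefficient
3iT(0)T*(0). -/
theorem balancedForm_half_period (hτ : 0 < τ.im) (hq : IsSolution n τ q) :
    balancedForm n τ q (π + π * τ / 2) = 0 := by
  have hθ := differentiable_phi n hτ
  have hT : thetaT τ (π + π * τ / 2) = 0 :=
    (thetaT_eq_zero_iff hτ).2 ⟨1, 0, by push_cast; ring⟩
  have hT' := two_mul_deriv_thetaT hτ
  rw [balancedForm, hirotaForm, deriv_fun_mul hθ.differentiableAt hq.entire.differentiableAt, hT,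
    hq.eq_zero_half_period, show (π : ℂ) + π * τ / 2 + π = π * τ / 2 + 2 * π by ring, hq.periodic,
    add_comm (π : ℂ) (π * τ / 2), thetaTs_add_pi]
  rw [add_comm (π : ℂ) (π * τ / 2)] at hT'
  linear_combination -thetaV τ (π * τ / 2 + π) * q (π * τ / 2) * phi n τ (π * τ / 2 + π) *
    deriv q (π * τ / 2 + π) * hT'

/-- The three-term relation makes the two values opposite, while reflection followed by translation,
with multiplier 1, makes them equal. -/
theorem balancedForm_half_period_add_third (hτ : 0 < τ.im) (hq : IsSolution n τ q) :
    balancedForm n τ q (π + π * τ / 2 + 2 * π / 3) = 0 ∧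
      balancedForm n τ q (π + π * τ / 2 - 2 * π / 3) = 0 := by
  have h0 := hq.balancedForm_sum hτ (π + π * τ / 2)
  rw [hq.balancedForm_half_period hτ] at h0
  have h1 := hq.balancedForm_quasi_periodic hτ (-(π + π * τ / 2 - 2 * π / 3))
  have hm : quasiFactor τ (-(π + π * τ / 2 - 2 * π / 3)) ^ (6 * n + 12) = 1 := by
    rw [quasiFactor_pow, Complex.exp_eq_one_iff]
    exact ⟨n + 2, by push_cast; ring⟩
  rw [hm, hq.balancedForm_neg hτ, ← hq.balancedForm_periodic hτ,
    show -((π : ℂ) + π * τ / 2 - 2 * π / 3) + π * τ + 2 * π = π + π * τ / 2 + 2 * π / 3 by ring,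
    one_mul] at h1
  exact ⟨by linear_combination (h0 + h1) / 2, by linear_combination (h0 - h1) / 2⟩

theorem differentiable_reducedBalancedForm (hτ : 0 < τ.im) (hq : IsSolution n τ q)
    (hξ : Differentiable ℂ ξ) :
    Differentiable ℂ (reducedBalancedForm n τ ξ q) := by
  have h1 := differentiable_reducedForm n hτ hξ hq.entire
  have h2 := differentiable_thetaV hτ
  have h3 := differentiable_thetaTs hτ
  have h4 := hq.entire
  unfold reducedBalancedForm
  fun_prop

theorem reducedBalancedForm_neg (hτ : 0 < τ.im) (hq : IsSolution n τ q)
    (hξ : Differentiable ℂ ξ) (hV : ∀ u, thetaV τ u = theta1 u τ * ξ u) (u : ℂ) :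
    reducedBalancedForm n τ ξ q (-u) = -reducedBalancedForm n τ ξ q u := by
  have hd := hq.differentiable_reducedBalancedForm hτ hξ
  have hφ := differentiable_phi n hτ
  obtain ⟨z, hz⟩ := exists_phi_ne_zero n hτ
  refine entire_mul_cancel' (f₁ := fun u => reducedBalancedForm n τ ξ q (-u))
    (f₂ := fun u => -reducedBalancedForm n τ ξ q u) (by fun_prop) (by fun_prop) hφ hz (fun u => ?_) u
  have := hq.balancedForm_neg hτ u
  rw [balancedForm_eq hτ hξ hV hq.entire, balancedForm_eq hτ hξ hV hq.entire, phi_neg] at this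
  linear_combination -this

theorem reducedBalancedForm_periodic (hτ : 0 < τ.im) (hq : IsSolution n τ q)
    (hξ : Differentiable ℂ ξ) (hV : ∀ u, thetaV τ u = theta1 u τ * ξ u) (u : ℂ) :
    reducedBalancedForm n τ ξ q (u + 2 * π) = reducedBalancedForm n τ ξ q u := by
  have hd := hq.differentiable_reducedBalancedForm hτ hξ
  have hφ := differentiable_phi n hτ
  obtain ⟨z, hz⟩ := exists_phi_ne_zero n hτ
  refine entire_mul_cancel' (f₁ := fun u => reducedBalancedForm n τ ξ q (u + 2 * π))
    (f₂ := reducedBalancedForm n τ ξ q) (by fun_prop) hd hφ hz (fun u => ?_) u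
  have := hq.balancedForm_periodic hτ u
  rwa [balancedForm_eq hτ hξ hV hq.entire, balancedForm_eq hτ hξ hV hq.entire, phi_add_two_pi] at this

theorem reducedBalancedForm_quasi_periodic (hτ : 0 < τ.im) (hq : IsSolution n τ q)
    (hξ : Differentiable ℂ ξ) (hV : ∀ u, thetaV τ u = theta1 u τ * ξ u) (u : ℂ) :
    reducedBalancedForm n τ ξ q (u + π * τ) =
      -quasiFactor τ u ^ (2 * n + 10) * reducedBalancedForm n τ ξ q u := by
  have hd := hq.differentiable_reducedBalancedForm hτ hξ
  have hφ := differentiable_phi n hτ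
  have hm := differentiable_quasiFactor τ
  obtain ⟨z, hz⟩ := exists_phi_ne_zero n hτ
  refine quotient_quasi_periodic (f := balancedForm n τ q)
    (ε := fun u => -quasiFactor τ u ^ (2 * n + 10))
    (e := fun u => -quasiFactor τ u ^ (4 * n + 2)) hφ hd (by fun_prop)
    (fun u => neg_ne_zero.2 (pow_ne_zero _ (quasiFactor_ne_zero _ _)))
    (fun u => balancedForm_eq hτ hξ hV hq.entire u) (fun u => ?_) (phi_add_tau n τ) hz u
  rw [hq.balancedForm_quasi_periodic hτ]
  ring

/-- At 0 and π this is oddness with period 2π. At π/3 and 2π/3 the bilinear form vanishes while φ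
does not. Reflection and translation give the remaining residues modulo 6. -/
theorem reducedBalancedForm_eq_zero_of_thetaV (hτ : 0 < τ.im) (hq : IsSolution n τ q)
    (hξ : Differentiable ℂ ξ) (hV : ∀ u, thetaV τ u = theta1 u τ * ξ u) {u : ℂ}
    (hu : thetaV τ u = 0) :
    reducedBalancedForm n τ ξ q u = 0 := by
  have hneg := hq.reducedBalancedForm_neg hτ hξ hV
  have hper := hq.reducedBalancedForm_periodic hτ hξ hV
  have h0 : theta1 0 τ = 0 := (theta1_eq_zero_iff hτ).2 ⟨0, 0, by simp⟩
  have z0 : reducedBalancedForm n τ ξ q 0 = 0 := by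
    have := hneg 0
    rw [neg_zero] at this
    linear_combination this / 2
  have z3 : reducedBalancedForm n τ ξ q π = 0 := by
    have := hper (-π)
    rw [hneg, show -(π : ℂ) + 2 * π = π by ring] at this
    linear_combination this / 2
  have hpos : ∀ z, theta1 z τ ≠ 0 → thetaV τ z = 0 →
      hirotaForm n τ (fun u => phi n τ u * q u) z = 0 → reducedBalancedForm n τ ξ q z = 0 := by
    intro z hz hVz hh
    have := balancedForm_eq (n := n) hτ hξ hV hq.entire z
    rw [balancedForm, hh, hVz, mul_zero, zero_mul, zero_mul, zero_mul, mul_zero, add_zero] at this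
    exact (mul_eq_zero.1 this.symm).resolve_left fun h => hz (phi_eq_zero_iff.1 h)
  obtain ⟨e1, e2⟩ := hq.hirotaForm_eq_zero hτ
  have z1 : reducedBalancedForm n τ ξ q (π / 3) = 0 :=
    hpos _ (by have := theta1_third_ne_zero hτ h0 (k := 1) (by decide)
               rwa [Int.cast_one, one_mul, zero_add] at this)
      ((thetaV_eq_zero_iff hτ).2 ⟨1, 0, by push_cast; ring⟩) e1
  have z2 : reducedBalancedForm n τ ξ q (2 * π / 3) = 0 :=
    hpos _ (by have := theta1_add_third_ne_zero hτ h0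
               rwa [zero_add] at this)
      ((thetaV_eq_zero_iff hτ).2 ⟨2, 0, by push_cast; ring⟩) e2
  have z4 : reducedBalancedForm n τ ξ q (-(2 * π / 3) + 2 * π) = 0 := by
    rw [hper, hneg, z2, neg_zero]
  have z5 : reducedBalancedForm n τ ξ q (-(π / 3) + 2 * π) = 0 := by
    rw [hper, hneg, z1, neg_zero]
  have ind : ∀ z₀, reducedBalancedForm n τ ξ q z₀ = 0 → ∀ j k : ℤ,
      reducedBalancedForm n τ ξ q (z₀ + j * (2 * π) + k * (π * τ)) = 0 := fun z₀ hz =>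
    exists_int_shift_induction (P := fun z => reducedBalancedForm n τ ξ q z = 0) hz
      (fun z => by rw [hper]) (fun z => by
        rw [hq.reducedBalancedForm_quasi_periodic hτ hξ hV, mul_eq_zero, or_iff_right]
        exact neg_ne_zero.2 (pow_ne_zero _ (quasiFactor_ne_zero _ _)))
  obtain ⟨m, k, rfl⟩ := (thetaV_eq_zero_iff hτ).1 hu
  obtain ⟨j, r, hm, hr0, hr6⟩ : ∃ j r : ℤ, m = 6 * j + r ∧ 0 ≤ r ∧ r < 6 :=
    ⟨m / 6, m % 6, by omega, by omega, by omega⟩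
  rw [show (m : ℂ) * (π / 3) + k * (π * τ) = (r : ℂ) * (π / 3) + j * (2 * π) + k * (π * τ) by
    rw [hm]; push_cast; ring]
  refine ind _ ?_ j k
  interval_cases r
  · simpa using z0
  · simpa using z1
  · rw [← z2]; congr 1; push_cast; ring
  · rw [← z3]; congr 1; push_cast; ring
  · rw [← z4]; congr 1; push_cast; ring
  · rw [← z5]; congr 1; push_cast; ring

theorem reducedBalancedForm_eq_zero_of_thetaT (hτ : 0 < τ.im) (hq : IsSolution n τ q)
    (hξ : Differentiable ℂ ξ) (hV : ∀ u, thetaV τ u = theta1 u τ * ξ u) {u : ℂ}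
    (hu : thetaT τ u = 0) :
    reducedBalancedForm n τ ξ q u = 0 := by
  have hper := hq.balancedForm_periodic hτ
  obtain ⟨e1, e2⟩ := hq.balancedForm_half_period_add_third hτ
  have ind : ∀ z₀, balancedForm n τ q z₀ = 0 → ∀ j k : ℤ,
      balancedForm n τ q (z₀ + j * (2 * π) + k * (π * τ)) = 0 := fun z₀ hz =>
    exists_int_shift_induction (P := fun z => balancedForm n τ q z = 0) hz
      (fun z => by rw [hper]) (fun z => by
        rw [hq.balancedForm_quasi_periodic hτ, mul_eq_zero, or_iff_right]
        exact pow_ne_zero _ (quasiFactor_ne_zero _ _))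
  have key : balancedForm n τ q u = 0 := by
    obtain ⟨m, k, rfl⟩ := (thetaT_eq_zero_iff hτ).1 hu
    obtain ⟨j, r, hm, hr0, hr3⟩ : ∃ j r : ℤ, m = 3 * j + r ∧ 0 ≤ r ∧ r < 3 :=
      ⟨m / 3, m % 3, by omega, by omega, by omega⟩
    rw [show (π : ℂ) / 3 + π * τ / 2 + m * (2 * π / 3) + k * (π * τ) =
      π / 3 + π * τ / 2 + r * (2 * π / 3) + j * (2 * π) + k * (π * τ) by
      rw [hm]; push_cast; ring]
    refine ind _ ?_ j k
    interval_cases r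
    · rw [← e2]; congr 1; push_cast; ring
    · rw [← hq.balancedForm_half_period hτ]; congr 1; push_cast; ring
    · rw [← e1]; congr 1; push_cast; ring
  rw [balancedForm_eq hτ hξ hV hq.entire] at key
  exact (mul_eq_zero.1 key).resolve_left fun h => theta1_ne_zero_of_thetaV_ne_zero hτ
    (thetaV_ne_zero_of_thetaT_eq_zero hτ hu) (phi_eq_zero_iff.1 h)

/-- V and T have simple zeros and no common ones, so both can be divided out. The symmetries of x
follow from those of `balancedForm` by cancelling φVT. -/
theorem exists_reducedBalancedForm_eq (hτ : 0 < τ.im) (hq : IsSolution n τ q)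
    (hξ : Differentiable ℂ ξ) (hV : ∀ u, thetaV τ u = theta1 u τ * ξ u) :
    ∃ x : ℂ → ℂ, IsSolution n τ x ∧
    ∀ u, reducedBalancedForm n τ ξ q u = thetaV τ u * (thetaT τ u * x u) := by
  have hd := hq.differentiable_reducedBalancedForm hτ hξ
  have dV := differentiable_thetaV hτ
  have dT := differentiable_thetaT hτ
  have dφ := differentiable_phi n hτ
  have hm := differentiable_quasiFactor τ
  obtain ⟨y, hy, hVy⟩ := exists_entire_quotient hd dV fun z hz =>
    ⟨hq.reducedBalancedForm_eq_zero_of_thetaV hτ hξ hV hz, deriv_thetaV_ne_zero hτ hz⟩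
  obtain ⟨x, hx, hTx⟩ := exists_entire_quotient hy dT fun z hz =>
    ⟨by
      have := hVy z
      rw [hq.reducedBalancedForm_eq_zero_of_thetaT hτ hξ hV hz] at this
      exact (mul_eq_zero.1 this.symm).resolve_left (thetaV_ne_zero_of_thetaT_eq_zero hτ hz),
      deriv_thetaT_ne_zero hτ hz⟩
  have hfac : ∀ u, reducedBalancedForm n τ ξ q u = thetaV τ u * (thetaT τ u * x u) := fun u => by
    rw [hVy, hTx]
  have hN : ∀ u, balancedForm n τ q u = (phi n τ u * (thetaV τ u * thetaT τ u)) * x u := fun u => by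
    rw [balancedForm_eq hτ hξ hV hq.entire, hfac]; ring
  obtain ⟨z, hz⟩ := exists_mul_ne_zero dφ (dV.mul dT) (exists_phi_ne_zero n hτ)
    (exists_mul_ne_zero dV dT (exists_thetaV_ne_zero hτ) ⟨0, by
      intro h
      exact thetaV_ne_zero_of_thetaT_eq_zero hτ h ((thetaV_eq_zero_iff hτ).2 ⟨0, 0, by simp⟩)⟩)
  have dG := dφ.mul (dV.mul dT)
  have dVT := dV.mul dT
  refine ⟨x, ⟨hx, ?_, ?_, ?_, ?_⟩, hfac⟩
  · intro u
    refine entire_mul_cancel' (f₁ := fun u => phi n τ u * x u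
        + phi n τ (u + 2 * π / 3) * x (u + 2 * π / 3)
        + phi n τ (u - 2 * π / 3) * x (u - 2 * π / 3)) (f₂ := fun _ => 0) (by fun_prop)
      (by fun_prop) dVT (right_ne_zero_of_mul hz) (fun u => ?_) u
    have h1 := hq.balancedForm_sum hτ u
    have e1 := thetaV_add_third τ (u - 2 * π / 3)
    have e2 := thetaT_add_third τ (u - 2 * π / 3)
    rw [sub_add_cancel] at e1 e2
    rw [hN, hN, hN, thetaV_add_third, thetaT_add_third, ← e1, ← e2] at h1
    simp only [Pi.mul_apply]
    linear_combination h1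
  · have := quotient_quasi_periodic (f := balancedForm n τ q) (ε := fun _ => 1) (e := fun _ => 1)
      (c := 2 * π) dG hx (by fun_prop) (fun _ => one_ne_zero) hN
      (fun u => by rw [hq.balancedForm_periodic hτ, one_mul, one_mul])
      (fun u => by
        simp only [Pi.mul_apply]
        rw [phi_add_two_pi, add_two_pi_of_add_third (thetaV_add_third τ),
          add_two_pi_of_add_third (thetaT_add_third τ), one_mul]) hz
    intro u
    rw [this, one_mul]
  · intro u
    refine entire_mul_cancel' (f₁ := fun u => x (-u)) (by fun_prop) hx dG hz (fun u => ?_) u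
    have h1 := hq.balancedForm_neg hτ u
    rw [hN, hN, phi_neg, thetaV_neg, thetaT_neg] at h1
    simp only [Pi.mul_apply]
    linear_combination h1
  -- The exponent of φVT is (4n + 2) + 6 + 3, which leaves 2n + 1 out of 6n + 12.
  · exact quotient_quasi_periodic (f := balancedForm n τ q)
      (ε := fun u => quasiFactor τ u ^ (2 * n + 1)) (e := fun u => quasiFactor τ u ^ (4 * n + 11))
      dG hx (by fun_prop) (fun u => pow_ne_zero _ (quasiFactor_ne_zero _ _)) hN
      (fun u => by rw [hq.balancedForm_quasi_periodic hτ]; ring)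
      (fun u => by
        simp only [Pi.mul_apply]
        rw [phi_add_tau, thetaV_add_tau, thetaT_add_tau]; ring) hz

end IsSolution

end quotient

/-! ### Second-order expansions of even functions -/

section jets

/-- `f u = a + b u² + O(u⁴)` as `u → 0`. -/
def HasEvenJet (f : ℂ → ℂ) (a b : ℂ) : Prop :=
  (fun u => f u - (a + b * u ^ 2)) =O[𝓝 0] fun u => u ^ 4

theorem isBigO_one_of_continuous {f : ℂ → ℂ} (hf : Continuous f) :
    f =O[𝓝 0] fun _ => (1 : ℂ) :=
  hf.continuousAt.isBigO_one ℂ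

namespace HasEvenJet

variable {f g : ℂ → ℂ} {a b c d : ℂ}

theorem isBigO_one (hf : HasEvenJet f a b) : f =O[𝓝 0] fun _ => (1 : ℂ) := by
  have h1 := hf.trans (isBigO_one_of_continuous (f := fun u => u ^ 4) (by fun_prop))
  have h2 := h1.add (isBigO_one_of_continuous (f := fun u => a + b * u ^ 2) (by fun_prop))
  simpa using h2

theorem mul (hf : HasEvenJet f a b) (hg : HasEvenJet g c d) :
    HasEvenJet (fun u => f u * g u) (a * c) (a * d + b * c) := by
  have h1 := Asymptotics.IsBigO.mul hf hg.isBigO_one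
  have h2 := (isBigO_one_of_continuous (f := fun u => a + b * u ^ 2) (by fun_prop)).mul hg
  have h3 := (Asymptotics.isBigO_refl (fun u : ℂ => u ^ 4) (𝓝 0)).const_mul_left (b * d)
  simp only [mul_one, one_mul] at h1 h2
  refine ((h1.add h2).add h3).congr_left fun u => ?_
  ring

theorem of_const (a : ℂ) : HasEvenJet (fun _ => a) a 0 := by
  unfold HasEvenJet
  simp only [zero_mul, add_zero, sub_self]
  exact Asymptotics.isBigO_zero _ _

/-- Writing the coefficient through b/a avoids the exponent k - 1. -/
theorem pow (hf : HasEvenJet f a b) (ha : a ≠ 0) (k : ℕ) :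
    HasEvenJet (fun u => f u ^ k) (a ^ k) (k * a ^ k * (b / a)) := by
  induction k with
  | zero => simpa using of_const 1
  | succ k ih =>
    have := ih.mul hf
    simp only [← pow_succ] at this
    convert this using 1
    push_cast
    field_simp
    ring

/-- Multiply the candidate jet by f: the product is 1 + O(u⁴), and 1/f is bounded near 0. -/
theorem inv (hf : HasEvenJet f a b) (hc : ContinuousAt f 0) (ha : f 0 = a) (ha0 : a ≠ 0) :
    HasEvenJet (fun u => (f u)⁻¹) a⁻¹ (-b / a ^ 2) := by
  have hw : HasEvenJet (fun u => a⁻¹ + -b / a ^ 2 * u ^ 2) a⁻¹ (-b / a ^ 2) := by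
    unfold HasEvenJet
    simp only [sub_self]
    exact Asymptotics.isBigO_zero _ _
  have h1 := hf.mul hw
  have hne : ∀ᶠ u in 𝓝 0, f u ≠ 0 := hc.eventually_ne (by rwa [ha])
  have h2 := ((hc.inv₀ (by rwa [ha])).isBigO_one ℂ).mul h1
  simp only [one_mul] at h2
  refine h2.neg_left.congr' (hne.mono fun u hu => ?_) .rfl
  have e : a * (-b / a ^ 2) + b * a⁻¹ = 0 := by field_simp; ring
  simp only [e, mul_inv_cancel₀ ha0, Pi.inv_apply]
  field_simp
  ring

theorem of_even (hf : Differentiable ℂ f) (he : ∀ u, f (-u) = f u) :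
    HasEvenJet f (f 0) (deriv (deriv f) 0 / 2) := by
  have he1 : ∀ u, f (-u) = 1 * f u := fun u => by rw [he, one_mul]
  have h1 := deriv_of_neg he1 0
  have h3 := deriv_of_neg (deriv_of_neg (deriv_of_neg he1)) 0
  rw [neg_zero] at h1 h3
  have h1' : deriv f 0 = 0 := by linear_combination h1 / 2
  have h3' : deriv (deriv (deriv f)) 0 = 0 := by linear_combination h3 / 2
  have hp := (hf.analyticAt 0).hasFPowerSeriesAt.isBigO_sub_partialSum_pow 4
  have := hp.trans (Asymptotics.isBigO_of_le (g := fun u : ℂ => u ^ 4) _ fun u => by simp)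
  refine this.congr_left fun u => ?_
  simp [FormalMultilinearSeries.partialSum, Finset.sum_range_succ, iteratedDeriv_succ, h1', h3',
    FormalMultilinearSeries.ofScalars, ContinuousMultilinearMap.mkPiAlgebraFin_apply]

end HasEvenJet

end jets

/-! ### Derivatives at 0 and π/3 -/

section evaluation

variable {n : ℕ} {τ : ℂ} {q ξ : ℂ → ℂ}

theorem deriv_zero_of_even {f : ℂ → ℂ} (he : ∀ u, f (-u) = f u) : deriv f 0 = 0 := by
  have := deriv_of_neg (f := f) (ε := 1) (fun u => by rw [he, one_mul]) 0
  rw [neg_zero] at this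
  linear_combination this / 2

theorem deriv_deriv_zero_of_odd {f : ℂ → ℂ} (ho : ∀ u, f (-u) = -f u) :
    deriv (deriv f) 0 = 0 := by
  refine deriv_zero_of_even fun u => ?_
  rw [deriv_of_neg (ε := -1) (fun u => by rw [ho, neg_one_mul])]
  ring

theorem exists_even_thetaV_factor (hτ : 0 < τ.im) : ∃ ξ : ℂ → ℂ, Differentiable ℂ ξ ∧
    (∀ u, thetaV τ u = theta1 u τ * ξ u) ∧ (∀ u, ξ (-u) = ξ u) ∧ ξ 0 ≠ 0 := by
  obtain ⟨c, hc, h⟩ := exists_thetaV_eq hτ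
  have hθ := differentiable_theta1 hτ
  have h0 : theta1 0 τ = 0 := (theta1_eq_zero_iff hτ).2 ⟨0, 0, by simp⟩
  refine ⟨_, ?_, h, fun u => ?_, mul_ne_zero hc (mul_ne_zero
    (theta1_add_third_ne_zero hτ h0) (theta1_sub_third_ne_zero hτ h0))⟩
  · fun_prop
  · rw [show -u + 2 * π / 3 = -(u - 2 * π / 3) by ring,
      show -u - 2 * π / 3 = -(u + 2 * π / 3) by ring, theta1_neg, theta1_neg]
    ring

theorem deriv_thetaV_zero (hτ : 0 < τ.im) (hξ : Differentiable ℂ ξ)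
    (hV : ∀ u, thetaV τ u = theta1 u τ * ξ u) (he : ∀ u, ξ (-u) = ξ u) :
    deriv (thetaV τ) 0 = deriv (fun u => theta1 u τ) 0 * ξ 0 ∧
    deriv (deriv (deriv (thetaV τ))) 0 = deriv (deriv (deriv fun u => theta1 u τ)) 0 * ξ 0
      + 3 * deriv (fun u => theta1 u τ) 0 * deriv (deriv ξ) 0 := by
  have hθ := differentiable_theta1 hτ
  have hθ' := differentiable_deriv hθ
  have hθ'' := differentiable_deriv hθ'
  have hξ' := differentiable_deriv hξ
  have hξ'' := differentiable_deriv hξ'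
  have h0 : theta1 0 τ = 0 := (theta1_eq_zero_iff hτ).2 ⟨0, 0, by simp⟩
  have h1 := deriv_zero_of_even he
  have h2 := deriv_deriv_zero_of_odd (f := fun u => theta1 u τ) fun u => theta1_neg u τ
  have e1 : deriv (thetaV τ) = fun u =>
      deriv (fun u => theta1 u τ) u * ξ u + theta1 u τ * deriv ξ u := funext fun u => by
    rw [show thetaV τ = fun u => theta1 u τ * ξ u from funext hV,
      deriv_fun_mul (by fun_prop) (by fun_prop)]
  have e2 : deriv (deriv (thetaV τ)) = fun u => deriv (deriv fun u => theta1 u τ) u * ξ u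
      + 2 * (deriv (fun u => theta1 u τ) u * deriv ξ u) + theta1 u τ * deriv (deriv ξ) u :=
    funext fun u => by
      rw [e1, deriv_fun_add (by fun_prop) (by fun_prop), deriv_fun_mul (by fun_prop) (by fun_prop),
        deriv_fun_mul (by fun_prop) (by fun_prop)]
      ring
  constructor
  · rw [e1]; simp only [h0, zero_mul, add_zero]
  · rw [e2, deriv_fun_add (by fun_prop) (by fun_prop), deriv_fun_add (by fun_prop) (by fun_prop),
      deriv_const_mul_field, deriv_fun_mul (by fun_prop) (by fun_prop),
      deriv_fun_mul (by fun_prop) (by fun_prop), deriv_fun_mul (by fun_prop) (by fun_prop), h0, h1, h2]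
    ring

/-- By parity θ₁, θ₁'', ξ', T', q' and V'' all vanish at 0, leaving only these terms. -/
theorem deriv_reducedForm_zero (n : ℕ) (hτ : 0 < τ.im) (hξ : Differentiable ℂ ξ)
    (he : ∀ u, ξ (-u) = ξ u)
    (hq : Differentiable ℂ q) (hqe : ∀ u, q (-u) = q u) :
    deriv (reducedForm n τ ξ q) 0 =
      ξ 0 * thetaT τ 0 * ((2 * n + 1) * deriv (deriv (deriv fun u => theta1 u τ)) 0 * q 0
        + (2 * (2 * n + 1) + 1) * deriv (fun u => theta1 u τ) 0 * deriv (deriv q) 0)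
      - (2 * (2 * n + 1) - 1) * ξ 0 * deriv (deriv (thetaT τ)) 0 * deriv (fun u => theta1 u τ) 0 * q 0
      - 2 * n * deriv (fun u => theta1 u τ) 0 * ξ 0
        * (thetaT τ 0 * deriv (deriv q) 0 - deriv (deriv (thetaT τ)) 0 * q 0)
      - 2 * n * (2 * n + 1) * deriv (deriv ξ) 0 * thetaT τ 0 * deriv (fun u => theta1 u τ) 0 * q 0
      + n ^ 2 * deriv (deriv (deriv (thetaV τ))) 0 * q 0 * thetaT τ 0 := by
  have hθ := differentiable_theta1 hτ
  have hθ' := differentiable_deriv hθ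
  have hθ'' := differentiable_deriv hθ'
  have hq' := differentiable_deriv hq
  have hq'' := differentiable_deriv hq'
  have hT := differentiable_thetaT hτ
  have hT' := differentiable_deriv hT
  have hT'' := differentiable_deriv hT'
  have hξ' := differentiable_deriv hξ
  have hV'' := differentiable_deriv (differentiable_deriv (differentiable_thetaV hτ))
  have h0 : theta1 0 τ = 0 := (theta1_eq_zero_iff hτ).2 ⟨0, 0, by simp⟩
  have h1 := deriv_zero_of_even he
  have h2 := deriv_deriv_zero_of_odd (f := fun u => theta1 u τ) fun u => theta1_neg u τ
  have h3 := deriv_zero_of_even (thetaT_neg τ)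
  have h4 := deriv_zero_of_even hqe
  have h5 := deriv_deriv_zero_of_odd (thetaV_neg τ)
  unfold reducedForm
  simp (disch := fun_prop) only [deriv_fun_add, deriv_fun_sub, deriv_fun_mul, deriv_const,
    h0, h1, h2, h3, h4, h5]
  ring

theorem deriv_hirotaForm {h : ℂ → ℂ} {z : ℂ} (hτ : 0 < τ.im) (hh : Differentiable ℂ h)
    (h1 : thetaV τ z = 0) (h2 : deriv (deriv (thetaV τ)) z = 0) (h3 : deriv (thetaT τ) z = 0) :
    deriv (hirotaForm n τ h) z =
      deriv (thetaV τ) z * (thetaT τ z * deriv (deriv h) z + deriv (deriv (thetaT τ)) z * h z)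
      - 2 * n * deriv (thetaV τ) z * (thetaT τ z * deriv (deriv h) z
        - deriv (deriv (thetaT τ)) z * h z)
      + n ^ 2 * deriv (deriv (deriv (thetaV τ))) z * h z * thetaT τ z := by
  have hh' := differentiable_deriv hh
  have hh'' := differentiable_deriv hh'
  have hT := differentiable_thetaT hτ
  have hT' := differentiable_deriv hT
  have hT'' := differentiable_deriv hT'
  have hV := differentiable_thetaV hτ
  have hV' := differentiable_deriv hV
  have hV'' := differentiable_deriv hV'
  unfold hirotaForm
  simp (disch := fun_prop) only [deriv_fun_add, deriv_fun_sub, deriv_fun_mul, deriv_const, h1, h2, h3]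
  ring

end evaluation

/-! ### The constant E and the final evaluation -/

section main

variable {n : ℕ} {τ : ℂ} {q ξ : ℂ → ℂ}

/-- The constant `E` in terms of logarithmic derivatives, where `θ₁(3u|3τ) = θ₁(u|τ) ξ(u)`. -/
noncomputable def energy (n : ℕ) (τ : ℂ) (ξ : ℂ → ℂ) : ℂ :=
  (deriv (deriv (deriv fun u => theta1 u τ)) 0 / deriv (fun u => theta1 u τ) 0
    - 2 * n * (deriv (deriv ξ) 0 / ξ 0) - deriv (deriv (thetaT τ)) 0 / thetaT τ 0
    - deriv (deriv (thetaTs τ)) 0 / thetaTs τ 0) / 2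

theorem thetaT_zero_ne_zero (hτ : 0 < τ.im) : thetaT τ 0 ≠ 0 := fun h =>
  thetaV_ne_zero_of_thetaT_eq_zero hτ h ((thetaV_eq_zero_iff hτ).2 ⟨0, 0, by simp⟩)

theorem thetaTs_zero_ne_zero (hτ : 0 < τ.im) : thetaTs τ 0 ≠ 0 := fun h => by
  rw [thetaTs_eq] at h
  exact thetaV_ne_zero_of_thetaT_eq_zero hτ h ((thetaV_eq_zero_iff hτ).2 ⟨3, 0, by push_cast; ring⟩)

/-- Away from 0 the factor θ₁²ⁿ cancels, and the quotient becomes u³ψ³/(cξ²ⁿTT*) with ψ = θ₁/u. The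
even functions ψ, ξ, T, T* contribute additively to the relative u² coefficient, which is E. -/
theorem isBigO_thetaQuotient (n : ℕ) (hτ : 0 < τ.im) (hξ : Differentiable ℂ ξ)
    (hV : ∀ u, thetaV τ u = theta1 u τ * ξ u) (he : ∀ u, ξ (-u) = ξ u) (hξ0 : ξ 0 ≠ 0) :
    ∃ E₀ : ℂ, E₀ ≠ 0 ∧
      (fun u : ℂ => thetaQuotient n τ u - (E₀ * u ^ 3 + E₀ * energy n τ ξ * u ^ 5))
        =O[𝓝[≠] 0] (fun u : ℂ => u ^ 7) := by
  have hθ := differentiable_theta1 hτ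
  have h0 : theta1 0 τ = 0 := (theta1_eq_zero_iff hτ).2 ⟨0, 0, by simp⟩
  have hT := differentiable_thetaT hτ
  have hTs := differentiable_thetaTs hτ
  have hT0 := thetaT_zero_ne_zero hτ
  have hTs0 := thetaTs_zero_ne_zero hτ
  obtain ⟨c, hc, h4⟩ := exists_theta4_triple_eq hτ
  obtain ⟨ψ, hψ, hθψ⟩ := exists_entire_quotient (g := fun u => u) hθ differentiable_id
    fun z (hz : z = 0) => ⟨by rw [hz, h0], by simp⟩
  have hψ' := differentiable_deriv hψ
  have hψ'' := differentiable_deriv hψ'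
  have hψe : ∀ u, ψ (-u) = ψ u :=
    entire_mul_cancel' (f₁ := fun u => ψ (-u)) (by fun_prop) hψ differentiable_id one_ne_zero
      fun u => by
        have := theta1_neg u τ
        rw [hθψ, hθψ u] at this
        simp only [id]
        linear_combination -this
  have e1 : (deriv fun u => theta1 u τ) = fun u => ψ u + u * deriv ψ u := funext fun u => by
    rw [show (fun u => theta1 u τ) = fun u => u * ψ u from funext hθψ,
      deriv_fun_mul (by fun_prop) (by fun_prop), deriv_id'', one_mul]
  have e2 : deriv (deriv fun u => theta1 u τ) = fun u => 2 * deriv ψ u + u * deriv (deriv ψ) u :=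
    funext fun u => by
      rw [e1, deriv_fun_add (by fun_prop) (by fun_prop), deriv_fun_mul (by fun_prop) (by fun_prop),
        deriv_id'']
      ring
  have e3 : deriv (deriv (deriv fun u => theta1 u τ)) 0 = 3 * deriv (deriv ψ) 0 := by
    rw [e2, deriv_fun_add (by fun_prop) (by fun_prop), deriv_const_mul_field,
      deriv_fun_mul (by fun_prop) (by fun_prop), deriv_id'']
    ring
  have e1' : deriv (fun u => theta1 u τ) 0 = ψ 0 := by rw [e1]; ring
  have hψ0 : ψ 0 ≠ 0 := by rw [← e1']; exact deriv_theta1_ne_zero hτ h0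
  have jψ := (HasEvenJet.of_even hψ hψe).pow hψ0 3
  have jD := (((HasEvenJet.of_even hξ he).pow hξ0 (2 * n)).mul (HasEvenJet.of_const c)).mul
    ((HasEvenJet.of_even hT (thetaT_neg τ)).mul (HasEvenJet.of_even hTs (thetaTs_neg τ)))
  have dD : Differentiable ℂ fun u => ξ u ^ (2 * n) * c * (thetaT τ u * thetaTs τ u) := by fun_prop
  have jF := jψ.mul (jD.inv dD.continuous.continuousAt rfl (by positivity))
  refine ⟨ψ 0 ^ 3 * (ξ 0 ^ (2 * n) * c * (thetaT τ 0 * thetaTs τ 0))⁻¹, by positivity, ?_⟩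
  have h1 := (Asymptotics.isBigO_refl (fun u : ℂ => u ^ 3) (𝓝 0)).mul jF
  refine (h1.mono nhdsWithin_le_nhds).congr' ?_ (.of_forall fun u => by ring)
  have hne : ∀ᶠ u in 𝓝[≠] (0 : ℂ), ψ u ≠ 0 :=
    (hψ.continuous.continuousAt.eventually_ne hψ0).filter_mono nhdsWithin_le_nhds
  filter_upwards [hne, self_mem_nhdsWithin] with u hu hu0
  have hu0 : u ≠ 0 := hu0
  have hθu : theta1 u τ ≠ 0 := by rw [hθψ]; exact mul_ne_zero hu0 hu
  have hV' : theta1 (3 * u) (3 * τ) = theta1 u τ * ξ u := hV u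
  have hquot : thetaQuotient n τ u = u ^ 3 * (ψ u ^ 3 *
      (ξ u ^ (2 * n) * c * (thetaT τ u * thetaTs τ u))⁻¹) := by
    rw [thetaQuotient, h4, hV', mul_pow, pow_add _ (2 * n), mul_assoc, mul_div_mul_left _ _
      (pow_ne_zero _ hθu), hθψ, mul_pow, div_eq_mul_inv]
    ring
  rw [hquot, energy, e3, e1']
  push_cast
  field_simp
  ring

/-- The proportionality of x and q is evaluated at the simple zeros 0 and π/3 of V, where x is
determined by a first derivative. -/
theorem IsSolution.quadraticForm_eq (hτ : 0 < τ.im) (hq : IsSolution n τ q)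
    (hξ : Differentiable ℂ ξ) (hV : ∀ u, thetaV τ u = theta1 u τ * ξ u)
    (he : ∀ u, ξ (-u) = ξ u) (hξ0 : ξ 0 ≠ 0) :
    q (π * τ / 2) * quadraticForm n τ (energy n τ ξ) q =
      3 * I * deriv q (π + π * τ / 2) * bigPhi τ q 0 (π / 3) := by
  obtain ⟨x, hx, hfac⟩ := hq.exists_reducedBalancedForm_eq hτ hξ hV
  have hcross := hx.cross_eq hτ hq 0 (π / 3)
  have dx := hx.entire
  have dq := hq.entire
  have dV := differentiable_thetaV hτ
  have dT := differentiable_thetaT hτ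
  have dTs := differentiable_thetaTs hτ
  have dφ := differentiable_phi n hτ
  have hT0 := thetaT_zero_ne_zero hτ
  have hTs0 := thetaTs_zero_ne_zero hτ
  have h0 : theta1 0 τ = 0 := (theta1_eq_zero_iff hτ).2 ⟨0, 0, by simp⟩
  have hθ0 : deriv (fun u => theta1 u τ) 0 ≠ 0 := deriv_theta1_ne_zero hτ h0
  obtain ⟨hV1, hV3⟩ := deriv_thetaV_zero hτ hξ hV he
  obtain ⟨V0, Vz, -⟩ := eq_zero_of_odd_of_periodic (thetaV_neg τ) (thetaV_add_third τ)
  obtain ⟨-, T'z, -⟩ := eq_zero_of_odd_of_periodic (deriv_thetaT_neg τ) (deriv_thetaT_add_third τ)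
  obtain ⟨-, V''z, -⟩ := eq_zero_of_odd_of_periodic (deriv_deriv_thetaV_neg τ)
    (deriv_deriv_thetaV_add_third τ)
  have hφz : phi n τ (π / 3) ≠ 0 := by
    have := theta1_third_ne_zero hτ h0 (k := 1) (by decide)
    rw [Int.cast_one, one_mul, zero_add] at this
    exact fun h => this (phi_eq_zero_iff.1 h)
  have shiftV : ∀ u, thetaV τ (u + π / 3) = -1 * thetaV τ u := fun u => by
    rw [thetaV_add_pi_third, neg_one_mul]
  have V1z : deriv (thetaV τ) (π / 3) = -deriv (thetaV τ) 0 := by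
    have := deriv_of_add shiftV 0
    rwa [zero_add, neg_one_mul] at this
  have V3z : deriv (deriv (deriv (thetaV τ))) (π / 3) = -deriv (deriv (deriv (thetaV τ))) 0 := by
    have := deriv_of_add (deriv_of_add (deriv_of_add shiftV)) 0
    rwa [zero_add, neg_one_mul] at this
  have shiftT : ∀ u, thetaT τ (u + π / 3) = thetaTs τ u := fun u => (thetaTs_eq_third τ u).symm
  have Tz : thetaT τ (π / 3) = thetaTs τ 0 := by rw [← shiftT, zero_add]
  have Tsz : thetaTs τ (π / 3) = thetaT τ 0 := by
    rw [thetaTs_eq_third, ← thetaT_add_third τ 0]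
    congr 1; ring
  have T2z : deriv (deriv (thetaT τ)) (π / 3) = deriv (deriv (thetaTs τ)) 0 := by
    rw [← funext shiftT]
    simp only [deriv_comp_add_const (deriv (thetaT τ)), zero_add,
      funext fun u => deriv_comp_add_const (thetaT τ) (π / 3) u]
  have at_zero : deriv (reducedBalancedForm n τ ξ q) 0 =
      deriv (thetaV τ) 0 * (thetaT τ 0 * x 0) := by
    rw [funext hfac, deriv_fun_mul (by fun_prop) (by fun_prop), V0]
    ring
  -- As φ(π/3) ≠ 0, the undivided form can be used here; this is what produces (qφ)''(π/3)/φ(π/3).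
  have at_third : deriv (balancedForm n τ q) (π / 3) =
      phi n τ (π / 3) * (deriv (thetaV τ) (π / 3) * (thetaT τ (π / 3) * x (π / 3))) := by
    rw [show balancedForm n τ q = fun u => thetaV τ u * (phi n τ u * (thetaT τ u * x u)) from
      funext fun u => by rw [balancedForm_eq hτ hξ hV dq, hfac]; ring,
      deriv_fun_mul (by fun_prop) (by fun_prop), Vz]
    ring
  have dr := differentiable_reducedForm n hτ hξ dq
  have hh := (hq.isOddSolution hτ).entire
  have dη : Differentiable ℂ (hirotaForm n τ fun u => phi n τ u * q u) := by
    rw [funext (hirotaForm_phi_mul hτ hξ hV dq)]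
    fun_prop
  unfold reducedBalancedForm at at_zero
  rw [deriv_fun_add (by fun_prop) (by fun_prop), deriv_const_mul_field, deriv_const_mul_field,
    deriv_fun_mul (by fun_prop) (by fun_prop), deriv_fun_mul (by fun_prop) (by fun_prop), V0,
    deriv_reducedForm_zero n hτ hξ he dq hq.even, hV3, hV1, zero_add] at at_zero
  unfold balancedForm at at_third
  rw [deriv_fun_add (by fun_prop) (by fun_prop), deriv_const_mul_field, deriv_const_mul_field,
    deriv_fun_mul (by fun_prop) (by fun_prop), deriv_fun_mul (by fun_prop) (by fun_prop),
    deriv_fun_mul (by fun_prop) (by fun_prop), Vz, deriv_hirotaForm hτ hh Vz V''z T'z,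
    V1z, V3z, hV3, hV1, Tz, Tsz, T2z] at at_third
  have hbig : bigPhi τ q 0 (π / 3) = thetaT τ 0 ^ 2 * q 0 * q (π / 3 + π)
      - thetaTs τ 0 ^ 2 * q π * q (π / 3) := by
    change thetaT τ 0 * thetaTs τ (π / 3) * q 0 * q (π / 3 + π)
      - thetaTs τ 0 * thetaT τ (π / 3) * q (0 + π) * q (π / 3) = _
    rw [Tz, Tsz, zero_add]
    ring
  rw [hbig, quadraticForm, energy]
  simp only [iteratedDeriv_succ, iteratedDeriv_zero, mul_comm (q _) (phi n τ _)]
  generalize deriv (deriv fun u => phi n τ u * q u) (π / 3) = h'' at *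
  generalize deriv (deriv (deriv fun u => theta1 u τ)) 0 = θ₃ at *
  generalize deriv (fun u => theta1 u τ) 0 = θ₁ at *
  generalize deriv (deriv ξ) 0 = ξ₂ at *
  generalize deriv (deriv (thetaT τ)) 0 = T₂ at *
  generalize deriv (deriv (thetaTs τ)) 0 = S₂ at *
  generalize deriv (deriv q) 0 = q₂ at *
  generalize deriv q (π + π * τ / 2) = q' at *
  generalize phi n τ (π / 3) = φ₁ at *
  generalize thetaT τ 0 = T₀ at *
  generalize thetaTs τ 0 = S₀ at *
  generalize ξ 0 = ξ₀ at *
  generalize q (π * τ / 2) = q₀ at *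
  generalize q (π / 3 + π) = p₁ at *
  generalize q π = p₀ at *
  generalize q (π / 3) = q₁ at *
  generalize q 0 = r₀ at *
  generalize x 0 = x₀ at *
  generalize x (π / 3) = x₁ at *
  have hx₀ : x₀ = q₀ * ((2 * n + 3) * q₂ + r₀ * ((n + 1) ^ 2 * (θ₃ / θ₁)
      - n * (n + 2) * (ξ₂ / ξ₀) - (2 * n + 1) * (T₂ / T₀))) + 3 * I * q' * S₀ ^ 2 * p₀ := by
    field_simp
    linear_combination -at_zero
  have hx₁ : x₁ = q₀ * ((1 - 2 * n) * (h'' / φ₁) + q₁ * ((2 * n + 1) * (S₂ / S₀)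
      + n ^ 2 * (θ₃ / θ₁ + 3 * (ξ₂ / ξ₀)))) + 3 * I * q' * T₀ ^ 2 * p₁ := by
    field_simp
    linear_combination at_third
  rw [hx₀, hx₁] at hcross
  -- The theta constants match E because (n+1)² - n² = 2n + 1 and n(n+2) + 3n² = 2n(2n+1).
  linear_combination hcross

end main

end XYZChain

theorem corollary3p12 (n : ℕ) (τ : ℂ) (hτ : 0 < τ.im) :
    ∃ E₀ E : ℂ, E₀ ≠ 0 ∧
      (fun u : ℂ => XYZChain.thetaQuotient n τ u - (E₀ * u ^ 3 + E₀ * E * u ^ 5))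
        =O[𝓝[≠] 0] (fun u : ℂ => u ^ 7) ∧
      ∀ q : ℂ → ℂ, XYZChain.IsQEigenvalue n τ q →
        q (π * τ / 2) * XYZChain.quadraticForm n τ E q
            = 3 * I * deriv q (π + π * τ / 2) * XYZChain.bigPhi τ q 0 (π / 3) ∧
        (q (π * τ / 2) ≠ 0 →
          XYZChain.quadraticForm n τ E q
            = 3 * I * (deriv q (π + π * τ / 2) / q (π * τ / 2))
                * XYZChain.bigPhi τ q 0 (π / 3)) := by
  obtain ⟨ξ, hξ, hV, he, hξ0⟩ := XYZChain.exists_even_thetaV_factor hτ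
  obtain ⟨E₀, hE₀, hO⟩ := XYZChain.isBigO_thetaQuotient n hτ hξ hV he hξ0
  refine ⟨E₀, XYZChain.energy n τ ξ, hE₀, hO, fun q hq => ?_⟩
  have key := hq.isSolution.quadraticForm_eq hτ hξ hV he hξ0
  refine ⟨key, fun h => mul_left_cancel₀ h ?_⟩
  rw [key]
  field_simp
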